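/- **Setting.** Let $\Omega\subset\mathbb R^d$, $d\ge 2$, be a bounded domain with (polyhedral) Lipschitz boundary, $I=(0,T)$ with $0<T<\infty$, and let $p\in(1,\infty)$ with $p\ge\frac{2d}{d+2}$, $p'=\frac p{p-1}$. For $\delta\in[0,1]$ and $P\in\mathbb R^{d\times d}$ with symmetric part $P^{\rm sym}$ and Hilbert–Schmidt norm $|\cdot|$ put $$S(P)=(\delta+|P^{\rm sym}|)^{p-2}P^{\rm sym},\qquad F(P)=(\delta+|P^{\rm sym}|)^{\frac{p-2}{2}}P^{\rm sym},\qquad S(P)=F(P)=0\ \text{ if } P^{\rm sym}=0,$$ and $Du=\frac12(\nabla u+\nabla u^\top)$. $(\cdot,\cdot)$ denotes the $L^2(\Omega)$ pairing and $W^{1,p}_{0,\operatorname{div}}(\Omega)$ the space of divergence-free fields in $W^{1,p}_0(\Omega)$. Let $\mathcal T_h$ be a finite decomposition of $\Omega$ into nondegenerate simplices without hanging nodes, with mesh size $h$, such that $h_T/\rho_T\le\sigma_0$ for all $T\in\mathcal T_h$ ($h_T$ the diameter of $T$, $\rho_T$ the diameter of the largest closed ball in $\overline T$). For $k,r\in\mathbb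 N_0$ let $X_h$ be the space of all $v\in W^{1,p}_0(\Omega)^d$ that are polynomials of degree $\le k$ on each $T$, $Y_h$ the space of all $q\in L^{p'}(\Omega)$ that are polynomials of degree $\le r$ on each $T$, and $V_h=\{v\in X_h:(q,\operatorname{div}v)=0\ \forall q\in Y_h\}$. With $S_T$ the interior of the union of the closed simplices that touch $T$, assume that - $X_h$ contains all continuous piecewise affine fields vanishing on $\partial\Omega$, and $Y_h$ contains all piecewise constants; - there are linear projections $\Pi^{\rm div}_h:W^{1,p}_0(\Omega)\to X_h$ and $\Pi^Y_h:L^{p'}(\Omega)\to Y_h$ and a constant $c$ such that $(\operatorname{div}w,q)=(\operatorname{div}\Pi^{\rm div}_hw,q)$ for all $w\in W^{1,p}_0(\Omega)$, $q\in Y_h$; such that on every $T$, with the mean values $\langle g\rangle_A=\frac1{|A|}\int_Ag\,dx$, $\langle|\Pi^{\rm div}_hw|\rangle_T\le c\langle|w|\rangle_{S_T}+c\,h_T\langle|\nabla w|\rangle_{S_T}$ and $\langle|\Pi_h^Yq|\rangle_T\le c\langle|q|\rangle_{S_T}$ for all $w\in W^{1,p}_0(\Omega)$, $q\in L^{p'}(\Omega)$;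 and such that $\Pi^{\rm div}_hw=w$ for every continuous piecewise affine $w$ vanishing on $\partial\Omega$. Let $f\in W^{1,2}(I,L^2(\Omega))$ (with its continuous representative on $\overline I$) and $u_0\in W^{1,p}_{0,\operatorname{div}}(\Omega)$, and let $M_1,M_3>0$ be such that $$\|f\|_{W^{1,2}(I,L^2(\Omega))}+\|u_0\|_{W^{1,p}(\Omega)}\le M_1,\qquad \|\nabla S(Du_0)\|_{L^2(\Omega)}\le M_3 .$$ **Theorem.** There is a unique $u_0^h\in V_h$ with $$(S(Du_0^h),D\xi_h)=(S(Du_0),D\xi_h)\qquad\text{for all }\xi_h\in V_h .$$ For this $u_0^h$ there is a unique $u_h\in C^1(\overline I,V_h)$ such that $u_h(0)=u_0^h$ and, for every $t\in\overline I$, $$(\partial_tu_h(t),\xi_h)+(S(Du_h(t)),D\xi_h)=(f(t),\xi_h)\qquad\text{for all }\xi_h\in V_h .$$ The function $F(Du_h)$ belongs to $W^{1,2}(I,L^2(\Omega))$, and $$\|u_h\|_{L^\infty(I,L^2(\Omega))}+\|F(Du_h)\|_{L^2(I,L^2(\Omega))}\le c_1,$$ $$\|\partial_tu_h\|_{L^2(I,L^2(\Omega))}+\|F(Du_h)\|_{L^\infty(I,L^2(\Omega))}\le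 c_1,$$ $$\|\partial_tu_h\|_{L^\infty(I,L^2(\Omega))}+\|\partial_tF(Du_h)\|_{L^2(I,L^2(\Omega))}\le c_2,$$ where $c_1$ depends only on $\Omega$ (and $d$), $p$, $T$ and $M_1$, and $c_2$ only on these and $M_3$; in particular both are independent of $h$, of the mesh and of $\delta\in[0,1]$. -/

import Mathlib

open MeasureTheory Set Filter Topology
open scoped ContDiff ENNReal

noncomputable section

/-! ## Vectors, tensors and the extra stress -/

/-- The space `ℝ^d` with the Euclidean norm. -/
abbrev RVec (d : ℕ) : Type := EuclideanSpace ℝ (Fin d)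

/-- The space `ℝ^{d×d}`; the norm is the Hilbert-Schmidt norm and `inner ℝ A B` is `A : B`. -/
abbrev RTen (d : ℕ) : Type := EuclideanSpace ℝ (Fin d × Fin d)

/-- The symmetric part `(A + Aᵀ)/2`. -/
def symPart {d : ℕ} (A : RTen d) : RTen d :=
  WithLp.toLp 2 fun ij => (A (ij.1, ij.2) + A (ij.2, ij.1)) / 2

/-- The derivative `φ'(s) = (δ + s)^{p-2} s` of the `N`-function `φ`. -/
def phiDeriv (δ p s : ℝ) : ℝ := (δ + s) ^ (p - 2) * s

/-- The extra stress tensor with `N`-potential `φ`: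
`S(P) = φ'(|P^sym|) P^sym / |P^sym|`, and `S(P) = 0` where `P^sym = 0`. -/
def stressS {d : ℕ} (δ p : ℝ) (P : RTen d) : RTen d :=
  (phiDeriv δ p ‖symPart P‖ / ‖symPart P‖) • symPart P

/-- `F(P) = (δ + |P^sym|)^{(p-2)/2} P^sym`. -/
def tensorF {d : ℕ} (δ p : ℝ) (P : RTen d) : RTen d :=
  ((δ + ‖symPart P‖) ^ ((p - 2) / 2)) • symPart P

/-! ## Weak derivatives and Sobolev spaces -/

/-- The Lebesgue measure on `Ω`. -/
abbrev volOn {d : ℕ} (Ω : TopologicalSpace.Opens (RVec d)) : Measure (RVec d) :=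
  volume.restrict (Ω : Set (RVec d))

section Sobolev

variable {d : ℕ} {ι : Type} [Fintype ι]

/-- The classical gradient, `(∇w)_{(i,j)} = ∂_j w_i`. -/
def classGrad (w : RVec d → EuclideanSpace ℝ ι) (x : RVec d) :
    EuclideanSpace ℝ (ι × Fin d) :=
  WithLp.toLp 2 fun ij => fderiv ℝ w x (EuclideanSpace.single ij.2 1) ij.1

/-- `G` is the weak gradient of `u` on `Ω`, `G_{(i,j)} = ∂_j u_i`. -/
def HasWeakGrad (Ω : TopologicalSpace.Opens (RVec d)) (u : RVec d → EuclideanSpace ℝ ι)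
    (G : RVec d → EuclideanSpace ℝ (ι × Fin d)) : Prop :=
  LocallyIntegrableOn u Ω ∧ LocallyIntegrableOn G Ω ∧
  ∀ η : RVec d → ℝ, ContDiff ℝ ∞ η → HasCompactSupport η → tsupport η ⊆ Ω → ∀ i j,
    ∫ x in (Ω : Set (RVec d)), u x i * fderiv ℝ η x (EuclideanSpace.single j 1) =
      - ∫ x in (Ω : Set (RVec d)), G x (i, j) * η x

open Classical in
/-- The weak gradient of `u` on `Ω` (unique up to null sets in `Ω`); `0` if there is none. -/
def weakGrad (Ω : TopologicalSpace.Opens (RVec d)) (u : RVec d → EuclideanSpace ℝ ι) :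
    RVec d → EuclideanSpace ℝ (ι × Fin d) :=
  if h : ∃ G, HasWeakGrad Ω u G then h.choose else 0

/-- `u ∈ W^{1,p}_0(Ω)`: `u` lies in `W^{1,p}(Ω)` and is the limit in the `W^{1,p}`-norm of a sequence
of smooth fields with compact support in `Ω`. -/
def MemW0 (Ω : TopologicalSpace.Opens (RVec d)) (p : ℝ) (u : RVec d → EuclideanSpace ℝ ι) : Prop :=
  ∃ G : RVec d → EuclideanSpace ℝ (ι × Fin d), HasWeakGrad Ω u G ∧
    MemLp u (ENNReal.ofReal p) (volOn Ω) ∧ MemLp G (ENNReal.ofReal p) (volOn Ω) ∧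
    ∃ w : ℕ → RVec d → EuclideanSpace ℝ ι,
      (∀ n, ContDiff ℝ ∞ (w n) ∧ HasCompactSupport (w n) ∧ tsupport (w n) ⊆ Ω) ∧
      Tendsto (fun n => eLpNorm (u - w n) (ENNReal.ofReal p) (volOn Ω)) atTop (𝓝 0) ∧
      Tendsto (fun n => eLpNorm (G - classGrad (w n)) (ENNReal.ofReal p) (volOn Ω)) atTop (𝓝 0)

end Sobolev

section SobolevFacts

variable {d : ℕ} {ι : Type} [Fintype ι] {Ω : TopologicalSpace.Opens (RVec d)}

theorem integrableOn_mul_test {f g : RVec d → ℝ} (hf : LocallyIntegrableOn f Ω)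
    (hg : Continuous g) (hgc : HasCompactSupport g) (hgΩ : tsupport g ⊆ Ω) :
    IntegrableOn (fun x => f x * g x) (Ω : Set (RVec d)) := by
  have h1 : IntegrableOn f (tsupport g) := hf.integrableOn_compact_subset hgΩ hgc
  have h2 : IntegrableOn (fun x => f x * g x) (tsupport g) :=
    h1.mul_continuousOn hg.continuousOn hgc
  refine (h2.integrable_of_forall_notMem_eq_zero fun x hx => ?_).integrableOn
  rw [image_eq_zero_of_notMem_tsupport hx, mul_zero]

theorem locallyIntegrableOn_coord {f : RVec d → EuclideanSpace ℝ ι}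
    (hf : LocallyIntegrableOn f Ω) (i : ι) : LocallyIntegrableOn (fun x => f x i) Ω :=
  (EuclideanSpace.proj (𝕜 := ℝ) i : EuclideanSpace ℝ ι →L[ℝ] ℝ).locallyIntegrableOn_comp hf

theorem tsupport_partial_subset {η : RVec d → ℝ} (v : RVec d) :
    tsupport (fun x => fderiv ℝ η x v) ⊆ tsupport η := by
  refine closure_minimal (fun x hx => ?_) (isClosed_tsupport η)
  refine support_fderiv_subset ℝ (fun h => hx ?_)
  simp [h]

theorem integrableOn_mul_partial {f : RVec d → ℝ} {η : RVec d → ℝ} (v : RVec d)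
    (hf : LocallyIntegrableOn f Ω) (hη : ContDiff ℝ ∞ η) (hc : HasCompactSupport η)
    (hs : tsupport η ⊆ Ω) :
    IntegrableOn (fun x => f x * fderiv ℝ η x v) (Ω : Set (RVec d)) :=
  integrableOn_mul_test hf ((hη.continuous_fderiv (by simp)).clm_apply continuous_const)
    (hc.fderiv_apply (𝕜 := ℝ) v) ((tsupport_partial_subset v).trans hs)

theorem HasWeakGrad.add {u v : RVec d → EuclideanSpace ℝ ι}
    {G H : RVec d → EuclideanSpace ℝ (ι × Fin d)}
    (hu : HasWeakGrad Ω u G) (hv : HasWeakGrad Ω v H) : HasWeakGrad Ω (u + v) (G + H) := by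
  refine ⟨hu.1.add hv.1, hu.2.1.add hv.2.1, fun η h1 h2 h3 i j => ?_⟩
  have e1 := hu.2.2 η h1 h2 h3 i j
  have e2 := hv.2.2 η h1 h2 h3 i j
  simp only [Pi.add_apply, PiLp.add_apply, add_mul]
  rw [integral_add (integrableOn_mul_partial _ (locallyIntegrableOn_coord hu.1 i) h1 h2 h3)
      (integrableOn_mul_partial _ (locallyIntegrableOn_coord hv.1 i) h1 h2 h3),
    integral_add
      (integrableOn_mul_test (locallyIntegrableOn_coord hu.2.1 (i, j)) h1.continuous h2 h3)
      (integrableOn_mul_test (locallyIntegrableOn_coord hv.2.1 (i, j)) h1.continuous h2 h3),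
    e1, e2]
  ring

theorem HasWeakGrad.smul {u : RVec d → EuclideanSpace ℝ ι}
    {G : RVec d → EuclideanSpace ℝ (ι × Fin d)} (c : ℝ)
    (hu : HasWeakGrad Ω u G) : HasWeakGrad Ω (c • u) (c • G) := by
  refine ⟨hu.1.smul c, hu.2.1.smul c, fun η h1 h2 h3 i j => ?_⟩
  have e1 := hu.2.2 η h1 h2 h3 i j
  simp only [Pi.smul_apply, PiLp.smul_apply, smul_eq_mul, mul_assoc]
  rw [integral_const_mul, integral_const_mul, e1]
  ring

theorem HasWeakGrad.congr {u v : RVec d → EuclideanSpace ℝ ι}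
    {G H : RVec d → EuclideanSpace ℝ (ι × Fin d)} (hu : HasWeakGrad Ω u G)
    (huv : u =ᵐ[volOn Ω] v) (hGH : G =ᵐ[volOn Ω] H) : HasWeakGrad Ω v H := by
  refine ⟨hu.1.congr huv, hu.2.1.congr hGH, fun η h1 h2 h3 i j => ?_⟩
  have e1 := hu.2.2 η h1 h2 h3 i j
  have a1 : ∫ x in (Ω : Set (RVec d)), u x i * fderiv ℝ η x (EuclideanSpace.single j 1) =
      ∫ x in (Ω : Set (RVec d)), v x i * fderiv ℝ η x (EuclideanSpace.single j 1) :=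
    integral_congr_ae (by filter_upwards [huv] with x hx; rw [hx])
  have a2 : ∫ x in (Ω : Set (RVec d)), G x (i, j) * η x =
      ∫ x in (Ω : Set (RVec d)), H x (i, j) * η x :=
    integral_congr_ae (by filter_upwards [hGH] with x hx; rw [hx])
  rw [← a1, ← a2, e1]

theorem HasWeakGrad.zero :
    HasWeakGrad Ω (0 : RVec d → EuclideanSpace ℝ ι) 0 := by
  refine ⟨locallyIntegrableOn_zero, locallyIntegrableOn_zero, fun η h1 h2 h3 i j => ?_⟩
  simp

/-- Weak gradients are unique almost everywhere. -/
theorem HasWeakGrad.unique {u : RVec d → EuclideanSpace ℝ ι}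
    {G H : RVec d → EuclideanSpace ℝ (ι × Fin d)}
    (hG : HasWeakGrad Ω u G) (hH : HasWeakGrad Ω u H) : G =ᵐ[volOn Ω] H := by
  have key : ∀ k : ι × Fin d, ∀ᵐ x ∂(volOn Ω), G x k = H x k := by
    rintro ⟨i, j⟩
    rw [ae_restrict_iff' Ω.isOpen.measurableSet]
    have hl : LocallyIntegrableOn (fun x => G x (i, j) - H x (i, j)) (Ω : Set (RVec d)) :=
      (locallyIntegrableOn_coord hG.2.1 (i, j)).sub (locallyIntegrableOn_coord hH.2.1 (i, j))
    have := Ω.isOpen.ae_eq_zero_of_integral_contDiff_smul_eq_zero (μ := volume) hl ?_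
    · filter_upwards [this] with x hx hxΩ
      exact sub_eq_zero.1 (hx hxΩ)
    · intro η h1 h2 h3
      have e1 := hG.2.2 η h1 h2 h3 i j
      have e2 := hH.2.2 η h1 h2 h3 i j
      have hz : ∀ x, x ∉ (Ω : Set (RVec d)) → η x • (G x (i, j) - H x (i, j)) = 0 := by
        intro x hx
        rw [image_eq_zero_of_notMem_tsupport (fun h => hx (h3 h)), zero_smul]
      rw [← setIntegral_eq_integral_of_forall_compl_eq_zero hz]
      have : ∀ x, η x • (G x (i, j) - H x (i, j)) = G x (i, j) * η x - H x (i, j) * η x := by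
        intro x; rw [smul_eq_mul]; ring
      simp only [this]
      rw [integral_sub
        (integrableOn_mul_test (locallyIntegrableOn_coord hG.2.1 (i, j)) h1.continuous h2 h3)
        (integrableOn_mul_test (locallyIntegrableOn_coord hH.2.1 (i, j)) h1.continuous h2 h3)]
      linarith
  filter_upwards [ae_all_iff.2 key] with x hx
  ext k
  exact hx k

theorem weakGrad_ae_eq {u : RVec d → EuclideanSpace ℝ ι}
    {G : RVec d → EuclideanSpace ℝ (ι × Fin d)} (hG : HasWeakGrad Ω u G) :
    weakGrad Ω u =ᵐ[volOn Ω] G := by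
  have h : ∃ G, HasWeakGrad Ω u G := ⟨G, hG⟩
  rw [weakGrad, dif_pos h]
  exact h.choose_spec.unique hG

theorem HasWeakGrad.weakGrad {u : RVec d → EuclideanSpace ℝ ι}
    {G : RVec d → EuclideanSpace ℝ (ι × Fin d)} (hG : HasWeakGrad Ω u G) :
    HasWeakGrad Ω u (weakGrad Ω u) :=
  hG.congr (ae_eq_refl u) (weakGrad_ae_eq hG).symm

theorem classGrad_add {v w : RVec d → EuclideanSpace ℝ ι} (hv : ContDiff ℝ ∞ v)
    (hw : ContDiff ℝ ∞ w) : classGrad (v + w) = classGrad v + classGrad w := by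
  funext x
  ext k
  have := fderiv_add (hv.differentiable (by simp) x) (hw.differentiable (by simp) x)
  simp [classGrad, this]

theorem classGrad_smul (c : ℝ) {w : RVec d → EuclideanSpace ℝ ι} (hw : ContDiff ℝ ∞ w) :
    classGrad (c • w) = c • classGrad w := by
  funext x
  ext k
  have := fderiv_const_smul (hw.differentiable (by simp) x) c
  simp [classGrad, this]

theorem continuous_classGrad {w : RVec d → EuclideanSpace ℝ ι} (hw : ContDiff ℝ ∞ w) :
    Continuous (classGrad w) := by
  refine (PiLp.continuous_toLp 2 _).comp (continuous_pi fun k => ?_)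
  exact (EuclideanSpace.proj (𝕜 := ℝ) k.1 : EuclideanSpace ℝ ι →L[ℝ] ℝ).continuous.comp
    ((hw.continuous_fderiv (by simp)).clm_apply continuous_const)

theorem tendsto_eLpNorm_add {V : Type} [NormedAddCommGroup V] {p : ℝ≥0∞}
    {a b : ℕ → RVec d → V}
    (ha : ∀ n, AEStronglyMeasurable (a n) (volOn Ω))
    (hb : ∀ n, AEStronglyMeasurable (b n) (volOn Ω))
    (ta : Tendsto (fun n => eLpNorm (a n) p (volOn Ω)) atTop (𝓝 0))
    (tb : Tendsto (fun n => eLpNorm (b n) p (volOn Ω)) atTop (𝓝 0)) :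
    Tendsto (fun n => eLpNorm (a n + b n) p (volOn Ω)) atTop (𝓝 0) := by
  have h : Tendsto (fun n => ENNReal.LpAddConst p *
      (eLpNorm (a n) p (volOn Ω) + eLpNorm (b n) p (volOn Ω))) atTop (𝓝 0) := by
    have := ENNReal.Tendsto.const_mul (a := ENNReal.LpAddConst p) (ta.add tb)
      (Or.inr (ENNReal.LpAddConst_lt_top p).ne)
    simpa using this
  exact tendsto_of_tendsto_of_tendsto_of_le_of_le tendsto_const_nhds h (fun n => zero_le)
    (fun n => eLpNorm_add_le' (ha n) (hb n) p)

theorem MemW0.add {p : ℝ} {u v : RVec d → EuclideanSpace ℝ ι}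
    (hu : MemW0 Ω p u) (hv : MemW0 Ω p v) : MemW0 Ω p (u + v) := by
  obtain ⟨G, hG, u1, G1, w, hw, tw, tw'⟩ := hu
  obtain ⟨H, hH, v1, H1, z, hz, tz, tz'⟩ := hv
  refine ⟨G + H, hG.add hH, u1.add v1, G1.add H1, fun n => w n + z n, fun n => ⟨?_, ?_, ?_⟩, ?_, ?_⟩
  · exact (hw n).1.add (hz n).1
  · exact (hw n).2.1.add (hz n).2.1
  · exact (tsupport_add (w n) (z n)).trans (union_subset (hw n).2.2 (hz n).2.2)
  · have := tendsto_eLpNorm_add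
      (fun n => u1.1.sub (hw n).1.continuous.aestronglyMeasurable)
      (fun n => v1.1.sub (hz n).1.continuous.aestronglyMeasurable) tw tz
    refine this.congr fun n => ?_
    rw [add_sub_add_comm]
  · have := tendsto_eLpNorm_add
      (fun n => G1.1.sub (continuous_classGrad (hw n).1).aestronglyMeasurable)
      (fun n => H1.1.sub (continuous_classGrad (hz n).1).aestronglyMeasurable) tw' tz'
    refine this.congr fun n => ?_
    rw [classGrad_add (hw n).1 (hz n).1, add_sub_add_comm]

theorem MemW0.smul {p : ℝ} (c : ℝ) {u : RVec d → EuclideanSpace ℝ ι}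
    (hu : MemW0 Ω p u) : MemW0 Ω p (c • u) := by
  obtain ⟨G, hG, u1, G1, w, hw, tw, tw'⟩ := hu
  have lim : ∀ {V : Type} [NormedAddCommGroup V] [NormedSpace ℝ V] {a : ℕ → RVec d → V},
      Tendsto (fun n => eLpNorm (a n) (ENNReal.ofReal p) (volOn Ω)) atTop (𝓝 0) →
      Tendsto (fun n => eLpNorm (c • a n) (ENNReal.ofReal p) (volOn Ω)) atTop (𝓝 0) := by
    intro V _ _ a ha
    have := ENNReal.Tendsto.const_mul (a := ‖c‖ₑ) ha (Or.inr enorm_ne_top)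
    simpa [eLpNorm_const_smul] using this
  refine ⟨c • G, hG.smul c, u1.const_smul c, G1.const_smul c, fun n => c • w n,
    fun n => ⟨?_, ?_, ?_⟩, ?_, ?_⟩
  · exact contDiff_const.smul (hw n).1
  · exact (hw n).2.1.smul_left (f := fun _ => c)
  · exact (tsupport_smul_subset_right (fun _ => c) (w n)).trans (hw n).2.2
  · refine (lim tw).congr fun n => ?_
    rw [smul_sub]
  · refine (lim tw').congr fun n => ?_
    rw [classGrad_smul c (hw n).1, smul_sub]

theorem MemW0.zero {p : ℝ} : MemW0 Ω p (0 : RVec d → EuclideanSpace ℝ ι) := by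
  have hc : classGrad (0 : RVec d → EuclideanSpace ℝ ι) = 0 := by
    funext x
    ext k
    have : fderiv ℝ (0 : RVec d → EuclideanSpace ℝ ι) x = 0 := fderiv_const_apply 0
    simp [classGrad, this]
  refine ⟨0, HasWeakGrad.zero, MemLp.zero, MemLp.zero, fun _ => 0, fun n => ⟨?_, ?_, ?_⟩, ?_, ?_⟩
  · exact contDiff_const
  · exact HasCompactSupport.zero
  · simp [tsupport]
  · simp
  · simp [hc]

theorem MemW0.congr {p : ℝ} {u v : RVec d → EuclideanSpace ℝ ι}
    (hu : MemW0 Ω p u) (huv : u =ᵐ[volOn Ω] v) : MemW0 Ω p v := by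
  obtain ⟨G, hG, u1, G1, w, hw, tw, tw'⟩ := hu
  refine ⟨G, hG.congr huv (ae_eq_refl G), (memLp_congr_ae huv).1 u1, G1, w, hw, ?_, tw'⟩
  refine tw.congr fun n => eLpNorm_congr_ae ?_
  filter_upwards [huv] with x hx
  simp [hx]

theorem MemW0.hasWeakGrad {p : ℝ} {u : RVec d → EuclideanSpace ℝ ι} (hu : MemW0 Ω p u) :
    HasWeakGrad Ω u (weakGrad Ω u) :=
  hu.choose_spec.1.weakGrad

theorem MemW0.memLp_weakGrad {p : ℝ} {u : RVec d → EuclideanSpace ℝ ι} (hu : MemW0 Ω p u) :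
    MemLp (weakGrad Ω u) (ENNReal.ofReal p) (volOn Ω) :=
  (memLp_congr_ae (weakGrad_ae_eq hu.choose_spec.1)).2 hu.choose_spec.2.2.1

end SobolevFacts

section Spaces

variable {d : ℕ}

/-- The space `W^{1,p}_0(Ω)` of vector fields (classes of a.e. equal fields on `Ω`). -/
def W01 (Ω : TopologicalSpace.Opens (RVec d)) (p : ℝ) :
    Submodule ℝ (RVec d →ₘ[volOn Ω] RVec d) where
  carrier := {u | MemW0 Ω p u}
  add_mem' := fun {u v} hu hv => (MemW0.add hu hv).congr (AEEqFun.coeFn_add u v).symm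
  zero_mem' := MemW0.zero.congr AEEqFun.coeFn_zero.symm
  smul_mem' := fun c u hu => (MemW0.smul c hu).congr (AEEqFun.coeFn_smul c u).symm

/-- The symmetric gradient `Du`. -/
def symGrad (Ω : TopologicalSpace.Opens (RVec d)) (u : RVec d → RVec d) (x : RVec d) : RTen d :=
  symPart (weakGrad Ω u x)

/-- The weak divergence. -/
def weakDiv (Ω : TopologicalSpace.Opens (RVec d)) (u : RVec d → RVec d) (x : RVec d) : ℝ :=
  ∑ i, weakGrad Ω u x (i, i)

end Spaces

/-! ## Domain and triangulation -/

section Mesh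

variable {d : ℕ}

/-- `Ω` has Lipschitz boundary: near every boundary point and in suitable orthonormal coordinates,
`Ω` is the set of points above the graph of a Lipschitz function. Here `ν` is the vertical direction
and `γ` is evaluated at the projection of `y` onto the hyperplane orthogonal to `ν`. -/
def HasLipschitzBoundary (Ω : Set (RVec d)) : Prop :=
  ∀ x ∈ frontier Ω, ∃ ν : RVec d, ‖ν‖ = 1 ∧ ∃ (K : NNReal) (γ : RVec d → ℝ) (ρ : ℝ),
    LipschitzWith K γ ∧ 0 < ρ ∧
      ∀ y ∈ Metric.ball x ρ, (y ∈ Ω ↔ γ (y - inner ℝ ν y • ν) < inner ℝ ν y)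

/-- A finite decomposition of `Ω` into nondegenerate simplices without hanging nodes. A simplex is
given by its set of `d + 1` vertices; two simplices meet exactly in the common face spanned by their
common vertices. -/
structure Triangulation (Ω : TopologicalSpace.Opens (RVec d)) where
  cells : Finset (Finset (RVec d))
  card_eq : ∀ s ∈ cells, s.card = d + 1
  affineIndependent : ∀ s ∈ cells, AffineIndependent ℝ ((↑) : s → RVec d)
  conforming : ∀ s ∈ cells, ∀ t ∈ cells,
    convexHull ℝ (s : Set (RVec d)) ∩ convexHull ℝ (t : Set (RVec d)) =
      convexHull ℝ ((s : Set (RVec d)) ∩ (t : Set (RVec d)))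
  iUnion_eq : ⋃ s ∈ cells, convexHull ℝ (s : Set (RVec d)) = closure (Ω : Set (RVec d))

/-- The closed simplex with vertex set `s`. -/
def closedCell (s : Finset (RVec d)) : Set (RVec d) := convexHull ℝ (s : Set (RVec d))

/-- `h_T`, the diameter of the simplex. -/
def cellDiam (s : Finset (RVec d)) : ℝ := Metric.diam (closedCell s)

/-- `ρ_T`, the diameter of the largest closed ball contained in the closed simplex. -/
def cellInDiam (s : Finset (RVec d)) : ℝ :=
  sSup {a : ℝ | ∃ (y : RVec d) (r : ℝ), 0 ≤ r ∧ a = 2 * r ∧ Metric.closedBall y r ⊆ closedCell s}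

variable {Ω : TopologicalSpace.Opens (RVec d)}

/-- Non-degeneracy of the mesh: `h_T / ρ_T ≤ σ₀` for all simplices. -/
def Triangulation.NonDegenerate (𝒯 : Triangulation Ω) (σ₀ : ℝ) : Prop :=
  ∀ s ∈ 𝒯.cells, cellDiam s / cellInDiam s ≤ σ₀

/-- `S_T`, the interior of the union of all simplices of the mesh that touch `T`. -/
def Triangulation.patch (𝒯 : Triangulation Ω) (s : Finset (RVec d)) : Set (RVec d) :=
  interior (⋃ t ∈ {t ∈ (𝒯.cells : Set (Finset (RVec d))) | (closedCell s ∩ closedCell t).Nonempty},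
    closedCell t)

/-- On every simplex, `g` is (a.e. equal to) a polynomial of degree at most `l`. -/
def PiecewisePoly (𝒯 : Triangulation Ω) (l : ℕ) (g : RVec d → ℝ) : Prop :=
  ∀ s ∈ 𝒯.cells, ∃ P : MvPolynomial (Fin d) ℝ, P.totalDegree ≤ l ∧
    ∀ᵐ x ∂(volOn Ω), x ∈ closedCell s → g x = MvPolynomial.eval (fun j => x j) P

theorem PiecewisePoly.add {𝒯 : Triangulation Ω} {l : ℕ} {g h : RVec d → ℝ}
    (hg : PiecewisePoly 𝒯 l g) (hh : PiecewisePoly 𝒯 l h) : PiecewisePoly 𝒯 l (g + h) := by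
  intro s hs
  obtain ⟨P, hP, eP⟩ := hg s hs
  obtain ⟨Q, hQ, eQ⟩ := hh s hs
  refine ⟨P + Q, (MvPolynomial.totalDegree_add P Q).trans (max_le hP hQ), ?_⟩
  filter_upwards [eP, eQ] with x h1 h2 hx
  rw [Pi.add_apply, h1 hx, h2 hx, map_add]

theorem PiecewisePoly.smul {𝒯 : Triangulation Ω} {l : ℕ} {g : RVec d → ℝ} (c : ℝ)
    (hg : PiecewisePoly 𝒯 l g) : PiecewisePoly 𝒯 l (c • g) := by
  intro s hs
  obtain ⟨P, hP, eP⟩ := hg s hs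
  refine ⟨c • P, (MvPolynomial.totalDegree_smul_le c P).trans hP, ?_⟩
  filter_upwards [eP] with x h1 hx
  rw [Pi.smul_apply, h1 hx, MvPolynomial.smul_eval, smul_eq_mul]

theorem PiecewisePoly.zero {𝒯 : Triangulation Ω} {l : ℕ} : PiecewisePoly 𝒯 l 0 :=
  fun _ _ => ⟨0, by simp, Eventually.of_forall fun x _ => by simp⟩

theorem PiecewisePoly.congr {𝒯 : Triangulation Ω} {l : ℕ} {g h : RVec d → ℝ}
    (hg : PiecewisePoly 𝒯 l g) (hgh : g =ᵐ[volOn Ω] h) : PiecewisePoly 𝒯 l h := by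
  intro s hs
  obtain ⟨P, hP, eP⟩ := hg s hs
  refine ⟨P, hP, ?_⟩
  filter_upwards [eP, hgh] with x h1 h2 hx
  rw [← h2, h1 hx]

/-- The velocity space `X_h`: fields in `W^{1,p}_0(Ω)` whose components are polynomials of degree at
most `k` on every simplex. -/
def Xh (𝒯 : Triangulation Ω) (p : ℝ) (k : ℕ) : Submodule ℝ (RVec d →ₘ[volOn Ω] RVec d) where
  carrier := {v | v ∈ W01 Ω p ∧ ∀ i, PiecewisePoly 𝒯 k fun x => v x i}
  add_mem' := fun {u v} hu hv => ⟨add_mem hu.1 hv.1, fun i => ((hu.2 i).add (hv.2 i)).congr (by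
    filter_upwards [AEEqFun.coeFn_add u v] with x hx
    simp [hx])⟩
  zero_mem' := ⟨zero_mem _, fun i => PiecewisePoly.zero.congr (by
    filter_upwards [AEEqFun.coeFn_zero (α := RVec d) (μ := volOn Ω) (β := RVec d)] with x hx
    simp [hx])⟩
  smul_mem' := fun c u hu => ⟨Submodule.smul_mem _ c hu.1, fun i => ((hu.2 i).smul c).congr (by
    filter_upwards [AEEqFun.coeFn_smul c u] with x hx
    simp [hx])⟩

theorem Xh_le_W01 (𝒯 : Triangulation Ω) (p : ℝ) (k : ℕ) : Xh 𝒯 p k ≤ W01 Ω p := fun _ h => h.1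

/-- The space `L^{p'}(Ω)` of scalar functions, `p' = p/(p-1)`. -/
abbrev LpDual (Ω : TopologicalSpace.Opens (RVec d)) (p : ℝ) : Submodule ℝ (RVec d →ₘ[volOn Ω] ℝ) :=
  Lp.LpSubmodule ℝ ℝ (ENNReal.ofReal (p / (p - 1))) (volOn Ω)

/-- The pressure space `Y_h`: functions in `L^{p'}(Ω)` that are polynomials of degree at most `r` on
every simplex. -/
def Yh (𝒯 : Triangulation Ω) (p : ℝ) (r : ℕ) : Submodule ℝ (RVec d →ₘ[volOn Ω] ℝ) where
  carrier := {q | q ∈ LpDual Ω p ∧ PiecewisePoly 𝒯 r q}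
  add_mem' := fun {u v} hu hv =>
    ⟨add_mem hu.1 hv.1, (hu.2.add hv.2).congr (AEEqFun.coeFn_add u v).symm⟩
  zero_mem' := ⟨zero_mem _, PiecewisePoly.zero.congr AEEqFun.coeFn_zero.symm⟩
  smul_mem' := fun c u hu =>
    ⟨Submodule.smul_mem _ c hu.1, (hu.2.smul c).congr (AEEqFun.coeFn_smul c u).symm⟩

theorem Yh_le_LpDual (𝒯 : Triangulation Ω) (p : ℝ) (r : ℕ) : Yh 𝒯 p r ≤ LpDual Ω p :=
  fun _ h => h.1

theorem MemW0.memLp_weakDiv {p : ℝ} {u : RVec d → RVec d} (hu : MemW0 Ω p u) :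
    MemLp (weakDiv Ω u) (ENNReal.ofReal p) (volOn Ω) := by
  have h : ∀ i : Fin d, MemLp (fun x => weakGrad Ω u x (i, i)) (ENNReal.ofReal p) (volOn Ω) :=
    fun i => (EuclideanSpace.proj (𝕜 := ℝ) (i, i) : RTen d →L[ℝ] ℝ).comp_memLp' hu.memLp_weakGrad
  exact memLp_finsetSum _ fun i _ => h i

theorem integrable_mul_weakDiv {p : ℝ} (hp : 1 < p) {u : RVec d → RVec d} (hu : MemW0 Ω p u)
    {q : RVec d →ₘ[volOn Ω] ℝ} (hq : q ∈ LpDual Ω p) :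
    Integrable (fun x => q x * weakDiv Ω u x) (volOn Ω) := by
  have hc : Real.HolderConjugate p (p / (p - 1)) := Real.HolderConjugate.conjExponent hp
  have : ENNReal.HolderConjugate (ENNReal.ofReal (p / (p - 1))) (ENNReal.ofReal p) :=
    hc.symm.ennrealOfReal
  have hq' : MemLp q (ENNReal.ofReal (p / (p - 1))) (volOn Ω) :=
    Lp.mem_Lp_iff_memLp.1 hq
  exact hq'.integrable_mul hu.memLp_weakDiv

/-- The discretely divergence-free space `V_h = {v ∈ X_h : (q, div v) = 0 for all q ∈ Y_h}`, regarded
as a (finite-dimensional) subspace of `L²(Ω)`; the elements of `X_h` are bounded. -/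
def Vh (𝒯 : Triangulation Ω) {p : ℝ} (hp : 1 < p) (k r : ℕ) :
    Submodule ℝ (Lp (RVec d) 2 (volOn Ω)) where
  carrier := {v | (v : RVec d →ₘ[volOn Ω] RVec d) ∈ Xh 𝒯 p k ∧
    ∀ q ∈ Yh 𝒯 p r, ∫ x in (Ω : Set (RVec d)), q x * weakDiv Ω v x = 0}
  add_mem' := fun {u v} hu hv => ⟨add_mem hu.1 hv.1, fun q hq => by
    have e : weakDiv Ω ((u + v : Lp (RVec d) 2 (volOn Ω)) : RVec d → RVec d) =ᵐ[volOn Ω]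
        weakDiv Ω u + weakDiv Ω v := by
      have h := weakGrad_ae_eq ((hu.1.1.hasWeakGrad.add hv.1.1.hasWeakGrad).congr
        (Lp.coeFn_add u v).symm (ae_eq_refl _))
      filter_upwards [h] with x hx
      simp only [weakDiv, hx, Pi.add_apply, PiLp.add_apply, Finset.sum_add_distrib]
    have e2 : ∫ x in (Ω : Set (RVec d)), q x * weakDiv Ω
        ((u + v : Lp (RVec d) 2 (volOn Ω)) : RVec d → RVec d) x =
        ∫ x in (Ω : Set (RVec d)), (q x * weakDiv Ω u x + q x * weakDiv Ω v x) :=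
      integral_congr_ae (by filter_upwards [e] with x hx; rw [hx, Pi.add_apply, mul_add])
    rw [e2, integral_add (integrable_mul_weakDiv hp hu.1.1 hq.1)
      (integrable_mul_weakDiv hp hv.1.1 hq.1), hu.2 q hq, hv.2 q hq, add_zero]⟩
  zero_mem' := ⟨zero_mem (Xh 𝒯 p k), fun q _ => by
    have h := weakGrad_ae_eq ((HasWeakGrad.zero (Ω := Ω) (ι := Fin d)).congr
      (Lp.coeFn_zero (RVec d) 2 (volOn Ω)).symm (ae_eq_refl _))
    rw [← integral_zero (RVec d) ℝ (μ := volOn Ω)]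
    refine integral_congr_ae ?_
    filter_upwards [h] with x hx
    simp only [weakDiv, hx, Pi.zero_apply, PiLp.zero_apply, Finset.sum_const_zero, mul_zero]⟩
  smul_mem' := fun c u hu => ⟨Submodule.smul_mem _ c hu.1, fun q hq => by
    have h := weakGrad_ae_eq ((hu.1.1.hasWeakGrad.smul c).congr
      (Lp.coeFn_smul c u).symm (ae_eq_refl _))
    have e2 : ∫ x in (Ω : Set (RVec d)), q x * weakDiv Ω
        ((c • u : Lp (RVec d) 2 (volOn Ω)) : RVec d → RVec d) x =
        ∫ x in (Ω : Set (RVec d)), c * (q x * weakDiv Ω u x) := by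
      refine integral_congr_ae ?_
      filter_upwards [h] with x hx
      simp only [weakDiv, hx, Pi.smul_apply, PiLp.smul_apply, smul_eq_mul, ← Finset.mul_sum]
      ring
    rw [e2, integral_const_mul, hu.2 q hq, mul_zero]⟩

/-- The assumption on the pair `X_h`, `Y_h`, with the constant `c` in the two stability estimates:
`X_h` contains the continuous piecewise affine fields with zero boundary values, `Y_h` contains the
piecewise constants, and there are linear projections `Pdiv : W^{1,p}_0(Ω) → X_h` and
`PY : L^{p'}(Ω) → Y_h` such that `Pdiv` preserves the divergence, is locally `W^{1,1}`-stable and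
fixes piecewise affine fields, and `PY` is locally `L¹`-stable. -/
def InterpolationAssumption (𝒯 : Triangulation Ω) (p : ℝ) (k r : ℕ) (c : ℝ) : Prop :=
  Xh 𝒯 p 1 ≤ Xh 𝒯 p k ∧ Yh 𝒯 p 0 ≤ Yh 𝒯 p r ∧
  ∃ (Pdiv : W01 Ω p →ₗ[ℝ] Xh 𝒯 p k) (PY : LpDual Ω p →ₗ[ℝ] Yh 𝒯 p r),
    (∀ w, Pdiv (Submodule.inclusion (Xh_le_W01 𝒯 p k) (Pdiv w)) = Pdiv w) ∧
    (∀ q, PY (Submodule.inclusion (Yh_le_LpDual 𝒯 p r) (PY q)) = PY q) ∧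
    (∀ w : W01 Ω p, ∀ q ∈ Yh 𝒯 p r,
      ∫ x in (Ω : Set (RVec d)), weakDiv Ω w.1 x * q x =
        ∫ x in (Ω : Set (RVec d)), weakDiv Ω (Pdiv w).1 x * q x) ∧
    (∀ w : W01 Ω p, ∀ s ∈ 𝒯.cells,
      ⨍ x in closedCell s, ‖(Pdiv w).1 x‖ ∂(volOn Ω) ≤
        c * (⨍ x in 𝒯.patch s, ‖w.1 x‖ ∂(volOn Ω)) +
          c * (⨍ x in 𝒯.patch s, cellDiam s * ‖weakGrad Ω w.1 x‖ ∂(volOn Ω))) ∧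
    (∀ w : W01 Ω p, w.1 ∈ Xh 𝒯 p 1 → (Pdiv w).1 = w.1) ∧
    (∀ q : LpDual Ω p, ∀ s ∈ 𝒯.cells,
      ⨍ x in closedCell s, |(PY q).1 x| ∂(volOn Ω) ≤
        c * (⨍ x in 𝒯.patch s, |q.1 x| ∂(volOn Ω)))

end Mesh

/-! ## Functions of time and the semi-discrete problem -/

/-- The Lebesgue measure on `I = (0,T)`. -/
abbrev volTime (T : ℝ) : Measure ℝ := volume.restrict (Ioo 0 T)

/-- `g ∈ W^{1,2}(I; X)` with weak derivative `g'`. -/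
def MemW12Time {X : Type} [NormedAddCommGroup X] [NormedSpace ℝ X] (T : ℝ) (g g' : ℝ → X) : Prop :=
  MemLp g 2 (volTime T) ∧ MemLp g' 2 (volTime T) ∧
  ∀ η : ℝ → ℝ, ContDiff ℝ ∞ η → HasCompactSupport η → tsupport η ⊆ Ioo 0 T →
    ∫ t in Ioo 0 T, deriv η t • g t = - ∫ t in Ioo 0 T, η t • g' t

section Discrete

variable {d : ℕ} {Ω : TopologicalSpace.Opens (RVec d)}

/-- The pairing `(S(Du), Dξ)`. -/
def stressPairing (Ω : TopologicalSpace.Opens (RVec d)) (δ p : ℝ) (u ξ : RVec d → RVec d) : ℝ :=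
  ∫ x in (Ω : Set (RVec d)), inner ℝ (stressS δ p (symGrad Ω u x)) (symGrad Ω ξ x)

/-- `w ∈ V_h` solves `(S(Dw), Dξ) = (S(Du₀), Dξ)` for all `ξ ∈ V_h`. -/
def IsNonlinearProjection (𝒯 : Triangulation Ω) {p : ℝ} (hp : 1 < p) (k r : ℕ) (δ : ℝ)
    (u₀ : RVec d → RVec d) (w : Vh 𝒯 hp k r) : Prop :=
  ∀ ξ : Vh 𝒯 hp k r, stressPairing Ω δ p w.1 ξ.1 = stressPairing Ω δ p u₀ ξ.1

/-- The time derivative on `[0,T]` (one-sided at the end points). -/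
def timeDeriv {X : Type} [NormedAddCommGroup X] [NormedSpace ℝ X] (T : ℝ) (u : ℝ → X) (t : ℝ) : X :=
  derivWithin u (Icc 0 T) t

/-- `u ∈ C¹([0,T], V_h)` satisfies `u(0) = u₀h` and
`(∂_t u(t), ξ) + (S(Du(t)), Dξ) = (f(t), ξ)` for all `t ∈ [0,T]` and `ξ ∈ V_h`. -/
def IsSemidiscreteSolution (𝒯 : Triangulation Ω) {p : ℝ} (hp : 1 < p) (k r : ℕ) (δ T : ℝ)
    (f : ℝ → Lp (RVec d) 2 (volOn Ω)) (u₀h : Vh 𝒯 hp k r) (u : ℝ → Vh 𝒯 hp k r) : Prop :=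
  ContDiffOn ℝ 1 u (Icc 0 T) ∧ u 0 = u₀h ∧
  ∀ t ∈ Icc 0 T, ∀ ξ : Vh 𝒯 hp k r,
    inner ℝ (timeDeriv T u t).1 ξ.1 + stressPairing Ω δ p (u t).1 ξ.1 = inner ℝ (f t) ξ.1

end Discrete

end

/-!
# Stability of a semi-discrete finite element scheme for symmetric `p`-Laplacian systems

On the finite-dimensional space `V_h` with the `L²` inner product the scheme is an ordinary
differential equation `u' + A u = g`: here `g` is the `L²` projection of `f` and `A` represents the
functional `ξ ↦ (S(Du), Dξ)`. The operator `A` is the gradient of `J(u) = ∫ φ(|Du|)`, and with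
`Φ(u) = F(Du)` it satisfies `c ‖Φ u - Φ v‖² ≤ (A u - A v, u - v)`, `(A u, u) = ‖Φ u‖²` and
`c' ‖Φ u‖² ≤ J u` (`exists_stress_operator`). These relations come from pointwise inequalities for
tensors (`monoConst_mul_norm_sq_le`, `inner_stressS_le_phiPot_sub`, `inner_stressS_self`) whose
constants depend only on `p`.

*Coercivity.* What replaces Korn's inequality is `‖u‖_{L²} ≤ K ‖Du‖_{L^p}` on `W^{1,p}_0(Ω)`
(`exists_eLpNorm_le_symGrad`, `MemW0.eLpNorm_two_le`). Its proof avoids singular integrals. For a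
test field `v` put `Z = (1 - λΔ)⁻¹ Dv`. In Fourier variables the symmetric gradient is elliptic, so
`(Z, Dv)` controls the high frequencies of `v` in `L²`; the low ones are absorbed because `v` is
supported in a set of finite measure (`sum_integral_norm_sq_le`, `exists_symbol_small`). Since `Z` is
bounded in `H¹` by `‖v‖_{L²}`, and `H¹` embeds into `L^{p'}` on `Ω` for `2d/(d+2) ≤ p ≤ 2`, Hölder's
inequality gives `‖v‖²_{L²} ≤ C ‖v‖_{L²} ‖Dv‖_{L^p}`.

*Initial value.* `u₀ʰ` is the minimizer on `V_h` of `J - (b, ·)`, where `b` represents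
`ξ ↦ (S(Du₀), Dξ)` (`existsUnique_nonlinearProjection`). Testing with `u₀ʰ` and Young's inequality
bound `∫ |F(Du₀ʰ)|²` by `‖∇u₀‖_{L^p}` (`dissipation_nonlinearProjection_le`).

*Flow.* Existence is Peano's theorem for the operator truncated outside a large ball, where
monotonicity keeps the solution inside the ball (`exists_monotone_flow`); uniqueness is monotonicity
(`monotone_flow_unique`).

*Estimates.* Testing with `u` gives the first bound (`flow_energy_bound`), testing with `u'` and using
`A = ∇J` the second (`flow_potential_bound`). For the third, the equation is subtracted from its
translate in time and tested with `u(· + h) - u`. This bounds `‖u(t + h) - u(t)‖ / h` by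
`‖u'(0)‖` and the variation of `g` (`norm_deriv_monotone_flow_le`), and the increments of `F(Du)` in
`L²(I, L²)` by `O(h)` (`integral_norm_sq_increment_le`); a weak limit of the difference quotients is
then the weak derivative of `F(Du)` (`exists_memW12Time_of_diffQuot`). Finally
`(u'(0), ξ) = (f(0), ξ) - (S(Du₀), Dξ)` by the choice of `u₀ʰ`, and integration by parts bounds the
last term by `‖∇S(Du₀)‖_{L²} ‖ξ‖_{L²}` (`abs_stressPairing_le`), so `u'(0)` is controlled by the data.

All constants come from `d`, `p`, `T`, `|Ω|` and `K`, so neither the mesh nor `δ` enters.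
-/

/-! ### Sobolev embedding by cut-off -/

section KornSobolev
open scoped SchwartzMap NNReal

theorem norm_clm_le_sum_apply_single {d : ℕ} {F : Type*} [NormedAddCommGroup F] [NormedSpace ℝ F]
    (L : RVec d →L[ℝ] F) : ‖L‖ ≤ ∑ k, ‖L (EuclideanSpace.single k 1)‖ := by
  refine L.opNorm_le_bound (Finset.sum_nonneg fun _ _ => norm_nonneg _) fun x => ?_
  have hx : x = ∑ k, x k • EuclideanSpace.single k (1 : ℝ) := by
    ext j
    simp [Pi.single_apply]
  have h1 : L x = ∑ k, x k • L (EuclideanSpace.single k (1 : ℝ)) := by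
    conv_lhs => rw [hx]
    simp
  rw [h1, Finset.sum_mul]
  refine (norm_sum_le _ _).trans (Finset.sum_le_sum fun k _ => ?_)
  rw [norm_smul, mul_comm]
  gcongr
  exact PiLp.norm_apply_le x k

theorem eLpNorm_le_of_support_subset {α F : Type*} [MeasurableSpace α] {μ : Measure α}
    [NormedAddCommGroup F] {g : α → F} {p q : ℝ≥0∞} (hpq : p ≤ q) (hg : AEStronglyMeasurable g μ)
    {B : Set α} (hB : Function.support g ⊆ B) :
    eLpNorm g p μ ≤ eLpNorm g q μ * μ B ^ (1 / p.toReal - 1 / q.toReal) := by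
  rw [← eLpNorm_restrict_eq_of_support_subset (p := p) hB,
    ← eLpNorm_restrict_eq_of_support_subset (p := q) hB]
  simpa using eLpNorm_le_eLpNorm_mul_rpow_measure_univ hpq hg.restrict (μ := μ.restrict B)

/-- Sobolev embedding on a bounded set for smooth functions on the whole space, obtained from the
Gagliardo-Nirenberg-Sobolev inequality by multiplication with a cut-off function. -/
theorem exists_eLpNorm_le_of_contDiff {d : ℕ} (hd : 2 ≤ d) {Ω : Set (RVec d)}
    (hΩ : Bornology.IsBounded Ω) {p : ℝ} (hp : 1 < p) (hp2 : p ≤ 2)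
    (hpd : p⁻¹ ≤ 2⁻¹ + (d : ℝ)⁻¹) :
    ∃ K : ℝ≥0, ∀ Z : RVec d → ℂ, ContDiff ℝ 1 Z →
      eLpNorm Z (ENNReal.ofReal (p / (p - 1))) (volume.restrict Ω) ≤
        K * (eLpNorm Z 2 volume + eLpNorm (fderiv ℝ Z) 2 volume) := by
  have hd0 : (0 : ℝ) < d := by positivity
  have hd2 : (2 : ℝ) ≤ d := by exact_mod_cast hd
  have hp0 : 0 < p := by linarith
  obtain ⟨R, hR0, hR⟩ : ∃ R : ℝ, 0 < R ∧ Ω ⊆ Metric.closedBall 0 R := by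
    obtain ⟨R, hR⟩ := hΩ.subset_closedBall 0
    exact ⟨max R 1, by positivity, hR.trans (Metric.closedBall_subset_closedBall (le_max_left _ _))⟩
  let χ : ContDiffBump (0 : RVec d) := ⟨R, 2 * R, hR0, by linarith⟩
  set B : Set (RVec d) := Metric.closedBall 0 (2 * R) with hB
  -- the exponent `ρ ∈ [1, 2]` whose Sobolev conjugate is the dual exponent `p / (p - 1)`
  have hden : 0 < 1 + (d : ℝ)⁻¹ - p⁻¹ := by
    have : p⁻¹ < 1 := inv_lt_one_of_one_lt₀ hp
    have : 0 < (d : ℝ)⁻¹ := by positivity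
    linarith
  set ρ : ℝ := (1 + (d : ℝ)⁻¹ - p⁻¹)⁻¹ with hρ
  have hρ0 : 0 < ρ := inv_pos.2 hden
  have hρinv : ρ⁻¹ = 1 + (d : ℝ)⁻¹ - p⁻¹ := by rw [hρ, inv_inv]
  have hρ1 : 1 ≤ ρ := by
    rw [hρ]
    refine (one_le_inv₀ hden).2 ?_
    have : (d : ℝ)⁻¹ ≤ p⁻¹ := inv_anti₀ hp0 (by linarith)
    linarith
  have hρ2 : ρ ≤ 2 := by
    rw [hρ, inv_le_comm₀ hden (by norm_num)]
    linarith
  have hρd : ρ < d := by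
    rw [hρ, inv_lt_comm₀ hden hd0]
    have : p⁻¹ < 1 := inv_lt_one_of_one_lt₀ hp
    linarith
  have hq0 : 0 < p / (p - 1) := div_pos hp0 (by linarith)
  have hvB : volume B < ⊤ := Metric.isBounded_closedBall.measure_lt_top
  obtain ⟨M, hM⟩ : ∃ M : ℝ, ∀ x, ‖fderiv ℝ χ x‖ ≤ M :=
    (χ.contDiff (n := 1)).continuous_fderiv (by simp) |>.bounded_above_of_compact_support
      (χ.hasCompactSupport.fderiv (𝕜 := ℝ))
  set q' : ℝ≥0 := Real.toNNReal (p / (p - 1)) with hq'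
  set ρ' : ℝ≥0 := Real.toNNReal ρ with hρ'
  have hq'c : ((q' : ℝ≥0) : ℝ) = p / (p - 1) := Real.coe_toNNReal _ hq0.le
  have hρ'c : ((ρ' : ℝ≥0) : ℝ) = ρ := Real.coe_toNNReal _ hρ0.le
  set C₀ : ℝ≥0 := eLpNormLESNormFDerivOfLeConst ℂ (volume : Measure (RVec d)) B ρ' q'
  set θ : ℝ≥0∞ := volume B ^ (1 / (ρ' : ℝ≥0∞).toReal - 1 / (2 : ℝ≥0∞).toReal) with hθ
  have hθt : θ ≠ ⊤ := by
    refine ENNReal.rpow_ne_top_of_nonneg ?_ hvB.ne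
    rw [ENNReal.coe_toReal, hρ'c, ENNReal.toReal_ofNat, one_div, one_div, sub_nonneg]
    exact inv_anti₀ hρ0 hρ2
  refine ⟨C₀ * θ.toNNReal * (1 + Real.toNNReal M), fun Z hZ => ?_⟩
  set u : RVec d → ℂ := fun x => χ x • Z x with hu
  have huC : ContDiff ℝ 1 u := (χ.contDiff (n := 1)).smul hZ
  have hsupp : Function.support u ⊆ B := by
    intro x hx
    have : x ∈ Function.support χ := fun h => hx (by simp [hu, h])
    rw [χ.support_eq] at this
    exact Metric.ball_subset_closedBall this
  have hfd : ∀ x, fderiv ℝ u x = χ x • fderiv ℝ Z x + (fderiv ℝ χ x).smulRight (Z x) := by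
    intro x
    exact fderiv_fun_smul ((χ.contDiff (n := 1)).differentiable (by simp) x)
      (hZ.differentiable (by simp) x)
  have hfs : Function.support (fderiv ℝ u) ⊆ B := by
    refine (support_fderiv_subset ℝ).trans ?_
    exact closure_minimal hsupp Metric.isClosed_closedBall
  have hcfd : Continuous (fderiv ℝ u) := huC.continuous_fderiv (by simp)
  have e1 : eLpNorm Z (ENNReal.ofReal (p / (p - 1))) (volume.restrict Ω) ≤ eLpNorm u q' volume := by
    have h1 : eLpNorm Z (ENNReal.ofReal (p / (p - 1))) (volume.restrict Ω) ≤
        eLpNorm Z (ENNReal.ofReal (p / (p - 1))) (volume.restrict (Metric.closedBall 0 R)) :=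
      eLpNorm_mono_measure _ (Measure.restrict_mono hR le_rfl)
    have h2 : eLpNorm Z (ENNReal.ofReal (p / (p - 1))) (volume.restrict (Metric.closedBall 0 R)) =
        eLpNorm u (ENNReal.ofReal (p / (p - 1))) (volume.restrict (Metric.closedBall 0 R)) := by
      refine eLpNorm_congr_ae ?_
      filter_upwards [ae_restrict_mem measurableSet_closedBall] with x hx
      simp [hu, χ.one_of_mem_closedBall hx]
    rw [h2] at h1
    exact h1.trans (eLpNorm_mono_measure _ Measure.restrict_le_self)
  have e2 : eLpNorm u q' volume ≤ C₀ * eLpNorm (fderiv ℝ u) ρ' volume := by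
    refine eLpNorm_le_eLpNorm_fderiv_of_le volume huC hsupp ?_ ?_ ?_ Metric.isBounded_closedBall
    · rw [← NNReal.coe_le_coe, hρ'c]; exact_mod_cast hρ1
    · rw [← NNReal.coe_lt_coe, hρ'c]; simpa using hρd
    · have : (p / (p - 1))⁻¹ = 1 - p⁻¹ := by field_simp
      rw [NNReal.coe_inv, hρ'c, hq'c, hρinv, this, finrank_euclideanSpace_fin]
      linarith
  have e3 : eLpNorm (fderiv ℝ u) ρ' volume ≤ θ * eLpNorm (fderiv ℝ u) 2 volume := by
    have h2 : ((ρ' : ℝ≥0) : ℝ≥0∞) ≤ 2 := by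
      rw [hρ', ← ENNReal.ofReal, ← ENNReal.ofReal_ofNat]
      exact ENNReal.ofReal_le_ofReal hρ2
    rw [mul_comm]
    exact eLpNorm_le_of_support_subset h2 hcfd.aestronglyMeasurable hfs
  have e4 : eLpNorm (fderiv ℝ u) 2 volume ≤
      (1 + Real.toNNReal M : ℝ≥0) * (eLpNorm Z 2 volume + eLpNorm (fderiv ℝ Z) 2 volume) := by
    have hM0 : 0 ≤ M := (norm_nonneg _).trans (hM 0)
    have hcZ : Continuous (fderiv ℝ Z) := hZ.continuous_fderiv (by simp)
    have hb : ∀ x, ‖fderiv ℝ u x‖ ≤ ‖‖fderiv ℝ Z x‖ + M * ‖Z x‖‖ := by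
      intro x
      rw [hfd, Real.norm_of_nonneg (by positivity)]
      refine (norm_add_le _ _).trans (add_le_add ?_ ?_)
      · rw [norm_smul, Real.norm_of_nonneg χ.nonneg]
        exact mul_le_of_le_one_left (norm_nonneg _) χ.le_one
      · rw [ContinuousLinearMap.norm_smulRight_apply]
        gcongr
        exact hM x
    refine (eLpNorm_mono hb).trans ?_
    refine (eLpNorm_add_le hcZ.norm.aestronglyMeasurable
      (hZ.continuous.norm.const_mul M).aestronglyMeasurable (by norm_num)).trans ?_
    have h5 : eLpNorm (fun x => M * ‖Z x‖) 2 volume =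
        (Real.toNNReal M : ℝ≥0∞) * eLpNorm Z 2 volume := by
      have := eLpNorm_const_smul M (fun x => ‖Z x‖) 2 (volume : Measure (RVec d))
      rw [eLpNorm_norm, Real.enorm_of_nonneg hM0] at this
      exact this
    rw [eLpNorm_norm, h5]
    push_cast
    rw [add_mul, mul_add, mul_add, one_mul, one_mul]
    calc _ = (Real.toNNReal M : ℝ≥0∞) * eLpNorm Z 2 volume +
        eLpNorm (fderiv ℝ Z) 2 volume := by ring
      _ ≤ _ := by
        refine le_trans ?_ (add_le_add le_add_self le_self_add)
        rw [add_comm]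
  refine e1.trans (e2.trans ((mul_le_mul_right (e3.trans (mul_le_mul_right e4 _)) _).trans_eq ?_))
  push_cast
  rw [ENNReal.coe_toNNReal hθt]
  ring

end KornSobolev

/-! ### The smoothed symmetric gradient in Fourier variables -/

section KornFourier
open scoped SchwartzMap NNReal FourierTransform LineDeriv
variable {d : ℕ}

/-- The Fourier symbol `(1 + a²|ξ|²)⁻¹` of the regularised inverse Laplacian. -/
noncomputable def resolventSymbol (d : ℕ) (a : ℝ) (ξ : RVec d) : ℝ := (1 + ‖a • ξ‖ ^ 2) ^ (-1 : ℝ)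

theorem resolventSymbol_hasTemperateGrowth (a : ℝ) :
    (resolventSymbol d a).HasTemperateGrowth := by
  unfold resolventSymbol
  exact (Function.hasTemperateGrowth_one_add_norm_sq_rpow (RVec d) (-1)).comp
    (f := fun ξ : RVec d => a • ξ)
    ((a • ContinuousLinearMap.id ℝ (RVec d)).hasTemperateGrowth)

theorem resolventSymbol_eq (a : ℝ) (ξ : RVec d) :
    resolventSymbol d a ξ = (1 + a ^ 2 * ‖ξ‖ ^ 2)⁻¹ := by
  rw [resolventSymbol, Real.rpow_neg_one, norm_smul, mul_pow, Real.norm_eq_abs, sq_abs]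

theorem fourier_partial (f : 𝓢(RVec d, ℂ)) (j : Fin d) (ξ : RVec d) :
    𝓕 (∂_{EuclideanSpace.single j (1 : ℝ)} f) ξ = 2 * Real.pi * Complex.I * (ξ j * 𝓕 f ξ) := by
  rw [SchwartzMap.fourier_lineDerivOp_eq, _root_.smul_apply, SchwartzMap.smulLeftCLM_apply_apply
      (by fun_prop)]
  simp [EuclideanSpace.inner_single_right]

/-- The complex symmetric gradient of a field of Schwartz functions. -/
noncomputable def schwartzSymGrad (v : Fin d → 𝓢(RVec d, ℂ)) (i j : Fin d) : 𝓢(RVec d, ℂ) :=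
  (1 / 2 : ℂ) • (∂_{EuclideanSpace.single j (1 : ℝ)} (v i) +
    ∂_{EuclideanSpace.single i (1 : ℝ)} (v j))

theorem fourier_schwartzSymGrad (v : Fin d → 𝓢(RVec d, ℂ)) (i j : Fin d) (ξ : RVec d) :
    𝓕 (schwartzSymGrad v i j) ξ = Real.pi * Complex.I * (ξ j * 𝓕 (v i) ξ + ξ i * 𝓕 (v j) ξ) := by
  rw [schwartzSymGrad, FourierTransform.fourier_smul, FourierTransform.fourier_add,
      _root_.smul_apply, _root_.add_apply,
    fourier_partial, fourier_partial, smul_eq_mul]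
  ring

theorem fourier_multiplier (a : ℝ) (f : 𝓢(RVec d, ℂ)) (ξ : RVec d) :
    𝓕 (SchwartzMap.fourierMultiplierCLM ℂ (resolventSymbol d a) f) ξ =
        resolventSymbol d a ξ * 𝓕 f ξ := by
  rw [SchwartzMap.fourierMultiplierCLM_apply, FourierTransform.fourier_fourierInv_eq,
    SchwartzMap.smulLeftCLM_apply_apply (resolventSymbol_hasTemperateGrowth a)]
  simp

/-- Ellipticity of the symbol of the symmetric gradient: the sum equals `4 |ξ ⊙ V|²`, and the
last term is nonnegative. -/
theorem sum_norm_sq_symm (V : Fin d → ℂ) (ξ : RVec d) :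
    ∑ i, ∑ j, ‖(ξ j : ℂ) * V i + ξ i * V j‖ ^ 2 =
      2 * ‖ξ‖ ^ 2 * ∑ i, ‖V i‖ ^ 2 + 2 * ‖∑ i, (ξ i : ℂ) * V i‖ ^ 2 := by
  have e : ∀ i j, ‖(ξ j : ℂ) * V i + ξ i * V j‖ ^ 2 = ξ j ^ 2 * ‖V i‖ ^ 2 + ξ i ^ 2 * ‖V j‖ ^ 2
      + 2 * ((ξ i * (V i).re) * (ξ j * (V j).re) + (ξ i * (V i).im) * (ξ j * (V j).im)) := by
    intro i j
    simp only [← Complex.normSq_eq_norm_sq, Complex.normSq_apply]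
    simp
    ring
  have e2 : ‖∑ i, (ξ i : ℂ) * V i‖ ^ 2 = (∑ i, ξ i * (V i).re) ^ 2 + (∑ i, ξ i * (V i).im) ^ 2 := by
    rw [← Complex.normSq_eq_norm_sq, Complex.normSq_apply]
    simp [sq]
  rw [e2, EuclideanSpace.real_norm_sq_eq]
  simp only [e, Finset.sum_add_distrib, ← Finset.mul_sum, ← Finset.sum_mul, sq (∑ i, _)]
  ring

theorem sum_norm_sq_symm_le (V : Fin d → ℂ) (ξ : RVec d) :
    ∑ i, ∑ j, ‖(ξ j : ℂ) * V i + ξ i * V j‖ ^ 2 ≤ 4 * ‖ξ‖ ^ 2 * ∑ i, ‖V i‖ ^ 2 := by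
  have e : ∀ i j, ‖(ξ j : ℂ) * V i + ξ i * V j‖ ^ 2 ≤
      2 * (ξ j ^ 2 * ‖V i‖ ^ 2) + 2 * (ξ i ^ 2 * ‖V j‖ ^ 2) := by
    intro i j
    have h := norm_add_le ((ξ j : ℂ) * V i) (ξ i * V j)
    have h2 : ‖(ξ j : ℂ) * V i + ξ i * V j‖ ^ 2 ≤ (‖(ξ j : ℂ) * V i‖ + ‖(ξ i : ℂ) * V j‖) ^ 2 := by
      gcongr
    have e1 : ‖(ξ j : ℂ) * V i‖ ^ 2 = ξ j ^ 2 * ‖V i‖ ^ 2 := by simp [mul_pow]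
    have e2 : ‖(ξ i : ℂ) * V j‖ ^ 2 = ξ i ^ 2 * ‖V j‖ ^ 2 := by simp [mul_pow]
    nlinarith [sq_nonneg (‖(ξ j : ℂ) * V i‖ - ‖(ξ i : ℂ) * V j‖)]
  refine (Finset.sum_le_sum fun i _ => Finset.sum_le_sum fun j _ => e i j).trans_eq ?_
  rw [EuclideanSpace.real_norm_sq_eq]
  simp only [Finset.sum_add_distrib, ← Finset.mul_sum, ← Finset.sum_mul]
  ring

theorem integrable_mul_norm_sq_schwartz {m : RVec d → ℝ} (hm : Continuous m) {C : ℝ}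
    (hC : ∀ ξ, |m ξ| ≤ C) (f : 𝓢(RVec d, ℂ)) : Integrable (fun ξ => m ξ * ‖f ξ‖ ^ 2) := by
  refine Integrable.bdd_mul (c := C) ?_ hm.aestronglyMeasurable (Eventually.of_forall hC)
  exact (f.memLp 2).integrable_norm_pow (by norm_num)

theorem resolventSymbol_nonneg (a : ℝ) (ξ : RVec d) : 0 ≤ resolventSymbol d a ξ := by
  rw [resolventSymbol_eq]; positivity

theorem resolventSymbol_le_one (a : ℝ) (ξ : RVec d) : resolventSymbol d a ξ ≤ 1 := by
  rw [resolventSymbol_eq]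
  exact inv_le_one_of_one_le₀ (by nlinarith [mul_nonneg (sq_nonneg a) (sq_nonneg ‖ξ‖)])

theorem resolventSymbol_add (a : ℝ) (ξ : RVec d) :
    resolventSymbol d a ξ + a ^ 2 * ‖ξ‖ ^ 2 * resolventSymbol d a ξ = 1 := by
  rw [resolventSymbol_eq]
  field_simp

theorem resolventSymbol_mul_le (a : ℝ) (ξ : RVec d) :
    a ^ 2 * ‖ξ‖ ^ 2 * resolventSymbol d a ξ ≤ 1 := by
  linarith [resolventSymbol_add a ξ, resolventSymbol_nonneg a ξ]

theorem continuous_resolventSymbol (a : ℝ) : Continuous (resolventSymbol d a) :=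
  (resolventSymbol_hasTemperateGrowth a).1.continuous

theorem integrable_norm_sq_schwartz (f : 𝓢(RVec d, ℂ)) : Integrable (fun ξ => ‖f ξ‖ ^ 2) :=
  (f.memLp 2).integrable_norm_pow (by norm_num)

theorem integrable_symbol_mul (a : ℝ) (f : 𝓢(RVec d, ℂ)) :
    Integrable (fun ξ => resolventSymbol d a ξ * ‖f ξ‖ ^ 2) :=
  integrable_mul_norm_sq_schwartz (continuous_resolventSymbol a) (C := 1)
    (fun ξ => by
      rw [abs_of_nonneg (resolventSymbol_nonneg a ξ)]; exact resolventSymbol_le_one a ξ) f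

theorem integrable_symbol_mul' (a : ℝ) (f : 𝓢(RVec d, ℂ)) :
    Integrable (fun ξ => a ^ 2 * ‖ξ‖ ^ 2 * resolventSymbol d a ξ * ‖f ξ‖ ^ 2) :=
  integrable_mul_norm_sq_schwartz
    (by have := continuous_resolventSymbol (d := d) a; fun_prop) (C := 1)
    (fun ξ => by
      have := resolventSymbol_nonneg a ξ
      rw [abs_of_nonneg (by positivity)]; exact resolventSymbol_mul_le a ξ) f

/-- `Z = (1 - (a/2π)² Δ)⁻¹ Dv`, the smoothed symmetric gradient used as a test tensor. -/
noncomputable def smoothedSymGrad (a : ℝ) (v : Fin d → 𝓢(RVec d, ℂ)) (i j : Fin d) :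
    𝓢(RVec d, ℂ) :=
  SchwartzMap.fourierMultiplierCLM ℂ (resolventSymbol d a) (schwartzSymGrad v i j)

/-- Korn's inequality, pointwise in Fourier variables. -/
theorem sum_norm_sq_fourier_symGrad (v : Fin d → 𝓢(RVec d, ℂ)) (ξ : RVec d) :
    2 * Real.pi ^ 2 * ‖ξ‖ ^ 2 * ∑ i, ‖𝓕 (v i) ξ‖ ^ 2 ≤
        ∑ i, ∑ j, ‖𝓕 (schwartzSymGrad v i j) ξ‖ ^ 2 ∧
      ∑ i, ∑ j, ‖𝓕 (schwartzSymGrad v i j) ξ‖ ^ 2 ≤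
        4 * Real.pi ^ 2 * ‖ξ‖ ^ 2 * ∑ i, ‖𝓕 (v i) ξ‖ ^ 2 := by
  have e : ∑ i, ∑ j, ‖𝓕 (schwartzSymGrad v i j) ξ‖ ^ 2 =
      Real.pi ^ 2 * ∑ i, ∑ j, ‖(ξ j : ℂ) * 𝓕 (v i) ξ + ξ i * 𝓕 (v j) ξ‖ ^ 2 := by
    simp only [Finset.mul_sum, fourier_schwartzSymGrad, norm_mul, mul_pow]
    simp
  rw [e]
  constructor
  · rw [sum_norm_sq_symm]
    nlinarith [Real.pi_pos, mul_nonneg (sq_nonneg Real.pi) (sq_nonneg ‖∑ i, (ξ i : ℂ) * 𝓕 (v i) ξ‖)]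
  · have := mul_le_mul_of_nonneg_left (sum_norm_sq_symm_le (fun i => 𝓕 (v i) ξ) ξ)
      (sq_nonneg Real.pi)
    linarith

/-- By Plancherel's theorem the left-hand side is the pairing of the `(i, j)` components of `Z` and
`Dv`. -/
theorem integral_symbol_symGrad_le (a : ℝ) (v : Fin d → 𝓢(RVec d, ℂ)) (i j : Fin d) :
    ∫ ξ, resolventSymbol d a ξ * ‖𝓕 (schwartzSymGrad v i j) ξ‖ ^ 2 ≤
      ∫ x, ‖smoothedSymGrad a v i j x‖ * ‖schwartzSymGrad v i j x‖ := by
  have h1 := SchwartzMap.integral_inner_fourier_fourier (smoothedSymGrad a v i j)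
    (schwartzSymGrad v i j)
  have h2 : ∀ ξ, inner ℂ (𝓕 (smoothedSymGrad a v i j) ξ) (𝓕 (schwartzSymGrad v i j) ξ) =
      ((resolventSymbol d a ξ * ‖𝓕 (schwartzSymGrad v i j) ξ‖ ^ 2 : ℝ) : ℂ) := by
    intro ξ
    rw [smoothedSymGrad, fourier_multiplier, ← Complex.real_smul, inner_smul_left_eq_smul,
      inner_self_eq_norm_sq_to_K]
    simp
  simp only [h2] at h1
  rw [integral_complex_ofReal] at h1
  have h3 := norm_integral_le_integral_norm
    (fun x => inner ℂ (smoothedSymGrad a v i j x) (schwartzSymGrad v i j x)) (μ := volume)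
  rw [← h1, Complex.norm_real] at h3
  refine (Real.le_norm_self _).trans (h3.trans (integral_mono_of_nonneg ?_ ?_ ?_))
  · exact Eventually.of_forall fun x => norm_nonneg _
  · exact ((smoothedSymGrad a v i j).memLp 2).norm.integrable_mul
      ((schwartzSymGrad v i j).memLp 2).norm
  · exact Eventually.of_forall fun x => norm_inner_le_norm (𝕜 := ℂ)
      (smoothedSymGrad a v i j x) (schwartzSymGrad v i j x)

/-- Splitting `1 = (1 + a²|ξ|²)⁻¹ + a²|ξ|² (1 + a²|ξ|²)⁻¹` in Fourier variables: the first part is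
small for fields supported in a set of finite measure if `a` is large, the second is bounded
by testing with `Z`. -/
theorem sum_integral_norm_sq_le (a : ℝ) (v : Fin d → 𝓢(RVec d, ℂ)) :
    ∑ i, ∫ x, ‖v i x‖ ^ 2 ≤ (∑ i, ∫ ξ, resolventSymbol d a ξ * ‖𝓕 (v i) ξ‖ ^ 2) +
      a ^ 2 / (2 * Real.pi ^ 2) * ∑ i, ∑ j, ∫ x,
          ‖smoothedSymGrad a v i j x‖ * ‖schwartzSymGrad v i j x‖ := by
  have h1 : ∀ i, ∫ x, ‖v i x‖ ^ 2 = (∫ ξ, resolventSymbol d a ξ * ‖𝓕 (v i) ξ‖ ^ 2) +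
      ∫ ξ, a ^ 2 * ‖ξ‖ ^ 2 * resolventSymbol d a ξ * ‖𝓕 (v i) ξ‖ ^ 2 := by
    intro i
    rw [← SchwartzMap.integral_norm_sq_fourier, ← integral_add (integrable_symbol_mul a _)
        (integrable_symbol_mul' a _)]
    congr 1 with ξ
    rw [← add_mul, resolventSymbol_add, one_mul]
  simp only [h1, Finset.sum_add_distrib]
  refine add_le_add le_rfl ?_
  have hpi := Real.pi_pos
  rw [← integral_finsetSum _ fun i _ => integrable_symbol_mul' a _]
  calc _ ≤ ∫ ξ, a ^ 2 / (2 * Real.pi ^ 2) * ∑ i, ∑ j,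
      resolventSymbol d a ξ * ‖𝓕 (schwartzSymGrad v i j) ξ‖ ^ 2 := by
        refine integral_mono (integrable_finsetSum _ fun i _ => integrable_symbol_mul' a _)
          ((integrable_finsetSum _ fun i _ => integrable_finsetSum _ fun j _ =>
            integrable_symbol_mul a _).const_mul _) fun ξ => ?_
        simp only [← Finset.mul_sum]
        have h := mul_le_mul_of_nonneg_left (sum_norm_sq_fourier_symGrad v ξ).1
          (resolventSymbol_nonneg a ξ)
        have h' := mul_le_mul_of_nonneg_left h (show 0 ≤ a ^ 2 / (2 * Real.pi ^ 2) by positivity)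
        refine le_trans (le_of_eq ?_) h'
        field_simp
    _ = a ^ 2 / (2 * Real.pi ^ 2) * ∑ i, ∑ j, ∫ ξ,
        resolventSymbol d a ξ * ‖𝓕 (schwartzSymGrad v i j) ξ‖ ^ 2 := by
        rw [integral_const_mul, integral_finsetSum _ fun i _ => integrable_finsetSum _ fun j _ =>
            integrable_symbol_mul a _]
        congr 2 with i
        rw [integral_finsetSum _ fun j _ => integrable_symbol_mul a _]
    _ ≤ _ := by
        refine mul_le_mul_of_nonneg_left (Finset.sum_le_sum fun i _ => Finset.sum_le_sum fun j _ =>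
          integral_symbol_symGrad_le a v i j) (by positivity)

theorem sum_integral_smoothed_le {a : ℝ} (ha : 0 < a) (v : Fin d → 𝓢(RVec d, ℂ)) :
    ∑ i, ∑ j, ∫ x, ‖smoothedSymGrad a v i j x‖ ^ 2 ≤
      4 * Real.pi ^ 2 / a ^ 2 * ∑ i, ∫ x, ‖v i x‖ ^ 2 := by
  simp only [← SchwartzMap.integral_norm_sq_fourier (v _),
    ← SchwartzMap.integral_norm_sq_fourier (smoothedSymGrad a v _ _)]
  calc _ = ∫ ξ, ∑ i, ∑ j, ‖𝓕 (smoothedSymGrad a v i j) ξ‖ ^ 2 := by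
        rw [integral_finsetSum _ fun i _ => integrable_finsetSum _ fun j _ =>
            integrable_norm_sq_schwartz _]
        congr 1 with i
        rw [integral_finsetSum _ fun j _ => integrable_norm_sq_schwartz _]
    _ ≤ ∫ ξ, 4 * Real.pi ^ 2 / a ^ 2 * ∑ i, ‖𝓕 (v i) ξ‖ ^ 2 := by
        refine integral_mono (integrable_finsetSum _ fun i _ => integrable_finsetSum _ fun j _ =>
          integrable_norm_sq_schwartz _)
          ((integrable_finsetSum _ fun i _ => integrable_norm_sq_schwartz _).const_mul
            _) fun ξ => ?_
        simp only [smoothedSymGrad, fourier_multiplier, norm_mul, mul_pow, ← Finset.mul_sum]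
        have h0 := resolventSymbol_nonneg a ξ
        have h1 := resolventSymbol_le_one a ξ
        have h2 := resolventSymbol_mul_le a ξ
        have h3 := (sum_norm_sq_fourier_symGrad v ξ).2
        have hV : 0 ≤ ∑ i, ‖𝓕 (v i) ξ‖ ^ 2 := by positivity
        rw [Complex.norm_real, Real.norm_of_nonneg h0]
        set m := resolventSymbol d a ξ
        calc m ^ 2 * ∑ i, ∑ j, ‖𝓕 (schwartzSymGrad v i j) ξ‖ ^ 2
            ≤ m ^ 2 * (4 * Real.pi ^ 2 * ‖ξ‖ ^ 2 * ∑ i, ‖𝓕 (v i) ξ‖ ^ 2) := by gcongr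
          _ = 4 * Real.pi ^ 2 / a ^ 2 * (m * (a ^ 2 * ‖ξ‖ ^ 2 * m)) * ∑ i, ‖𝓕 (v i) ξ‖ ^ 2 := by
              field_simp
          _ ≤ 4 * Real.pi ^ 2 / a ^ 2 * (1 * 1) * ∑ i, ‖𝓕 (v i) ξ‖ ^ 2 := by gcongr
          _ = _ := by ring
    _ = _ := by
        rw [integral_const_mul, integral_finsetSum _ fun i _ => integrable_norm_sq_schwartz _]

/-- `Dv` costs one derivative, `∇` another, and the resolvent gains both: `‖∇Z‖_{L²}` is bounded by
`‖v‖_{L²}`. -/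
theorem sum_integral_deriv_smoothed_le {a : ℝ} (ha : 0 < a) (v : Fin d → 𝓢(RVec d, ℂ)) :
    ∑ k : Fin d, ∑ i, ∑ j, ∫ x,
        ‖∂_{EuclideanSpace.single k (1 : ℝ)} (smoothedSymGrad a v i j) x‖ ^ 2 ≤
      16 * Real.pi ^ 4 / a ^ 4 * ∑ i, ∫ x, ‖v i x‖ ^ 2 := by
  have hf : ∀ (k i j : Fin d), ∫ x, ‖∂_{EuclideanSpace.single k (1 : ℝ)}
    (smoothedSymGrad a v i j) x‖ ^ 2 =
      ∫ ξ, ‖𝓕 (∂_{EuclideanSpace.single k (1 : ℝ)} (smoothedSymGrad a v i j)) ξ‖ ^ 2 := fun k i j =>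
    (SchwartzMap.integral_norm_sq_fourier _).symm
  simp only [hf]
  simp only [← SchwartzMap.integral_norm_sq_fourier (v _)]
  calc _ = ∫ ξ, ∑ k : Fin d, ∑ i, ∑ j,
      ‖𝓕 (∂_{EuclideanSpace.single k (1 : ℝ)} (smoothedSymGrad a v i j)) ξ‖ ^ 2 := by
        rw [integral_finsetSum _ fun k _ => integrable_finsetSum _ fun i _ =>
            integrable_finsetSum _ fun j _ => integrable_norm_sq_schwartz _]
        congr 1 with k
        rw [integral_finsetSum _ fun i _ => integrable_finsetSum _ fun j _ =>
            integrable_norm_sq_schwartz _]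
        congr 1 with i
        rw [integral_finsetSum _ fun j _ => integrable_norm_sq_schwartz _]
    _ ≤ ∫ ξ, 16 * Real.pi ^ 4 / a ^ 4 * ∑ i, ‖𝓕 (v i) ξ‖ ^ 2 := by
        refine integral_mono (integrable_finsetSum _ fun k _ => integrable_finsetSum _ fun i _ =>
          integrable_finsetSum _ fun j _ => integrable_norm_sq_schwartz _)
          ((integrable_finsetSum _ fun i _ => integrable_norm_sq_schwartz _).const_mul
            _) fun ξ => ?_
        have h0 := resolventSymbol_nonneg a ξ
        have h2 := resolventSymbol_mul_le a ξ
        have h3 := (sum_norm_sq_fourier_symGrad v ξ).2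
        have hV : 0 ≤ ∑ i, ‖𝓕 (v i) ξ‖ ^ 2 := by positivity
        have e : ∑ k : Fin d, ∑ i, ∑ j,
          ‖𝓕 (∂_{EuclideanSpace.single k (1 : ℝ)} (smoothedSymGrad a v i j)) ξ‖ ^ 2 =
            4 * Real.pi ^ 2 * ‖ξ‖ ^ 2 * (resolventSymbol d a ξ ^ 2 * ∑ i, ∑ j,
                ‖𝓕 (schwartzSymGrad v i j) ξ‖ ^ 2) := by
          rw [EuclideanSpace.real_norm_sq_eq, Finset.mul_sum, Finset.sum_mul]
          refine Finset.sum_congr rfl fun k _ => ?_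
          simp only [fourier_partial, smoothedSymGrad, fourier_multiplier, norm_mul, mul_pow,
            Finset.mul_sum]
          refine Finset.sum_congr rfl fun i _ => Finset.sum_congr rfl fun j _ => ?_
          simp
          ring
        simp only [e]
        set m := resolventSymbol d a ξ
        calc _ ≤ 4 * Real.pi ^ 2 * ‖ξ‖ ^ 2 *
            (m ^ 2 * (4 * Real.pi ^ 2 * ‖ξ‖ ^ 2 * ∑ i, ‖𝓕 (v i) ξ‖ ^ 2)) := by gcongr
          _ = 16 * Real.pi ^ 4 / a ^ 4 * ((a ^ 2 * ‖ξ‖ ^ 2 * m) * (a ^ 2 * ‖ξ‖ ^ 2 * m)) * ∑ i,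
              ‖𝓕 (v i) ξ‖ ^ 2 := by
              field_simp
              ring
          _ ≤ 16 * Real.pi ^ 4 / a ^ 4 * (1 * 1) * ∑ i, ‖𝓕 (v i) ξ‖ ^ 2 := by gcongr
          _ = _ := by ring
    _ = _ := by
        rw [integral_const_mul, integral_finsetSum _ fun i _ => integrable_norm_sq_schwartz _]

end KornFourier

/-! ### Low frequencies of functions supported in a set of finite measure -/

section LowFrequency
open scoped SchwartzMap NNReal FourierTransform LineDeriv

/-- The Cauchy-Schwarz inequality against the constant function `1`. -/
theorem sq_integral_norm_le {α F : Type*} [MeasurableSpace α] {μ : Measure α} [IsFiniteMeasure μ]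
    [NormedAddCommGroup F] {g : α → F} (hg : MemLp g 2 μ) :
    (∫ x, ‖g x‖ ∂μ) ^ 2 ≤ μ.real univ * ∫ x, ‖g x‖ ^ 2 ∂μ := by
  have h1 : Integrable (fun x => ‖g x‖) μ := (hg.integrable (by norm_num)).norm
  have h2 : Integrable (fun x => ‖g x‖ ^ 2) μ := hg.integrable_norm_pow (by norm_num)
  rcases eq_or_ne (μ.real univ) 0 with h0 | h0
  · have : μ = 0 := by
      rw [← Measure.measure_univ_eq_zero]
      exact (measureReal_eq_zero_iff).1 h0
    simp [this]
  · have hV : 0 < μ.real univ := lt_of_le_of_ne measureReal_nonneg (Ne.symm h0)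
    set V := μ.real univ
    set A := ∫ x, ‖g x‖ ∂μ
    have h3 : 0 ≤ ∫ x, (V * ‖g x‖ - A) ^ 2 ∂μ := integral_nonneg fun x => sq_nonneg _
    have h4 : ∫ x, (V * ‖g x‖ - A) ^ 2 ∂μ = V ^ 2 * (∫ x, ‖g x‖ ^ 2 ∂μ) - V * A ^ 2 := by
      have : ∀ x, (V * ‖g x‖ - A) ^ 2 = V ^ 2 * ‖g x‖ ^ 2 - 2 * V * A * ‖g x‖ + A ^ 2 := by
        intro x; ring
      simp only [this]
      have h5 : Integrable (fun x => V ^ 2 * ‖g x‖ ^ 2 - 2 * V * A * ‖g x‖) μ :=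
        (h2.const_mul _).sub (h1.const_mul _)
      rw [integral_add h5 (integrable_const _), integral_sub (h2.const_mul _) (h1.const_mul _),
          integral_const_mul, integral_const_mul,
        integral_const, smul_eq_mul]
      ring
    rw [h4] at h3
    by_contra! h
    nlinarith [mul_lt_mul_of_pos_left h hV]

variable {d : ℕ}

theorem norm_sq_fourier_le {Ω : Set (RVec d)} (hΩ : volume Ω < ⊤) (f : 𝓢(RVec d, ℂ))
    (hf : Function.support f ⊆ Ω) (ξ : RVec d) :
    ‖𝓕 f ξ‖ ^ 2 ≤ volume.real Ω * ∫ x, ‖f x‖ ^ 2 := by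
  have h1 : ‖𝓕 f ξ‖ ≤ ∫ x, ‖f x‖ := by
    rw [SchwartzMap.fourier_coe]
    exact VectorFourier.norm_fourierIntegral_le_integral_norm _ _ _ _ _
  have h2 : ∫ x, ‖f x‖ = ∫ x in Ω, ‖f x‖ := by
    refine (setIntegral_eq_integral_of_forall_compl_eq_zero fun x hx => ?_).symm
    rw [Function.notMem_support.1 fun h => hx (hf h), norm_zero]
  have h3 : ∫ x, ‖f x‖ ^ 2 = ∫ x in Ω, ‖f x‖ ^ 2 := by
    refine (setIntegral_eq_integral_of_forall_compl_eq_zero fun x hx => ?_).symm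
    rw [Function.notMem_support.1 fun h => hx (hf h), norm_zero]; simp
  have : Fact (volume Ω < ⊤) := ⟨hΩ⟩
  have h4 := sq_integral_norm_le (μ := volume.restrict Ω) ((f.memLp 2 (μ := volume)).restrict Ω)
  rw [h3]
  calc _ ≤ (∫ x, ‖f x‖) ^ 2 := by gcongr
    _ ≤ _ := by rw [h2]; simpa using h4

/-- On functions supported in a set of finite measure the symbol `(1 + a²|ξ|²)⁻¹` is small for
large `a`: low frequencies carry little energy because the Fourier transform is bounded. -/
theorem exists_symbol_small (hd : 0 < d) {Ω : Set (RVec d)} (hΩ : volume Ω < ⊤) :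
    ∃ a : ℝ, 0 < a ∧ ∀ f : 𝓢(RVec d, ℂ), Function.support f ⊆ Ω →
      ∫ ξ, resolventSymbol d a ξ * ‖𝓕 f ξ‖ ^ 2 ≤ 1 / 2 * ∫ x, ‖f x‖ ^ 2 := by
  set W := volume.real Ω
  have hW : 0 ≤ W := measureReal_nonneg
  obtain ⟨R, hR0, hR⟩ : ∃ R : ℝ, 0 < R ∧ W * volume.real (Metric.ball (0 : RVec d) R) ≤ 1 / 4 := by
    have : Nonempty (Fin d) := ⟨⟨0, hd⟩⟩
    have h1 : ∀ R : ℝ, 0 < R → volume.real (Metric.ball (0 : RVec d) R) =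
        R ^ d * volume.real (Metric.ball (0 : RVec d) 1) := by
      intro R hR
      rw [measureReal_def, measureReal_def, Measure.addHaar_ball _ _ hR.le]
      simp [hR.le]
    have h2 : Tendsto (fun R : ℝ => W * (R ^ d * volume.real (Metric.ball (0 : RVec d) 1)))
        (𝓝[>] 0) (𝓝 (W * (0 ^ d * volume.real (Metric.ball (0 : RVec d) 1)))) := by
      refine tendsto_nhdsWithin_of_tendsto_nhds ?_
      exact (Continuous.tendsto (by fun_prop) 0)
    rw [zero_pow hd.ne', zero_mul, mul_zero] at h2
    obtain ⟨R, hR, hR0⟩ := ((h2.eventually (gt_mem_nhds (show (0 : ℝ) < 1 / 4 by norm_num))).and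
      self_mem_nhdsWithin).exists
    exact ⟨R, hR0, by rw [h1 R hR0]; exact hR.le⟩
  -- `1 / (1 + a² R²) ≤ 1 / 4` for `a = 2 / R`
  refine ⟨2 / R, by positivity, fun f hf => ?_⟩
  set N := ∫ x, ‖f x‖ ^ 2 with hN
  have hN0 : 0 ≤ N := integral_nonneg fun x => by positivity
  have hpt : ∀ ξ, resolventSymbol d (2 / R) ξ * ‖𝓕 f ξ‖ ^ 2 ≤
      (Metric.ball (0 : RVec d) R).indicator (fun _ => W * N) ξ + 1 / 4 * ‖𝓕 f ξ‖ ^ 2 := by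
    intro ξ
    by_cases hξ : ξ ∈ Metric.ball (0 : RVec d) R
    · rw [indicator_of_mem hξ]
      have h1 := mul_le_mul_of_nonneg_right (resolventSymbol_le_one (2 / R) ξ) (sq_nonneg ‖𝓕 f ξ‖)
      have h2 := norm_sq_fourier_le hΩ f hf ξ
      nlinarith [sq_nonneg ‖𝓕 f ξ‖]
    · rw [indicator_of_notMem hξ, zero_add]
      gcongr
      rw [mem_ball_zero_iff, not_lt] at hξ
      rw [resolventSymbol_eq, one_div]
      refine inv_anti₀ (by norm_num) ?_
      have : R ^ 2 ≤ ‖ξ‖ ^ 2 := by gcongr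
      have h4 : (2 / R) ^ 2 * R ^ 2 = 4 := by field_simp; norm_num
      nlinarith [mul_le_mul_of_nonneg_left this (sq_nonneg (2 / R))]
  have hi : Integrable ((Metric.ball (0 : RVec d) R).indicator (fun _ => W * N)) :=
    (integrable_indicator_iff measurableSet_ball).2
      (integrableOn_const Metric.isBounded_ball.measure_lt_top.ne)
  have h5 := integral_mono (integrable_symbol_mul (2 / R) (𝓕 f))
    (hi.add ((integrable_norm_sq_schwartz (𝓕 f)).const_mul (1 / 4))) hpt
  have h6 : ∫ ξ, ((Metric.ball (0 : RVec d) R).indicator (fun _ => W * N) ξ + 1 / 4 * ‖𝓕 f ξ‖ ^ 2) =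
      volume.real (Metric.ball (0 : RVec d) R) * (W * N) + 1 / 4 * N := by
    rw [integral_add hi ((integrable_norm_sq_schwartz (𝓕 f)).const_mul (1 / 4)),
      integral_indicator_const _ measurableSet_ball, integral_const_mul,
      SchwartzMap.integral_norm_sq_fourier, smul_eq_mul]
  refine h5.trans (h6.le.trans ?_)
  nlinarith [mul_le_mul_of_nonneg_right hR hN0]

end LowFrequency

/-! ### The Korn-Sobolev inequality for test fields, `p ≤ 2` -/

section KornSobolevSmooth
open scoped SchwartzMap NNReal FourierTransform LineDeriv

theorem eLpNorm_two_eq_ofReal_sqrt {α F : Type*} [MeasurableSpace α] {μ : Measure α}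
    [NormedAddCommGroup F] {g : α → F} (hg : MemLp g 2 μ) :
    eLpNorm g 2 μ = ENNReal.ofReal (√(∫ x, ‖g x‖ ^ 2 ∂μ)) := by
  rw [hg.eLpNorm_eq_integral_rpow_norm (by norm_num) (by norm_num), Real.sqrt_eq_rpow]
  simp

theorem integral_norm_mul_norm_le {α F G : Type*} [MeasurableSpace α] {μ : Measure α}
    [NormedAddCommGroup F] [NormedAddCommGroup G] {p q : ℝ} (hpq : p.HolderConjugate q)
    {f : α → F} {g : α → G} (hf : MemLp f (ENNReal.ofReal p) μ)
    (hg : MemLp g (ENNReal.ofReal q) μ) :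
    ∫ x, ‖f x‖ * ‖g x‖ ∂μ ≤
      (eLpNorm f (ENNReal.ofReal p) μ).toReal * (eLpNorm g (ENNReal.ofReal q) μ).toReal := by
  have h := integral_mul_norm_le_Lp_mul_Lq hpq hf.norm hg.norm
  have e1 : (ENNReal.ofReal p).toReal = p := ENNReal.toReal_ofReal hpq.pos.le
  have e2 : (ENNReal.ofReal q).toReal = q := ENNReal.toReal_ofReal hpq.symm.pos.le
  rw [hf.eLpNorm_eq_integral_rpow_norm (by simpa using hpq.pos) (by simp),
    hg.eLpNorm_eq_integral_rpow_norm (by simpa using hpq.symm.pos) (by simp), e1, e2,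
    ENNReal.toReal_ofReal (by positivity), ENNReal.toReal_ofReal (by positivity)]
  simpa [one_div] using h

variable {d : ℕ}

theorem eLpNorm_schwartz_two (f : 𝓢(RVec d, ℂ)) :
    eLpNorm f 2 volume = ENNReal.ofReal (√(∫ x, ‖f x‖ ^ 2)) :=
  eLpNorm_two_eq_ofReal_sqrt (f.memLp 2 volume)

theorem symPart_apply (A : RTen d) (i j : Fin d) : symPart A (i, j) =
    (A (i, j) + A (j, i)) / 2 := rfl

/-- The components of a smooth compactly supported field as complex Schwartz functions. -/
noncomputable def schwartzComponent (w : RVec d → RVec d) (hw : ContDiff ℝ ∞ w)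
  (hc : HasCompactSupport w)
    (i : Fin d) : 𝓢(RVec d, ℂ) :=
  HasCompactSupport.toSchwartzMap (f := fun x => ((w x i : ℝ) : ℂ))
    (hc.comp_left (g := fun y : RVec d => ((y i : ℝ) : ℂ)) (by simp))
    (Complex.ofRealCLM.contDiff.comp
      ((EuclideanSpace.proj (𝕜 := ℝ) i : RVec d →L[ℝ] ℝ).contDiff.comp hw))

theorem schwartzComponent_apply (w : RVec d → RVec d) (hw : ContDiff ℝ ∞ w)
    (hc : HasCompactSupport w)
    (i : Fin d) (x : RVec d) : schwartzComponent w hw hc i x = ((w x i : ℝ) : ℂ) := rfl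

theorem schwartzSymGrad_component (w : RVec d → RVec d) (hw : ContDiff ℝ ∞ w)
    (hc : HasCompactSupport w) (i j : Fin d) (x : RVec d) :
    schwartzSymGrad (schwartzComponent w hw hc) i j x =
        ((symPart (classGrad w x) (i, j) : ℝ) : ℂ) := by
  have h : ∀ i j : Fin d, ∂_{EuclideanSpace.single j (1 : ℝ)} (schwartzComponent w hw hc i) x =
      ((classGrad w x (i, j) : ℝ) : ℂ) := by
    intro i j
    rw [SchwartzMap.lineDerivOp_apply_eq_fderiv]
    have h1 : HasFDerivAt w (fderiv ℝ w x) x := (hw.differentiable (by simp) x).hasFDerivAt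
    have h2 := (Complex.ofRealCLM.comp
      (EuclideanSpace.proj (𝕜 := ℝ) i : RVec d →L[ℝ] ℝ)).hasFDerivAt.comp x h1
    have h3 : HasFDerivAt (schwartzComponent w hw hc i) _ x := h2
    rw [h3.fderiv]
    rfl
  rw [schwartzSymGrad, _root_.smul_apply, _root_.add_apply, h, h, symPart_apply]
  push_cast
  simp
  ring

theorem eLpNorm_fderiv_schwartz_le (Z : 𝓢(RVec d, ℂ)) :
    eLpNorm (fderiv ℝ Z) 2 volume ≤ ∑ k : Fin d,
        eLpNorm (∂_{EuclideanSpace.single k (1 : ℝ)} Z : 𝓢(RVec d, ℂ)) 2 volume := by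
  have h1 : ∀ x, ‖fderiv ℝ Z x‖ ≤ ‖∑ k : Fin d,
      ‖(∂_{EuclideanSpace.single k (1 : ℝ)} Z : 𝓢(RVec d, ℂ)) x‖‖ := by
    intro x
    rw [Real.norm_of_nonneg (by positivity)]
    exact norm_clm_le_sum_apply_single _
  refine (eLpNorm_mono h1).trans ?_
  have h2 := eLpNorm_sum_le (μ := volume) (p := 2) (s := Finset.univ)
    (f := fun (k : Fin d) x => ‖(∂_{EuclideanSpace.single k (1 : ℝ)} Z : 𝓢(RVec d, ℂ)) x‖)
    (fun k _ => (SchwartzMap.continuous _).norm.aestronglyMeasurable) (by norm_num)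
  simp only [eLpNorm_norm] at h2
  refine le_trans (le_of_eq ?_) h2
  congr 1
  ext x
  simp

theorem memLp_of_compactSupport {F : Type*} [NormedAddCommGroup F] {g : RVec d → F}
    (hg : Continuous g)
    (hc : HasCompactSupport g) (p : ℝ≥0∞) {μ : Measure (RVec d)} [IsFiniteMeasureOnCompacts μ] :
    MemLp g p μ := hg.memLp_of_hasCompactSupport hc

theorem support_classGrad_subset {ι : Type} [Fintype ι] (w : RVec d → EuclideanSpace ℝ ι) :
    Function.support (classGrad w) ⊆ tsupport w := by
  intro x hx
  refine support_fderiv_subset ℝ fun h => hx ?_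
  ext k
  simp [classGrad, h]

theorem continuous_symPart : Continuous (symPart : RTen d → RTen d) := by
  unfold symPart
  refine (PiLp.continuous_toLp 2 _).comp (continuous_pi fun k => ?_)
  fun_prop

theorem symPart_zero : symPart (0 : RTen d) = 0 := by
  ext k
  simp [symPart]

/-- A Korn-Sobolev inequality for smooth fields, for exponents `p ≤ 2`. After the low
frequencies are absorbed, `‖v‖²` is at most a multiple of `∑ ∫ |Z| |Dv|` with `Z` the smoothed
symmetric gradient. By Hölder's inequality and the Sobolev embedding of `H¹` into `L^{p'}` on `Ω`,
this is at most a multiple of `‖Z‖_{H¹} ‖Dv‖_{L^p}`, and `‖Z‖_{H¹}` is bounded by `‖v‖_{L²}`. -/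
theorem exists_eLpNorm_le_symGrad_of_le_two (hd : 2 ≤ d) {Ω : TopologicalSpace.Opens (RVec d)}
    (hΩ : Bornology.IsBounded (Ω : Set (RVec d))) {p : ℝ} (hp : 1 < p) (hp2 : p ≤ 2)
    (hpd : p⁻¹ ≤ 2⁻¹ + (d : ℝ)⁻¹) :
    ∃ K : ℝ≥0, ∀ w : RVec d → RVec d, ContDiff ℝ ∞ w → HasCompactSupport w → tsupport w ⊆ Ω →
      eLpNorm w 2 (volOn Ω) ≤
        K * eLpNorm (fun x => symPart (classGrad w x)) (ENNReal.ofReal p) (volOn Ω) := by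
  obtain ⟨K₁, hK₁⟩ := exists_eLpNorm_le_of_contDiff hd hΩ hp hp2 hpd
  obtain ⟨a, ha, hsmall⟩ := exists_symbol_small (d := d) (by omega) hΩ.measure_lt_top
  have hpi := Real.pi_pos
  set A : ℝ := 2 * Real.pi / a with hA
  set B : ℝ := 4 * Real.pi ^ 2 / a ^ 2 with hB
  set C : ℝ := a ^ 2 / Real.pi ^ 2 * (d * (d * (K₁ * (A + d * B)))) with hC
  have hC0 : 0 ≤ C := by positivity
  refine ⟨Real.toNNReal C, fun w hw hc hs => ?_⟩
  set v := schwartzComponent w hw hc with hv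
  have hcG : Continuous fun x => symPart (classGrad w x) :=
    continuous_symPart.comp (continuous_classGrad hw)
  have hsG : Function.support (fun x => symPart (classGrad w x)) ⊆ tsupport w := by
    intro x hx
    refine support_classGrad_subset w fun h => hx ?_
    simp [h, symPart_zero]
  have hGc : HasCompactSupport fun x => symPart (classGrad w x) :=
    HasCompactSupport.of_support_subset_isCompact hc hsG
  have hGp : MemLp (fun x => symPart (classGrad w x)) (ENNReal.ofReal p) (volOn Ω) :=
    memLp_of_compactSupport hcG hGc _
  set P : ℝ := (eLpNorm (fun x => symPart (classGrad w x)) (ENNReal.ofReal p)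
    (volOn Ω)).toReal with hP
  set N : ℝ := ∑ i, ∫ x, ‖v i x‖ ^ 2 with hN
  have hN0 : 0 ≤ N := Finset.sum_nonneg fun i _ => integral_nonneg fun x => by positivity
  have hcj : p.HolderConjugate (p / (p - 1)) := Real.HolderConjugate.conjExponent hp
  have hZ2 : ∀ i j, eLpNorm (smoothedSymGrad a v i j) 2 volume ≤ ENNReal.ofReal (A * √N) := by
    intro i j
    rw [eLpNorm_schwartz_two]
    refine ENNReal.ofReal_le_ofReal ?_
    rw [Real.sqrt_le_left (by positivity), mul_pow, Real.sq_sqrt hN0]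
    have h1 := sum_integral_smoothed_le ha v
    have h2 : ∫ x, ‖smoothedSymGrad a v i j x‖ ^ 2 ≤ ∑ i, ∑ j, ∫ x,
        ‖smoothedSymGrad a v i j x‖ ^ 2 := by
      refine le_trans ?_ (Finset.single_le_sum
        (f := fun i => ∑ j, ∫ x, ‖smoothedSymGrad a v i j x‖ ^ 2)
        (fun i _ => by positivity) (Finset.mem_univ i))
      exact Finset.single_le_sum (f := fun j => ∫ x, ‖smoothedSymGrad a v i j x‖ ^ 2)
        (fun j _ => by positivity) (Finset.mem_univ j)
    refine h2.trans (h1.trans_eq ?_)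
    rw [hA]; ring
  have hdZ2 : ∀ i j, eLpNorm (fderiv ℝ (smoothedSymGrad a v i j)) 2 volume ≤
      ENNReal.ofReal (d * B * √N) := by
    intro i j
    refine (eLpNorm_fderiv_schwartz_le _).trans ?_
    have h0 : ∀ k : Fin d, eLpNorm
      (∂_{EuclideanSpace.single k (1 : ℝ)} (smoothedSymGrad a v i j) : 𝓢(RVec d, ℂ)) 2 volume ≤
        ENNReal.ofReal (B * √N) := by
      intro k
      rw [eLpNorm_schwartz_two]
      refine ENNReal.ofReal_le_ofReal ?_
      rw [Real.sqrt_le_left (by positivity), mul_pow, Real.sq_sqrt hN0]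
      have h1 := sum_integral_deriv_smoothed_le ha v
      set D : Fin d → Fin d → Fin d → ℝ := fun k i j =>
        ∫ x, ‖∂_{EuclideanSpace.single k (1 : ℝ)} (smoothedSymGrad a v i j) x‖ ^ 2 with hD
      have hD0 : ∀ k i j, 0 ≤ D k i j := fun k i j => integral_nonneg fun x => by positivity
      have h2 : D k i j ≤ ∑ k, ∑ i, ∑ j, D k i j := by
        refine le_trans ?_ (Finset.single_le_sum (f := fun k => ∑ i, ∑ j, D k i j)
          (fun k _ => Finset.sum_nonneg fun i _ => Finset.sum_nonneg fun j _ => hD0 k i j)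
            (Finset.mem_univ k))
        refine le_trans ?_ (Finset.single_le_sum (f := fun i => ∑ j, D k i j)
          (fun i _ => Finset.sum_nonneg fun j _ => hD0 k i j) (Finset.mem_univ i))
        exact Finset.single_le_sum (f := fun j => D k i j) (fun j _ => hD0 k i j)
          (Finset.mem_univ j)
      refine h2.trans (h1.trans_eq ?_)
      rw [hB]; ring
    refine (Finset.sum_le_sum fun k _ => h0 k).trans_eq ?_
    rw [Finset.sum_const, Finset.card_univ, Fintype.card_fin, ← ENNReal.ofReal_nsmul, nsmul_eq_mul]
    ring_nf
  have hZq : ∀ i j, eLpNorm (smoothedSymGrad a v i j) (ENNReal.ofReal (p / (p - 1))) (volOn Ω) ≤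
      ENNReal.ofReal (K₁ * (A + d * B) * √N) := by
    intro i j
    refine (hK₁ _ ((smoothedSymGrad a v i j).smooth 1)).trans ?_
    have h1 := mul_le_mul_right (add_le_add (hZ2 i j) (hdZ2 i j)) (K₁ : ℝ≥0∞)
    refine h1.trans_eq ?_
    rw [← ENNReal.ofReal_add (by positivity) (by positivity), ← ENNReal.ofReal_coe_nnreal,
      ← ENNReal.ofReal_mul (by positivity)]
    ring_nf
  have hpair : ∀ i j, ∫ x, ‖smoothedSymGrad a v i j x‖ * ‖schwartzSymGrad v i j x‖ ≤
      K₁ * (A + d * B) * √N * P := by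
    intro i j
    have hg : ∀ x, ‖schwartzSymGrad v i j x‖ ≤ ‖symPart (classGrad w x)‖ := by
      intro x
      rw [hv, schwartzSymGrad_component, Complex.norm_real]
      exact PiLp.norm_apply_le _ _
    have hz : ∀ x, x ∉ (Ω : Set (RVec d)) → ‖smoothedSymGrad a v i j x‖ * ‖schwartzSymGrad v i
        j x‖ = 0 := by
      intro x hx
      have : symPart (classGrad w x) = 0 := Function.notMem_support.1 fun h => hx (hs (hsG h))
      have h2 := hg x
      rw [this, norm_zero] at h2
      rw [le_antisymm h2 (norm_nonneg _), mul_zero]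
    have hZm : MemLp (smoothedSymGrad a v i j) (ENNReal.ofReal (p / (p - 1))) (volOn Ω) :=
      ⟨(SchwartzMap.continuous _).aestronglyMeasurable, (hZq i j).trans_lt ENNReal.ofReal_lt_top⟩
    rw [← setIntegral_eq_integral_of_forall_compl_eq_zero hz]
    have hi : Integrable (fun x => ‖smoothedSymGrad a v i j x‖ * ‖symPart
      (classGrad w x)‖) (volOn Ω) :=
      ((SchwartzMap.continuous _).norm.mul hcG.norm).integrable_of_hasCompactSupport
        (hGc.norm.mul_left)
    calc ∫ x in (Ω : Set (RVec d)), ‖smoothedSymGrad a v i j x‖ * ‖schwartzSymGrad v i j x‖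
        ≤ ∫ x in (Ω : Set (RVec d)), ‖smoothedSymGrad a v i j x‖ * ‖symPart (classGrad w x)‖ := by
          refine integral_mono_of_nonneg (Eventually.of_forall fun x => by positivity) hi
            (Eventually.of_forall fun x => ?_)
          exact mul_le_mul_of_nonneg_left (hg x) (norm_nonneg _)
      _ ≤ _ := integral_norm_mul_norm_le hcj.symm hZm hGp
      _ ≤ _ := by
          gcongr
          exact ENNReal.toReal_le_of_le_ofReal (by positivity) (hZq i j)
  have hmain : N ≤ C * (√N * P) := by
    have h1 := sum_integral_norm_sq_le a v
    have h2 : ∑ i, ∫ ξ, resolventSymbol d a ξ * ‖𝓕 (v i) ξ‖ ^ 2 ≤ 1 / 2 * N := by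
      rw [hN, Finset.mul_sum]
      refine Finset.sum_le_sum fun i _ => hsmall (v i) fun x hx =>
        hs (subset_tsupport _ fun h => hx ?_)
      rw [hv, schwartzComponent_apply, h]
      simp
    have h3 : ∑ i, ∑ j, ∫ x, ‖smoothedSymGrad a v i j x‖ * ‖schwartzSymGrad v i j x‖ ≤
        d * (d * (K₁ * (A + d * B) * √N * P)) := by
      refine (Finset.sum_le_sum fun i _ => Finset.sum_le_sum fun j _ => hpair i j).trans_eq ?_
      simp
    have h4 := mul_le_mul_of_nonneg_left h3 (show 0 ≤ a ^ 2 / (2 * Real.pi ^ 2) by positivity)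
    have h5 : a ^ 2 / (2 * Real.pi ^ 2) * (d * (d * (K₁ * (A + d * B) * √N * P))) =
        1 / 2 * (C * (√N * P)) := by
      rw [hC]; field_simp
    rw [h5] at h4
    change N ≤ _ at h1
    linarith
  have hroot : √N ≤ C * P := by
    rcases eq_or_lt_of_le (Real.sqrt_nonneg N) with h | h
    · rw [← h]; positivity
    · have : √N * √N ≤ √N * (C * P) := by
        rw [Real.mul_self_sqrt hN0]; linarith
      exact le_of_mul_le_mul_left this h
  have hw2 : MemLp w 2 volume := memLp_of_compactSupport hw.continuous hc 2
  have hNw : ∫ x, ‖w x‖ ^ 2 = N := by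
    rw [hN, ← integral_finsetSum _ fun i _ => integrable_norm_sq_schwartz (v i)]
    congr 1 with x
    rw [EuclideanSpace.real_norm_sq_eq]
    refine Finset.sum_congr rfl fun i _ => ?_
    rw [hv, schwartzComponent_apply, Complex.norm_real, Real.norm_eq_abs, sq_abs]
  calc eLpNorm w 2 (volOn Ω) ≤ eLpNorm w 2 volume := eLpNorm_mono_measure _ Measure.restrict_le_self
    _ = ENNReal.ofReal (√N) := by rw [eLpNorm_two_eq_ofReal_sqrt hw2, hNw]
    _ ≤ ENNReal.ofReal (C * P) := ENNReal.ofReal_le_ofReal hroot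
    _ = _ := by
      rw [ENNReal.ofReal_mul hC0, hP, ENNReal.ofReal_toReal hGp.2.ne]
      rfl

end KornSobolevSmooth

/-! ### The Korn-Sobolev inequality in `W^{1,p}_0(Ω)` -/

section SymPart
variable {d : ℕ}

theorem symPart_add (A B : RTen d) : symPart (A + B) = symPart A + symPart B := by
  ext k; simp [symPart]; ring

theorem symPart_smul (c : ℝ) (A : RTen d) : symPart (c • A) = c • symPart A := by
  ext k; simp [symPart]; ring

theorem symPart_neg (A : RTen d) : symPart (-A) = -symPart A := by
  rw [← neg_one_smul ℝ, symPart_smul, neg_one_smul]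

theorem symPart_sub (A B : RTen d) : symPart (A - B) = symPart A - symPart B := by
  rw [sub_eq_add_neg, symPart_add, symPart_neg, ← sub_eq_add_neg]

theorem symPart_symPart (A : RTen d) : symPart (symPart A) = symPart A := by
  ext k; simp [symPart]; ring

theorem inner_symPart_left (A B : RTen d) : inner ℝ (symPart A) B =
    inner ℝ (symPart A) (symPart B) := by
  have h : ∑ k : Fin d × Fin d, symPart A k * B (k.2, k.1) = ∑ k : Fin d × Fin d,
      symPart A k * B k := by
    refine Fintype.sum_equiv (Equiv.prodComm _ _) _ _ fun k => ?_
    simp [symPart, add_comm, Prod.swap]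
  simp only [PiLp.inner_apply, RCLike.inner_apply, conj_trivial]
  have h2 : ∀ k : Fin d × Fin d, symPart B k * symPart A k =
      1 / 2 * (symPart A k * B k) + 1 / 2 * (symPart A k * B (k.2, k.1)) := by
    intro k; simp [symPart]; ring
  simp only [h2, Finset.sum_add_distrib, ← Finset.mul_sum, h]
  rw [← add_mul]
  norm_num
  exact Finset.sum_congr rfl fun k _ => mul_comm _ _

theorem norm_symPart_le (A : RTen d) : ‖symPart A‖ ≤ ‖A‖ := by
  have h := real_inner_le_norm (symPart A) A
  rw [inner_symPart_left, real_inner_self_eq_norm_sq] at h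
  rcases eq_or_lt_of_le (norm_nonneg (symPart A)) with h0 | h0
  · rw [← h0]; exact norm_nonneg _
  · rw [sq] at h; exact le_of_mul_le_mul_left h h0

end SymPart

section KornSobolevW0
open scoped NNReal

variable {d : ℕ} {Ω : TopologicalSpace.Opens (RVec d)}

/-- The Korn-Sobolev inequality for test fields. The case `p > 2` follows from `p = 2`, since `Ω` is
bounded. -/
theorem exists_eLpNorm_le_symGrad (hd : 2 ≤ d) (hΩ : Bornology.IsBounded (Ω : Set (RVec d))) {p : ℝ}
    (hp : 1 < p) (hpd : 2 * (d : ℝ) / ((d : ℝ) + 2) ≤ p) :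
    ∃ K : ℝ≥0, ∀ w : RVec d → RVec d, ContDiff ℝ ∞ w → HasCompactSupport w → tsupport w ⊆ Ω →
      eLpNorm w 2 (volOn Ω) ≤
        K * eLpNorm (fun x => symPart (classGrad w x)) (ENNReal.ofReal p) (volOn Ω) := by
  have hd0 : (0 : ℝ) < d := by positivity
  have hd2 : (2 : ℝ) ≤ d := by exact_mod_cast hd
  have hvol : volume (Ω : Set (RVec d)) < ⊤ := hΩ.measure_lt_top
  have hcrit : (2 * (d : ℝ) / ((d : ℝ) + 2))⁻¹ = 2⁻¹ + (d : ℝ)⁻¹ := by field_simp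
  set s : ℝ := min p 2 with hs
  have hs1 : 1 < s := lt_min hp (by norm_num)
  have hsd : s⁻¹ ≤ 2⁻¹ + (d : ℝ)⁻¹ := by
    rw [← hcrit]
    refine inv_anti₀ (by positivity) (le_min hpd ?_)
    rw [div_le_iff₀ (by positivity)]; linarith
  obtain ⟨K, hK⟩ := exists_eLpNorm_le_symGrad_of_le_two hd hΩ hs1 (min_le_right p 2) hsd
  set θ : ℝ≥0∞ := volOn Ω univ ^
    (1 / (ENNReal.ofReal s).toReal - 1 / (ENNReal.ofReal p).toReal) with hθ
  have hθt : θ ≠ ⊤ := by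
    refine ENNReal.rpow_ne_top_of_nonneg ?_ (by simpa using hvol.ne)
    rw [ENNReal.toReal_ofReal (by positivity), ENNReal.toReal_ofReal (by positivity), sub_nonneg]
    exact one_div_le_one_div_of_le (by positivity) (min_le_left _ _)
  refine ⟨K * θ.toNNReal, fun w hw hc hsw => (hK w hw hc hsw).trans ?_⟩
  have hcG : Continuous fun x => symPart (classGrad w x) :=
    continuous_symPart.comp (continuous_classGrad hw)
  have h := eLpNorm_le_eLpNorm_mul_rpow_measure_univ (μ := volOn Ω)
    (ENNReal.ofReal_le_ofReal (min_le_left p 2)) hcG.aestronglyMeasurable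
  rw [ENNReal.coe_mul, ENNReal.coe_toNNReal hθt, mul_assoc, mul_comm θ]
  exact mul_le_mul_right h _

theorem classGrad_sub {ι : Type} [Fintype ι] {v w : RVec d → EuclideanSpace ℝ ι}
    (hv : ContDiff ℝ ∞ v)
    (hw : ContDiff ℝ ∞ w) : classGrad (v - w) = classGrad v - classGrad w := by
  have h : classGrad (v + (-1 : ℝ) • w) = classGrad v + classGrad ((-1 : ℝ) • w) :=
    classGrad_add hv (contDiff_const.smul hw)
  rw [classGrad_smul (-1) hw] at h
  simpa [sub_eq_add_neg] using h

/-- The approximating test fields of a field in `W^{1,p}_0(Ω)` also converge in `L²(Ω)`, as soon as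
the Korn-Sobolev inequality holds for test fields. -/
theorem tendsto_eLpNorm_two_of_korn {p : ℝ} (hp : 1 < p) {K : ℝ≥0}
    (hK : ∀ w : RVec d → RVec d, ContDiff ℝ ∞ w → HasCompactSupport w → tsupport w ⊆ Ω →
      eLpNorm w 2 (volOn Ω) ≤
        K * eLpNorm (fun x => symPart (classGrad w x)) (ENNReal.ofReal p) (volOn Ω))
    {u : RVec d → RVec d} {G : RVec d → RTen d} (hu : AEStronglyMeasurable u (volOn Ω))
    (hG : AEStronglyMeasurable G (volOn Ω)) {w : ℕ → RVec d → RVec d}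
    (hw : ∀ n, ContDiff ℝ ∞ (w n) ∧ HasCompactSupport (w n) ∧ tsupport (w n) ⊆ Ω)
    (tw : Tendsto (fun n => eLpNorm (u - w n) (ENNReal.ofReal p) (volOn Ω)) atTop (𝓝 0))
    (tG : Tendsto (fun n => eLpNorm (G - classGrad (w n)) (ENNReal.ofReal p) (volOn Ω))
      atTop (𝓝 0)) :
    Tendsto (fun n => eLpNorm (u - w n) 2 (volOn Ω)) atTop (𝓝 0) := by
  have hp1 : 1 ≤ ENNReal.ofReal p := by simpa using hp.le
  set a : ℕ → ℝ≥0∞ := fun n => eLpNorm (G - classGrad (w n)) (ENNReal.ofReal p) (volOn Ω) with ha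
  have hwm : ∀ n, AEStronglyMeasurable (w n) (volOn Ω) := fun n =>
    (hw n).1.continuous.aestronglyMeasurable
  have hcm : ∀ n, AEStronglyMeasurable (classGrad (w n)) (volOn Ω) := fun n =>
    (continuous_classGrad (hw n).1).aestronglyMeasurable
  have hdiff : ∀ n m, eLpNorm (w m - w n) 2 (volOn Ω) ≤ K * (a n + a m) := by
    intro n m
    have hsub : tsupport (w m - w n) ⊆ Ω := by
      rw [sub_eq_add_neg]
      refine (tsupport_add (w m) (-(w n))).trans (union_subset (hw m).2.2 ?_)
      rw [tsupport, Function.support_neg]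
      exact (hw n).2.2
    refine (hK _ ((hw m).1.sub (hw n).1) ((hw m).2.1.sub (hw n).2.1) hsub).trans ?_
    refine mul_le_mul_right ?_ _
    have e : ∀ x, ‖symPart (classGrad (w m - w n) x)‖ ≤
        ‖((G - classGrad (w n)) - (G - classGrad (w m))) x‖ := by
      intro x
      refine (norm_symPart_le _).trans (le_of_eq ?_)
      rw [classGrad_sub (hw m).1 (hw n).1]
      congr 1
      simp
    refine (eLpNorm_mono e).trans ?_
    exact eLpNorm_sub_le (hG.sub (hcm n)) (hG.sub (hcm m)) hp1
  obtain ⟨ns, hns, hae⟩ : ∃ ns : ℕ → ℕ, StrictMono ns ∧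
      ∀ᵐ x ∂(volOn Ω), Tendsto (fun i => w (ns i) x) atTop (𝓝 (u x)) := by
    have tw' : Tendsto (fun n => eLpNorm (w n - u) (ENNReal.ofReal p) (volOn Ω)) atTop (𝓝 0) := by
      simpa only [eLpNorm_sub_comm] using tw
    exact (tendstoInMeasure_of_tendsto_eLpNorm (by positivity) hwm hu tw').exists_seq_tendsto_ae
  have hbound : ∀ n, eLpNorm (u - w n) 2 (volOn Ω) ≤ K * a n := by
    intro n
    have h1 : eLpNorm (u - w n) 2 (volOn Ω) ≤
        liminf (fun i => eLpNorm (w (ns i) - w n) 2 (volOn Ω)) atTop := by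
      refine Lp.eLpNorm_lim_le_liminf_eLpNorm (f := fun i => w (ns i) - w n)
        (fun i => (hwm _).sub (hwm n)) _ ?_
      filter_upwards [hae] with x hx
      exact hx.sub_const (w n x)
    have h2 : Tendsto (fun i => (K : ℝ≥0∞) * (a n + a (ns i))) atTop (𝓝 (K * (a n + 0))) :=
      ENNReal.Tendsto.const_mul ((tendsto_const_nhds).add (tG.comp hns.tendsto_atTop))
        (Or.inr (by simp))
    refine h1.trans ((liminf_le_liminf (Eventually.of_forall fun i => hdiff n (ns i))).trans ?_)
    rw [h2.liminf_eq, add_zero]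
  have h3 : Tendsto (fun n => (K : ℝ≥0∞) * a n) atTop (𝓝 0) := by
    simpa using ENNReal.Tendsto.const_mul tG (Or.inr (by simp : (K : ℝ≥0∞) ≠ ⊤))
  exact tendsto_of_tendsto_of_tendsto_of_le_of_le tendsto_const_nhds h3 (fun n => zero_le) hbound

theorem MemW0.exists_approx {p : ℝ} {ι : Type} [Fintype ι] {u : RVec d → EuclideanSpace ℝ ι}
    (hu : MemW0 Ω p u) :
    ∃ w : ℕ → RVec d → EuclideanSpace ℝ ι,
      (∀ n, ContDiff ℝ ∞ (w n) ∧ HasCompactSupport (w n) ∧ tsupport (w n) ⊆ Ω) ∧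
      Tendsto (fun n => eLpNorm (u - w n) (ENNReal.ofReal p) (volOn Ω)) atTop (𝓝 0) ∧
      Tendsto (fun n => eLpNorm (weakGrad Ω u - classGrad (w n)) (ENNReal.ofReal p) (volOn Ω))
          atTop (𝓝 0) := by
  obtain ⟨G, hG, u1, G1, w, hw, tw, tw'⟩ := hu
  refine ⟨w, hw, tw, tw'.congr fun n => eLpNorm_congr_ae ?_⟩
  filter_upwards [weakGrad_ae_eq hG] with x hx
  simp [hx]

theorem MemW0.memLp {p : ℝ} {ι : Type} [Fintype ι] {u : RVec d → EuclideanSpace ℝ ι}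
    (hu : MemW0 Ω p u) :
    MemLp u (ENNReal.ofReal p) (volOn Ω) := hu.choose_spec.2.1

theorem memLp_symPart {q : ℝ≥0∞} {G : RVec d → RTen d} (hG : MemLp G q (volOn Ω)) :
    MemLp (fun x => symPart (G x)) q (volOn Ω) :=
  hG.of_le (continuous_symPart.comp_aestronglyMeasurable hG.1)
    (Eventually.of_forall fun _ => norm_symPart_le _)

theorem MemW0.memLp_symGrad {p : ℝ} {u : RVec d → RVec d} (hu : MemW0 Ω p u) :
    MemLp (symGrad Ω u) (ENNReal.ofReal p) (volOn Ω) := memLp_symPart hu.memLp_weakGrad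

/-- The Korn-Sobolev inequality `‖u‖_{L²} ≤ K ‖Du‖_{L^p}` in `W^{1,p}_0(Ω)`. -/
theorem MemW0.eLpNorm_two_le {p : ℝ} (hp : 1 < p) {K : ℝ≥0}
    (hK : ∀ w : RVec d → RVec d, ContDiff ℝ ∞ w → HasCompactSupport w → tsupport w ⊆ Ω →
      eLpNorm w 2 (volOn Ω) ≤
        K * eLpNorm (fun x => symPart (classGrad w x)) (ENNReal.ofReal p) (volOn Ω))
    {u : RVec d → RVec d} (hu : MemW0 Ω p u) :
    eLpNorm u 2 (volOn Ω) ≤ K * eLpNorm (symGrad Ω u) (ENNReal.ofReal p) (volOn Ω) := by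
  obtain ⟨w, hw, tw, tG⟩ := hu.exists_approx
  have hp1 : 1 ≤ ENNReal.ofReal p := by simpa using hp.le
  have t2 := tendsto_eLpNorm_two_of_korn hp hK hu.memLp.1 hu.memLp_weakGrad.1 hw tw tG
  have hwm : ∀ n, AEStronglyMeasurable (w n) (volOn Ω) := fun n =>
    (hw n).1.continuous.aestronglyMeasurable
  have hcm : ∀ n, AEStronglyMeasurable (classGrad (w n)) (volOn Ω) := fun n =>
    (continuous_classGrad (hw n).1).aestronglyMeasurable
  have hb : ∀ n, eLpNorm u 2 (volOn Ω) ≤ eLpNorm (u - w n) 2 (volOn Ω) +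
      K * (eLpNorm (symGrad Ω u) (ENNReal.ofReal p) (volOn Ω) +
        eLpNorm (weakGrad Ω u - classGrad (w n)) (ENNReal.ofReal p) (volOn Ω)) := by
    intro n
    have h1 : eLpNorm u 2 (volOn Ω) ≤ eLpNorm (u - w n) 2 (volOn Ω) +
        eLpNorm (w n) 2 (volOn Ω) := by
      have := eLpNorm_add_le (hu.memLp.1.sub (hwm n)) (hwm n) (p := 2) (by norm_num)
      simpa using this
    refine h1.trans (add_le_add le_rfl ((hK _ (hw n).1 (hw n).2.1 (hw n).2.2).trans
      (mul_le_mul_right ?_ _)))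
    have h2 : (fun x => symPart (classGrad (w n) x)) =
        symGrad Ω u - fun x => symPart ((weakGrad Ω u - classGrad (w n)) x) := by
      funext x
      simp [symGrad, symPart_sub]
    rw [h2]
    refine (eLpNorm_sub_le hu.memLp_symGrad.1 (continuous_symPart.comp_aestronglyMeasurable
      (hu.memLp_weakGrad.1.sub (hcm n))) hp1).trans (add_le_add le_rfl ?_)
    exact eLpNorm_mono fun _ => norm_symPart_le _
  have hlim := t2.add (ENNReal.Tendsto.const_mul (a := (K : ℝ≥0∞))
    ((tendsto_const_nhds (x := eLpNorm (symGrad Ω u) (ENNReal.ofReal p) (volOn Ω))).add tG)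
    (Or.inr (by simp)))
  rw [zero_add, add_zero] at hlim
  exact ge_of_tendsto' hlim hb

end KornSobolevW0

/-! ### Scalar inequalities for `φ'` and `φ` -/

section ScalarInequalities

theorem continuousOn_add_rpow_mul {δ α : ℝ} (hδ : 0 ≤ δ) (hα : -1 < α) :
    ContinuousOn (fun s : ℝ => (δ + s) ^ α * s) (Ici 0) := by
  rcases eq_or_lt_of_le hδ with h | h
  · subst h
    have h1 : EqOn (fun s : ℝ => (0 + s) ^ α * s) (fun s => s ^ (α + 1)) (Ici 0) := by
      intro s hs
      simp only [zero_add]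
      rw [Real.rpow_add_one' hs (by linarith)]
    refine ContinuousOn.congr ?_ h1
    exact continuousOn_id.rpow_const fun x _ => Or.inr (by linarith)
  · refine ContinuousOn.mul (ContinuousOn.rpow_const (by fun_prop) fun s hs => Or.inl ?_)
      continuousOn_id
    have : (0 : ℝ) ≤ s := hs
    positivity

theorem hasDerivAt_add_rpow_mul {δ α s : ℝ} (hδ : 0 ≤ δ) (hs : 0 < s) :
    HasDerivAt (fun s : ℝ => (δ + s) ^ α * s) ((δ + s) ^ (α - 1) * ((α + 1) * s + δ)) s := by
  have h0 : δ + s ≠ 0 := by positivity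
  have h1 : HasDerivAt (fun s : ℝ => δ + s) 1 s := by simpa using (hasDerivAt_id s).const_add δ
  have h2 := (h1.rpow_const (p := α) (Or.inl h0)).mul (hasDerivAt_id s)
  convert! h2 using 1
  have : (δ + s) ^ α = (δ + s) ^ (α - 1) * (δ + s) := by
    rw [← Real.rpow_add_one h0]; ring_nf
  simp only [id, this]
  ring

/-- The constant in `c |F(P) - F(Q)|² ≤ (S(P) - S(Q)) : (P - Q)`. -/
noncomputable def monoConst (p : ℝ) : ℝ := min 1 (p - 1) / max 1 (p / 2) ^ 2

theorem monoConst_pos {p : ℝ} (hp : 1 < p) : 0 < monoConst p := by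
  have : 0 < min 1 (p - 1) := lt_min one_pos (by linarith)
  have : 0 < max 1 (p / 2) := lt_max_of_lt_left one_pos
  unfold monoConst; positivity

theorem monoConst_le_one {p : ℝ} : monoConst p ≤ 1 := by
  have h : 1 ≤ max 1 (p / 2) := le_max_left _ _
  unfold monoConst
  rw [div_le_one (by positivity)]
  exact (min_le_left _ _).trans (by nlinarith)

/-- This is `c (ψ')² ≤ φ''` for `ψ(s) = (δ + s)^{(p-2)/2} s`, after division by `(δ + s)^{p-4}`. -/
theorem monoConst_mul_sq_le {δ p s : ℝ} (hδ : 0 ≤ δ) (hp : 1 < p) (hs : 0 ≤ s) :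
    monoConst p * (p / 2 * s + δ) ^ 2 ≤ (δ + s) * ((p - 1) * s + δ) := by
  set M := max 1 (p / 2)
  set m := min 1 (p - 1)
  have hm : 0 < m := lt_min one_pos (by linarith)
  have hM : 0 < M := lt_max_of_lt_left one_pos
  have h1 : p / 2 * s + δ ≤ M * (δ + s) := by
    have : p / 2 * s ≤ M * s := by gcongr; exact le_max_right _ _
    have : 1 * δ ≤ M * δ := by gcongr; exact le_max_left _ _
    linarith
  have h2 : m * (δ + s) ≤ (p - 1) * s + δ := by
    have : m * s ≤ (p - 1) * s := by gcongr; exact min_le_right _ _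
    have : m * δ ≤ 1 * δ := by gcongr; exact min_le_left _ _
    linarith
  have h3 : (p / 2 * s + δ) ^ 2 ≤ (M * (δ + s)) ^ 2 := by gcongr
  calc monoConst p * (p / 2 * s + δ) ^ 2 ≤ m / M ^ 2 * (M * (δ + s)) ^ 2 := by
        rw [monoConst]; gcongr
    _ = (δ + s) * (m * (δ + s)) := by field_simp
    _ ≤ _ := by gcongr

/-- The scalar form of the monotonicity estimate. For every `l` the function
`φ' - 2 c l ψ + c l² s` is nondecreasing, because `c (ψ')² ≤ φ''`; the optimal `l` gives
the claim. -/
theorem monoConst_mul_sq_sub_le {δ p a b : ℝ} (hδ : 0 ≤ δ) (hp : 1 < p) (ha : 0 ≤ a) (hb : 0 ≤ b) :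
    monoConst p * ((δ + a) ^ ((p - 2) / 2) * a - (δ + b) ^ ((p - 2) / 2) * b) ^ 2 ≤
      (phiDeriv δ p a - phiDeriv δ p b) * (a - b) := by
  wlog hab : b ≤ a generalizing a b
  · have := this hb ha (le_of_not_ge hab)
    linarith
  rcases eq_or_lt_of_le hab with rfl | hlt
  · simp
  have hc := monoConst_pos hp
  set c := monoConst p
  have hmono : ∀ l : ℝ, MonotoneOn (fun s : ℝ => phiDeriv δ p s -
      2 * c * l * ((δ + s) ^ ((p - 2) / 2) * s) + c * l ^ 2 * s) (Ici 0) := by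
    intro l
    have hd : ∀ s ∈ interior (Ici (0 : ℝ)), HasDerivAt (fun s : ℝ => phiDeriv δ p s -
        2 * c * l * ((δ + s) ^ ((p - 2) / 2) * s) + c * l ^ 2 * s)
        ((δ + s) ^ (p - 2 - 1) * ((p - 2 + 1) * s + δ) -
          2 * c * l * ((δ + s) ^ ((p - 2) / 2 - 1) * (((p - 2) / 2 + 1) * s + δ)) +
              c * l ^ 2) s := by
      intro s hs
      rw [interior_Ici] at hs
      have h3 : HasDerivAt (fun s : ℝ => c * l ^ 2 * s) (c * l ^ 2) s := by
        simpa using (hasDerivAt_id s).const_mul (c * l ^ 2)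
      exact ((hasDerivAt_add_rpow_mul hδ hs).sub
        ((hasDerivAt_add_rpow_mul hδ hs).const_mul (2 * c * l))).add h3
    refine monotoneOn_of_deriv_nonneg (convex_Ici 0) ?_
      (fun s hs => (hd s hs).differentiableAt.differentiableWithinAt) ?_
    · exact ((continuousOn_add_rpow_mul hδ (by linarith)).sub
        (continuousOn_const.mul (continuousOn_add_rpow_mul hδ (by linarith)))).add (by fun_prop)
    · intro s hs
      rw [(hd s hs).deriv]
      rw [interior_Ici] at hs
      have hs' : 0 < s := hs
      have hr : 0 < δ + s := by positivity
      set X := (δ + s) ^ ((p - 2) / 2 - 1) with hX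
      have hX2 : (δ + s) ^ (p - 2 - 1) = X ^ 2 * (δ + s) := by
        rw [hX, ← Real.rpow_natCast, ← Real.rpow_mul hr.le, ← Real.rpow_add_one hr.ne']
        congr 1; push_cast; ring
      rw [hX2]
      have h1 := mul_le_mul_of_nonneg_left (monoConst_mul_sq_le hδ hp hs'.le) (sq_nonneg X)
      have h2 : 0 ≤ c * (X * (p / 2 * s + δ) - l) ^ 2 := by positivity
      have e : (p - 2) / 2 + 1 = p / 2 := by ring
      have e' : p - 2 + 1 = p - 1 := by ring
      rw [e, e']
      linarith
  set E := (δ + a) ^ ((p - 2) / 2) * a - (δ + b) ^ ((p - 2) / 2) * b with hE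
  have ht : 0 < a - b := by linarith
  have h := hmono (E / (a - b)) hb ha hab
  simp only at h
  have h2 : 0 ≤ (phiDeriv δ p a - phiDeriv δ p b) - 2 * c * (E / (a - b)) * E +
      c * (E / (a - b)) ^ 2 * (a - b) := by
    rw [hE] at h ⊢; linarith
  have h3 : 2 * c * (E / (a - b)) * E - c * (E / (a - b)) ^ 2 * (a - b) = c * E ^ 2 / (a - b) := by
    field_simp; ring
  have h4 : c * E ^ 2 / (a - b) ≤ phiDeriv δ p a - phiDeriv δ p b := by linarith
  rwa [div_le_iff₀ ht] at h4

theorem phiDeriv_mono {δ p a b : ℝ} (hδ : 0 ≤ δ) (hp : 1 < p) (ha : 0 ≤ a) (hab : a ≤ b) :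
    phiDeriv δ p a ≤ phiDeriv δ p b := by
  rcases eq_or_lt_of_le hab with rfl | hlt
  · exact le_rfl
  have h := (mul_nonneg (monoConst_pos hp).le (sq_nonneg _)).trans
    (monoConst_mul_sq_sub_le hδ hp (ha.trans hab) ha)
  have := nonneg_of_mul_nonneg_left h (by linarith : 0 < b - a)
  linarith

/-- The `N`-function `φ(s) = ∫₀ˢ φ'`, extended evenly. -/
noncomputable def phiPot (δ p s : ℝ) : ℝ := ∫ r in (0 : ℝ)..s, phiDeriv δ p |r|

theorem continuous_phiDeriv_abs {δ p : ℝ} (hδ : 0 ≤ δ) (hp : 1 < p) :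
    Continuous fun r : ℝ => phiDeriv δ p |r| :=
  (continuousOn_add_rpow_mul hδ (by linarith)).comp_continuous continuous_abs fun r => abs_nonneg r

theorem phiPot_sub {δ p : ℝ} (hδ : 0 ≤ δ) (hp : 1 < p) (a b : ℝ) :
    phiPot δ p b - phiPot δ p a = ∫ r in a..b, phiDeriv δ p |r| :=
  intervalIntegral.integral_interval_sub_left
    ((continuous_phiDeriv_abs hδ hp).intervalIntegrable _ _)
    ((continuous_phiDeriv_abs hδ hp).intervalIntegrable _ _)

theorem continuous_phiPot {δ p : ℝ} (hδ : 0 ≤ δ) (hp : 1 < p) : Continuous (phiPot δ p) :=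
  intervalIntegral.continuous_primitive
    (fun _ _ => (continuous_phiDeriv_abs hδ hp).intervalIntegrable _ _) 0

theorem phiDeriv_mul_le_phiPot_sub {δ p a b : ℝ} (hδ : 0 ≤ δ) (hp : 1 < p) (ha : 0 ≤ a)
    (hb : 0 ≤ b) :
    phiDeriv δ p a * (b - a) ≤ phiPot δ p b - phiPot δ p a := by
  have hi : ∀ x y, IntervalIntegrable (fun r : ℝ => phiDeriv δ p |r|) volume x y := fun x y =>
    (continuous_phiDeriv_abs hδ hp).intervalIntegrable _ _
  rw [phiPot_sub hδ hp]
  rcases le_total a b with h | h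
  · have := intervalIntegral.integral_mono_on h
      (intervalIntegrable_const (c := phiDeriv δ p a)) (hi a b)
      fun r hr => by
        rw [abs_of_nonneg (ha.trans hr.1)]; exact phiDeriv_mono hδ hp ha hr.1
    rw [intervalIntegral.integral_const, smul_eq_mul] at this
    linarith
  · have := intervalIntegral.integral_mono_on h (hi b a)
      (intervalIntegrable_const (c := phiDeriv δ p a))
      fun r hr => by
        rw [abs_of_nonneg (hb.trans hr.1)]; exact phiDeriv_mono hδ hp (hb.trans hr.1) hr.2
    rw [intervalIntegral.integral_const, smul_eq_mul] at this
    rw [intervalIntegral.integral_symm]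
    linarith

theorem phiPot_zero (δ p : ℝ) : phiPot δ p 0 = 0 := intervalIntegral.integral_same

theorem phiPot_le {δ p s : ℝ} (hδ : 0 ≤ δ) (hp : 1 < p) (hs : 0 ≤ s) : phiPot δ p s ≤
    phiDeriv δ p s * s := by
  have h := phiDeriv_mul_le_phiPot_sub hδ hp hs le_rfl
  rw [phiPot_zero] at h
  linarith

/-- The constant in the lower bound `c |F(P)|² ≤ φ(|P|)`. -/
noncomputable def potConst (p : ℝ) : ℝ := min 1 ((1 / 2 : ℝ) ^ (p - 2)) / 4

theorem potConst_pos (p : ℝ) : 0 < potConst p := by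
  unfold potConst
  have : 0 < min 1 ((1 / 2 : ℝ) ^ (p - 2)) := lt_min one_pos (by positivity)
  positivity

/-- Since `φ'` is nondecreasing, `φ(s) ≥ (s/2) φ'(s/2)`. -/
theorem le_phiPot {δ p s : ℝ} (hδ : 0 ≤ δ) (hp : 1 < p) (hs : 0 ≤ s) :
    potConst p * (phiDeriv δ p s * s) ≤ phiPot δ p s := by
  rcases eq_or_lt_of_le hs with rfl | hs0
  · simp [phiPot_zero]
  have h1 := phiDeriv_mul_le_phiPot_sub hδ hp (by positivity : 0 ≤ s / 2) hs
  have h2 := phiDeriv_mul_le_phiPot_sub hδ hp le_rfl (by positivity : 0 ≤ s / 2)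
  have h3 : 0 ≤ phiDeriv δ p 0 * (s / 2 - 0) := by simp [phiDeriv]
  rw [phiPot_zero] at h2
  have h4 : min 1 ((1 / 2 : ℝ) ^ (p - 2)) * (δ + s) ^ (p - 2) ≤ (δ + s / 2) ^ (p - 2) := by
    rcases le_total 2 p with h | h
    · calc _ ≤ (1 / 2 : ℝ) ^ (p - 2) * (δ + s) ^ (p - 2) := by gcongr; exact min_le_right _ _
        _ = (1 / 2 * (δ + s)) ^ (p - 2) := by rw [Real.mul_rpow (by norm_num) (by positivity)]
        _ ≤ _ := Real.rpow_le_rpow (by positivity) (by linarith) (by linarith)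
    · calc _ ≤ 1 * (δ + s) ^ (p - 2) := by gcongr; exact min_le_left _ _
        _ = (δ + s) ^ (p - 2) := one_mul _
        _ ≤ _ := Real.rpow_le_rpow_of_nonpos (by positivity) (by linarith) (by linarith)
  have h5 : phiDeriv δ p (s / 2) * (s - s / 2) ≤ phiPot δ p s := by linarith
  refine le_trans ?_ h5
  unfold phiDeriv potConst
  have := mul_le_mul_of_nonneg_right h4 (by positivity : 0 ≤ s ^ 2 / 4)
  linarith

/-- Coercivity, uniformly in `δ ∈ [0,1]`. -/
theorem rpow_le_two_mul_add_one {δ p s : ℝ} (hδ : 0 ≤ δ) (hδ1 : δ ≤ 1) (hp : 1 < p) (hs : 0 ≤ s) :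
    s ^ p ≤ 2 * (phiDeriv δ p s * s) + 1 := by
  have hnn : 0 ≤ phiDeriv δ p s * s := by unfold phiDeriv; positivity
  rcases eq_or_lt_of_le hs with rfl | hs0
  · rw [Real.zero_rpow (by linarith)]; simp [phiDeriv]
  have e : s ^ p = s ^ (p - 2) * s * s := by
    rw [mul_assoc, ← sq, ← Real.rpow_natCast s 2, ← Real.rpow_add hs0]; congr 1; push_cast; ring
  rcases le_total 2 p with h | h
  · have : s ^ p ≤ phiDeriv δ p s * s := by
      rw [e, phiDeriv]
      gcongr
      linarith
    linarith
  · rcases le_total s δ with h' | h'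
    · have : s ^ p ≤ 1 := Real.rpow_le_one hs (h'.trans hδ1) (by linarith)
      linarith
    · have h1 : (2 * s) ^ (p - 2) ≤ (δ + s) ^ (p - 2) :=
        Real.rpow_le_rpow_of_nonpos (by positivity) (by linarith) (by linarith)
      have h2 : (1 / 2 : ℝ) ≤ 2 ^ (p - 2) := by
        have : (2 : ℝ) ^ (-1 : ℝ) ≤ 2 ^ (p - 2) := Real.rpow_le_rpow_of_exponent_le
          (by norm_num) (by linarith)
        rw [Real.rpow_neg_one] at this
        linarith
      rw [Real.mul_rpow (by norm_num) hs] at h1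
      have h3 : 1 / 2 * s ^ (p - 2) ≤ (δ + s) ^ (p - 2) :=
        le_trans (by gcongr) h1
      rw [e, phiDeriv]
      have h4 := mul_le_mul_of_nonneg_right h3 (by positivity : 0 ≤ s * s)
      linarith

theorem phiDeriv_le_rpow {δ p s : ℝ} (hδ : 0 ≤ δ) (hp : 1 < p) (hs : 0 ≤ s) :
    phiDeriv δ p s ≤ (δ + s) ^ (p - 1) := by
  unfold phiDeriv
  have h : (δ + s) ^ (p - 1) = (δ + s) ^ (p - 2) * (δ + s) := by
    rw [← Real.rpow_add_one' (by positivity) (by linarith)]; ring_nf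
  rw [h]
  gcongr
  linarith

/-- A weighted Young inequality. -/
theorem rpow_mul_le_young {p a b : ℝ} (hp : 1 < p) (ha : 0 ≤ a) (hb : 0 ≤ b) :
    a ^ (p - 1) * b ≤ 1 / 4 * b ^ p + (4 : ℝ) ^ (1 / (p - 1)) * a ^ p := by
  have hp1 : 0 < p - 1 := by linarith
  set K : ℝ := (4 : ℝ) ^ (1 / (p - 1)) with hK
  have hK0 : 0 < K := by positivity
  have ea : a ^ p = a ^ (p - 1) * a := by
    rw [← Real.rpow_add_one' ha (by linarith)]; ring_nf
  have eb : b ^ p = b ^ (p - 1) * b := by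
    rw [← Real.rpow_add_one' hb (by linarith)]; ring_nf
  have h1 : 0 ≤ a ^ (p - 1) := by positivity
  rcases le_total b (K * a) with h | h
  · have : a ^ (p - 1) * b ≤ K * a ^ p := by
      rw [ea]; nlinarith [mul_le_mul_of_nonneg_left h h1]
    have : 0 ≤ b ^ p := by positivity
    linarith
  · have h2 : (K * a) ^ (p - 1) ≤ b ^ (p - 1) := Real.rpow_le_rpow (by positivity) h hp1.le
    rw [Real.mul_rpow hK0.le ha, hK, ← Real.rpow_mul (by norm_num), one_div_mul_cancel hp1.ne',
        Real.rpow_one] at h2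
    have : a ^ (p - 1) * b ≤ 1 / 4 * b ^ p := by
      rw [eb]; nlinarith [mul_le_mul_of_nonneg_right h2 hb]
    have : 0 ≤ K * a ^ p := by positivity
    linarith

end ScalarInequalities

/-! ### Inequalities for `S` and `F` -/

section TensorInequalities
variable {d : ℕ}

theorem stressS_eq (δ p : ℝ) (P : RTen d) :
    stressS δ p P = ((δ + ‖symPart P‖) ^ (p - 2)) • symPart P := by
  rcases eq_or_ne (symPart P) 0 with h | h
  · simp [stressS, h]
  · rw [stressS, phiDeriv, mul_div_cancel_right₀ _ (norm_ne_zero_iff.2 h)]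

theorem continuous_add_norm_rpow_smul {δ α : ℝ} (hδ : 0 ≤ δ) (hα : -1 < α) :
    Continuous fun P : RTen d => ((δ + ‖symPart P‖) ^ α) • symPart P := by
  have hn : Continuous fun P : RTen d => (δ + ‖symPart P‖) ^ α * ‖symPart P‖ :=
    (continuousOn_add_rpow_mul hδ hα).comp_continuous continuous_symPart.norm fun P => norm_nonneg _
  rw [continuous_iff_continuousAt]
  intro P
  rcases eq_or_ne (symPart P) 0 with h | h
  · rw [ContinuousAt, h, smul_zero, tendsto_zero_iff_norm_tendsto_zero]
    have h1 := hn.tendsto P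
    rw [h, norm_zero, mul_zero] at h1
    refine h1.congr fun Q => ?_
    rw [norm_smul, Real.norm_of_nonneg (by positivity)]
  · have h1 : δ + ‖symPart P‖ ≠ 0 := by
      have := norm_pos_iff.2 h
      positivity
    exact ((continuous_const.add continuous_symPart.norm).continuousAt.rpow_const (Or.inl h1)).smul
      continuous_symPart.continuousAt

theorem continuous_stressS {δ p : ℝ} (hδ : 0 ≤ δ) (hp : 1 < p) :
    Continuous (stressS δ p : RTen d → RTen d) := by
  have : (stressS δ p : RTen d → RTen d) = fun P => ((δ + ‖symPart P‖) ^ (p - 2)) • symPart P :=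
    funext fun P => stressS_eq δ p P
  rw [this]
  exact continuous_add_norm_rpow_smul hδ (by linarith)

theorem continuous_tensorF {δ p : ℝ} (hδ : 0 ≤ δ) (hp : 1 < p) :
    Continuous (tensorF δ p : RTen d → RTen d) :=
  continuous_add_norm_rpow_smul hδ (by linarith)

theorem norm_stressS {δ p : ℝ} (hδ : 0 ≤ δ) (P : RTen d) :
    ‖stressS δ p P‖ = phiDeriv δ p ‖symPart P‖ := by
  rw [stressS_eq, norm_smul, Real.norm_of_nonneg (by positivity), phiDeriv]

theorem norm_sq_tensorF {δ p : ℝ} (hδ : 0 ≤ δ) (P : RTen d) :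
    ‖tensorF δ p P‖ ^ 2 = phiDeriv δ p ‖symPart P‖ * ‖symPart P‖ := by
  have h0 : 0 ≤ δ + ‖symPart P‖ := by positivity
  rw [tensorF, norm_smul, Real.norm_of_nonneg (by positivity), mul_pow, phiDeriv,
      ← Real.rpow_natCast,
    ← Real.rpow_mul h0]
  have : (p - 2) / 2 * ((2 : ℕ) : ℝ) = p - 2 := by push_cast; ring
  rw [this]
  ring

theorem inner_stressS_self {δ p : ℝ} (hδ : 0 ≤ δ) (P : RTen d) :
    inner ℝ (stressS δ p P) (symPart P) = ‖tensorF δ p P‖ ^ 2 := by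
  rw [stressS_eq, real_inner_smul_left, real_inner_self_eq_norm_sq, norm_sq_tensorF hδ, phiDeriv]
  ring

/-- Monotonicity of the stress. Both sides are affine in `P : Q`; the difference is decreasing in
`P : Q ≤ |P| |Q|`, and for parallel tensors the estimate is scalar. -/
theorem monoConst_mul_norm_sq_le {δ p : ℝ} (hδ : 0 ≤ δ) (hp : 1 < p) (P Q : RTen d) :
    monoConst p * ‖tensorF δ p P - tensorF δ p Q‖ ^ 2 ≤
      inner ℝ (stressS δ p P - stressS δ p Q) (symPart P - symPart Q) := by
  have hc := (monoConst_pos hp).le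
  have hc1 := monoConst_le_one (p := p)
  have hs := monoConst_mul_sq_sub_le hδ hp (norm_nonneg (symPart P)) (norm_nonneg (symPart Q))
  rw [stressS_eq, stressS_eq, tensorF, tensorF]
  unfold phiDeriv at hs
  have hA : ∀ R : RTen d, (δ + ‖symPart R‖) ^ (p - 2) =
      ((δ + ‖symPart R‖) ^ ((p - 2) / 2)) ^ 2 := by
    intro R
    rw [← Real.rpow_natCast, ← Real.rpow_mul (by positivity)]
    congr 1; push_cast; ring
  have hB : ∀ R : RTen d, 0 ≤ (δ + ‖symPart R‖) ^ ((p - 2) / 2) := fun R => by positivity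
  rw [hA P, hA Q] at hs ⊢
  have hβ := hB P
  have hβ' := hB Q
  have ht := real_inner_le_norm (symPart P) (symPart Q)
  set β := (δ + ‖symPart P‖) ^ ((p - 2) / 2)
  set β' := (δ + ‖symPart Q‖) ^ ((p - 2) / 2)
  set c := monoConst p
  have e1 : ‖β • symPart P - β' • symPart Q‖ ^ 2 =
      β ^ 2 * ‖symPart P‖ ^ 2 + β' ^ 2 * ‖symPart Q‖ ^ 2 - 2 * β * β' * inner ℝ (symPart P)
          (symPart Q) := by
    rw [norm_sub_sq_real, norm_smul, norm_smul, real_inner_smul_left, real_inner_smul_right,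
      Real.norm_of_nonneg hβ, Real.norm_of_nonneg hβ']
    ring
  have e2 : inner ℝ (β ^ 2 • symPart P - β' ^ 2 • symPart Q) (symPart P - symPart Q) =
      β ^ 2 * ‖symPart P‖ ^ 2 + β' ^ 2 * ‖symPart Q‖ ^ 2 - (β ^ 2 + β' ^ 2) * inner ℝ (symPart P)
          (symPart Q) := by
    simp only [inner_sub_left, inner_sub_right, real_inner_smul_left, real_inner_self_eq_norm_sq,
      real_inner_comm (symPart P) (symPart Q)]
    ring
  rw [e1, e2]
  have hcoef : 0 ≤ β ^ 2 + β' ^ 2 - 2 * c * (β * β') := by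
    nlinarith [sq_nonneg (β - β'), mul_nonneg hβ hβ']
  have := mul_le_mul_of_nonneg_left ht hcoef
  nlinarith

/-- `F` is injective on symmetric tensors. -/
theorem symPart_eq_of_tensorF_eq {δ p : ℝ} (hδ : 0 ≤ δ) (hp : 1 < p) {P Q : RTen d}
    (h : tensorF δ p P = tensorF δ p Q) : symPart P = symPart Q := by
  -- `|F|²= φ'(s) s` is strictly increasing in `s`
  have hmono : ∀ a b : ℝ, 0 ≤ a → a < b → phiDeriv δ p a * a < phiDeriv δ p b * b := by
    intro a b ha hab
    have h1 := phiDeriv_mono hδ hp ha hab.le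
    have h2 : 0 < phiDeriv δ p b := by
      have : 0 < b := ha.trans_lt hab
      unfold phiDeriv; positivity
    nlinarith
  have hn : ‖symPart P‖ = ‖symPart Q‖ := by
    have h2 : phiDeriv δ p ‖symPart P‖ * ‖symPart P‖ = phiDeriv δ p ‖symPart Q‖ * ‖symPart Q‖ := by
      rw [← norm_sq_tensorF hδ, ← norm_sq_tensorF hδ, h]
    rcases lt_trichotomy ‖symPart P‖ ‖symPart Q‖ with h3 | h3 | h3
    · exact absurd h2 (hmono _ _ (norm_nonneg _) h3).ne
    · exact h3
    · exact absurd h2 (hmono _ _ (norm_nonneg _) h3).ne'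
  rcases eq_or_ne (symPart P) 0 with h0 | h0
  · rw [h0, norm_zero] at hn
    rw [h0, norm_eq_zero.1 hn.symm]
  · rw [tensorF, tensorF, ← hn] at h
    have : (δ + ‖symPart P‖) ^ ((p - 2) / 2) ≠ 0 := by
      have := norm_pos_iff.2 h0
      positivity
    exact smul_right_injective _ this h

theorem inner_stressS_le_phiPot_sub {δ p : ℝ} (hδ : 0 ≤ δ) (hp : 1 < p) (P Q : RTen d) :
    inner ℝ (stressS δ p P) (symPart Q - symPart P) ≤
        phiPot δ p ‖symPart Q‖ - phiPot δ p ‖symPart P‖ := by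
  refine le_trans ?_ (phiDeriv_mul_le_phiPot_sub hδ hp (norm_nonneg (symPart P))
    (norm_nonneg (symPart Q)))
  rw [stressS_eq, real_inner_smul_left, inner_sub_right, real_inner_self_eq_norm_sq,
      phiDeriv, mul_assoc]
  have := real_inner_le_norm (symPart P) (symPart Q)
  gcongr
  linarith

theorem norm_stressS_le {δ p : ℝ} (hδ : 0 ≤ δ) (hδ1 : δ ≤ 1) (hp : 1 < p) (P : RTen d) :
    ‖stressS δ p P‖ ≤ (1 + ‖symPart P‖) ^ (p - 1) := by
  rw [norm_stressS hδ]
  refine (phiDeriv_le_rpow hδ hp (norm_nonneg _)).trans ?_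
  exact Real.rpow_le_rpow (by positivity) (by linarith) (by linarith)

theorem norm_sq_tensorF_le {δ p : ℝ} (hδ : 0 ≤ δ) (hδ1 : δ ≤ 1) (hp : 1 < p) (P : RTen d) :
    ‖tensorF δ p P‖ ^ 2 ≤ (1 + ‖symPart P‖) ^ p := by
  rw [← inner_stressS_self hδ]
  refine (real_inner_le_norm _ _).trans ?_
  have e : (1 + ‖symPart P‖) ^ p = (1 + ‖symPart P‖) ^ (p - 1) * (1 + ‖symPart P‖) := by
    rw [← Real.rpow_add_one (by positivity)]; ring_nf
  rw [e]
  gcongr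
  · exact norm_stressS_le hδ hδ1 hp P
  · linarith

end TensorInequalities

/-! ### Peano's theorem and the energy estimate -/

section Peano
variable {V : Type*} [NormedAddCommGroup V] [NormedSpace ℝ V]

/-- The delayed Picard map `v ↦ u₀ + ∫₀ᵗ g(s, v(s - τ)) ds`, with value `u₀` for `t ≤ 0`. -/
noncomputable def delayedPicard (g : ℝ → V → V) (u₀ : V) (τ : ℝ) (v : ℝ → V) (t : ℝ) : V :=
  u₀ + ∫ s in (0 : ℝ)..max t 0, g s (v (s - τ))

theorem delayedPicard_lipschitz [CompleteSpace V] {g : ℝ → V → V}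
    (hg : Continuous (Function.uncurry g)) {M : ℝ}
    (hM : ∀ t x, ‖g t x‖ ≤ M) (u₀ : V) (τ : ℝ) {v : ℝ → V} (hv : Continuous v) (t t' : ℝ) :
    ‖delayedPicard g u₀ τ v t - delayedPicard g u₀ τ v t'‖ ≤ M * |t - t'| := by
  have hc : Continuous fun s => g s (v (s - τ)) :=
    hg.comp (continuous_id.prodMk (hv.comp (by fun_prop)))
  have hM0 : 0 ≤ M := (norm_nonneg _).trans (hM 0 0)
  rw [delayedPicard, delayedPicard, add_sub_add_left_eq_sub,
    intervalIntegral.integral_interval_sub_left (hc.intervalIntegrable _ _)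
      (hc.intervalIntegrable _ _)]
  refine (intervalIntegral.norm_integral_le_of_norm_le_const fun s _ => hM _ _).trans ?_
  exact mul_le_mul_of_nonneg_left (abs_max_sub_max_le_abs t t' 0) hM0

theorem continuous_of_norm_sub_le {V : Type*} [NormedAddCommGroup V] {v : ℝ → V} {M : ℝ}
    (h : ∀ t t', ‖v t - v t'‖ ≤ M * |t - t'|) :
    Continuous v := by
  have : LipschitzWith (Real.toNNReal M) v := LipschitzWith.of_dist_le_mul fun t t' => by
    rw [dist_eq_norm, Real.dist_eq]
    refine (h t t').trans ?_
    gcongr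
    exact Real.le_coe_toNNReal M
  exact this.continuous

/-- The delayed equation can be solved step by step: the iterates of the delayed Picard map become
stationary on longer and longer intervals. -/
theorem exists_delayed_solution [CompleteSpace V] {g : ℝ → V → V}
    (hg : Continuous (Function.uncurry g)) {M : ℝ}
    (hM : ∀ t x, ‖g t x‖ ≤ M) (u₀ : V) {τ : ℝ} (hτ : 0 < τ) (T : ℝ) :
    ∃ v : ℝ → V, (∀ t t', ‖v t - v t'‖ ≤ M * |t - t'|) ∧
      ∀ t ∈ Icc 0 T, v t = u₀ + ∫ s in (0 : ℝ)..t, g s (v (s - τ)) := by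
  have hM0 : 0 ≤ M := (norm_nonneg _).trans (hM 0 0)
  set v : ℕ → ℝ → V := fun n => (delayedPicard g u₀ τ)^[n] fun _ => u₀ with hv
  have hsucc : ∀ n, v (n + 1) = delayedPicard g u₀ τ (v n) := fun n =>
    Function.iterate_succ_apply' _ _ _
  have hlip : ∀ n t t', ‖v n t - v n t'‖ ≤ M * |t - t'| := by
    intro n
    induction n with
    | zero => intro t t'; simp only [hv, Function.iterate_zero, id, sub_self, norm_zero]; positivity
    | succ n ih =>
      rw [hsucc]
      exact delayedPicard_lipschitz hg hM u₀ τ (continuous_of_norm_sub_le ih)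
  have hstat : ∀ n : ℕ, ∀ t ≤ n * τ, v (n + 1) t = v n t := by
    intro n
    induction n with
    | zero =>
      intro t ht
      rw [hsucc]
      have : max t 0 = 0 := max_eq_right (by simpa using ht)
      simp [delayedPicard, this, hv]
    | succ n ih =>
      intro t ht
      have h : delayedPicard g u₀ τ (v (n + 1)) t = delayedPicard g u₀ τ (v n) t := by
        unfold delayedPicard
        congr 1
        refine intervalIntegral.integral_congr fun s hs => ?_
        rw [uIcc_of_le (le_max_right _ _)] at hs
        have hs2 : s ≤ (n + 1 : ℕ) * τ := hs.2.trans (max_le ht (by positivity))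
        have : v (n + 1) (s - τ) = v n (s - τ) := ih _ (by push_cast at hs2; linarith)
        simp only [this]
      rw [hsucc (n + 1), h, ← hsucc]
  obtain ⟨N, hN⟩ := exists_nat_ge (T / τ)
  rw [div_le_iff₀ hτ] at hN
  refine ⟨v N, hlip N, fun t ht => ?_⟩
  rw [← hstat N t (ht.2.trans hN), hsucc, delayedPicard, max_eq_left ht.1]

/-- Peano's existence theorem for a bounded continuous right-hand side. -/
theorem exists_integral_solution [FiniteDimensional ℝ V] {g : ℝ → V → V}
    (hg : Continuous (Function.uncurry g))
    {M : ℝ} (hM : ∀ t x, ‖g t x‖ ≤ M) (u₀ : V) {T : ℝ} (hT : 0 < T) :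
    ∃ u : ℝ → V, Continuous u ∧ ∀ t ∈ Icc 0 T, u t = u₀ + ∫ s in (0 : ℝ)..t, g s (u s) := by
  have : CompleteSpace V := FiniteDimensional.complete ℝ V
  have : ProperSpace V := FiniteDimensional.proper ℝ V
  have hM0 : 0 ≤ M := (norm_nonneg _).trans (hM 0 0)
  set τ : ℕ → ℝ := fun n => 1 / ((n : ℝ) + 1) with hτ
  have hτ0 : ∀ n, 0 < τ n := fun n => by simp only [hτ]; positivity
  have hτlim : Tendsto τ atTop (𝓝 0) := tendsto_one_div_add_atTop_nhds_zero_nat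
  choose w hlip hw using fun n => exists_delayed_solution hg hM u₀ (hτ0 n) T
  have hwc : ∀ n, Continuous (w n) := fun n => continuous_of_norm_sub_le (hlip n)
  set z : ℕ → BoundedContinuousFunction (Icc (0 : ℝ) T) V := fun n =>
    BoundedContinuousFunction.mkOfCompact
      ⟨fun t => w n t, (hwc n).comp continuous_subtype_val⟩ with hz
  have hcomp : IsCompact (closure (range z)) := by
    refine BoundedContinuousFunction.arzela_ascoli (Metric.closedBall u₀ (M * T))
      (isCompact_closedBall _ _) _ ?_ ?_
    · rintro _ t ⟨n, rfl⟩
      rw [mem_closedBall_iff_norm]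
      have h0 : w n 0 = u₀ := by simpa using hw n 0 ⟨le_rfl, hT.le⟩
      have h1 := hlip n t 0
      rw [h0, sub_zero, abs_of_nonneg t.2.1] at h1
      exact h1.trans (by gcongr; exact t.2.2)
    · refine Metric.equicontinuous_of_continuity_modulus (fun r => M * r) ?_ _ ?_
      · have : Continuous fun r : ℝ => M * r := by fun_prop
        simpa using this.tendsto 0
      · rintro x y ⟨_, ⟨n, rfl⟩⟩
        rw [dist_eq_norm]
        exact hlip n x y
  obtain ⟨y, -, φ, hφ, hlim⟩ := hcomp.tendsto_subseq fun n => subset_closure (mem_range_self n)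
  have hpt : ∀ t : Icc (0 : ℝ) T, Tendsto (fun n => w (φ n) t) atTop (𝓝 (y t)) := fun t =>
    ((BoundedContinuousFunction.lipschitz_eval_const t).continuous.tendsto y).comp hlim
  refine ⟨IccExtend hT.le y, y.continuous.Icc_extend', fun t ht => ?_⟩
  have hyt : ∀ s (hs : s ∈ Icc 0 T), IccExtend hT.le y s = y ⟨s, hs⟩ := fun s hs =>
    IccExtend_of_mem _ _ hs
  rw [hyt t ht]
  have hI : Tendsto (fun n => ∫ s in (0 : ℝ)..t, g s (w (φ n) (s - τ (φ n)))) atTop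
      (𝓝 (∫ s in (0 : ℝ)..t, g s (IccExtend hT.le y s))) := by
    refine intervalIntegral.tendsto_integral_filter_of_dominated_convergence
      (fun _ => M) ?_ ?_ ?_ ?_
    · refine Eventually.of_forall fun n => Continuous.aestronglyMeasurable ?_
      exact hg.comp (continuous_id.prodMk ((hwc _).comp (by fun_prop)))
    · exact Eventually.of_forall fun n => ae_of_all _ fun s _ => hM _ _
    · exact intervalIntegrable_const
    · refine ae_of_all _ fun s hs => ?_
      rw [uIoc_of_le ht.1] at hs
      have hs' : s ∈ Icc 0 T := ⟨hs.1.le, hs.2.trans ht.2⟩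
      have h1 : Tendsto (fun n => w (φ n) (s - τ (φ n))) atTop (𝓝 (IccExtend hT.le y s)) := by
        rw [hyt s hs']
        have h2 : Tendsto (fun n => w (φ n) (s - τ (φ n)) - w (φ n) s) atTop (𝓝 0) := by
          refine squeeze_zero_norm (fun n => hlip (φ n) _ _) ?_
          have : Tendsto (fun n => M * |τ (φ n)|) atTop (𝓝 (M * |0|)) :=
            ((hτlim.comp hφ.tendsto_atTop).abs).const_mul M
          simpa using this
        simpa using h2.add (hpt ⟨s, hs'⟩)
      exact (hg.tendsto (s, IccExtend hT.le y s)).comp (tendsto_const_nhds.prodMk_nhds h1)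
  refine tendsto_nhds_unique (hpt ⟨t, ht⟩) ?_
  refine (tendsto_const_nhds.add hI).congr fun n => ?_
  exact (hw (φ n) t ht).symm

end Peano

section Energy
variable {V : Type*} [NormedAddCommGroup V] [InnerProductSpace ℝ V]

theorem hasDerivAt_of_within_Icc {F : Type*} [NormedAddCommGroup F] [NormedSpace ℝ F] {T t : ℝ}
    {w : ℝ → F} {w' : F}
    (h : HasDerivWithinAt w w' (Icc 0 T) t) (ht : t ∈ Ioo 0 T) : HasDerivAt w w' t :=
  h.hasDerivAt (Icc_mem_nhds ht.1 ht.2)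

/-- `‖w(t)‖² - ‖w(0)‖² = 2∫₀ᵗ (w, w')`. -/
theorem norm_sq_sub_eq_integral {T : ℝ} {w w' : ℝ → V}
    (hw : ∀ t ∈ Icc 0 T, HasDerivWithinAt w (w' t) (Icc 0 T) t) (hw' : ContinuousOn w' (Icc 0 T))
    {t : ℝ} (ht : t ∈ Icc 0 T) :
    ‖w t‖ ^ 2 - ‖w 0‖ ^ 2 = ∫ s in (0 : ℝ)..t, 2 * inner ℝ (w s) (w' s) := by
  have hwc : ContinuousOn w (Icc 0 T) := fun s hs => (hw s hs).continuousWithinAt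
  have hsub : Icc 0 t ⊆ Icc 0 T := Icc_subset_Icc_right ht.2
  refine (intervalIntegral.integral_eq_sub_of_hasDerivAt_of_le ht.1 ((hwc.mono hsub).norm.pow 2)
    (fun s hs => ?_) ?_).symm
  · exact (hasDerivAt_of_within_Icc (hw s (hsub (Ioo_subset_Icc_self hs)))
      ⟨hs.1, hs.2.trans_le ht.2⟩).norm_sq
  · refine ContinuousOn.intervalIntegrable ?_
    rw [uIcc_of_le ht.1]
    exact continuousOn_const.mul ((hwc.mono hsub).inner (hw'.mono hsub))

/-- The energy estimate: `(w, w') + q ≤ β ‖w‖` with `q ≥ 0` controls `sup ‖w‖` and `∫ q`. -/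
theorem energy_estimate {T : ℝ} (hT : 0 ≤ T) {w w' : ℝ → V} {q β : ℝ → ℝ}
    (hw : ∀ t ∈ Icc 0 T, HasDerivWithinAt w (w' t) (Icc 0 T) t) (hw' : ContinuousOn w' (Icc 0 T))
    (hq : ContinuousOn q (Icc 0 T)) (hβ : ContinuousOn β (Icc 0 T))
    (hq0 : ∀ t ∈ Icc 0 T, 0 ≤ q t) (hβ0 : ∀ t ∈ Icc 0 T, 0 ≤ β t)
    (h : ∀ t ∈ Icc 0 T, inner ℝ (w t) (w' t) + q t ≤ β t * ‖w t‖) :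
    (∀ t ∈ Icc 0 T, ‖w t‖ ≤ ‖w 0‖ + 2 * ∫ s in (0 : ℝ)..T, β s) ∧
      2 * (∫ s in (0 : ℝ)..T, q s) ≤ (‖w 0‖ + 2 * ∫ s in (0 : ℝ)..T, β s) ^ 2 := by
  have hwc : ContinuousOn w (Icc 0 T) := fun s hs => (hw s hs).continuousWithinAt
  obtain ⟨tm, htm, hmax⟩ := isCompact_Icc.exists_isMaxOn (nonempty_Icc.2 hT) hwc.norm
  set M := ‖w tm‖ with hM
  have hM' : ∀ t ∈ Icc 0 T, ‖w t‖ ≤ M := fun t ht => hmax ht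
  set b := ∫ s in (0 : ℝ)..T, β s with hb
  have hii : ∀ {γ : ℝ → ℝ}, ContinuousOn γ (Icc 0 T) → ∀ t ∈ Icc 0 T,
      IntervalIntegrable γ volume 0 t := by
    intro γ hγ t ht
    refine ContinuousOn.intervalIntegrable ?_
    rw [uIcc_of_le ht.1]
    exact hγ.mono (Icc_subset_Icc_right ht.2)
  have hb0 : 0 ≤ b := intervalIntegral.integral_nonneg hT hβ0
  have hβt : ∀ t ∈ Icc 0 T, ∫ s in (0 : ℝ)..t, β s ≤ b := by
    intro t ht
    refine intervalIntegral.integral_mono_interval le_rfl ht.1 ht.2 ?_ (hii hβ T ⟨hT, le_rfl⟩)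
    filter_upwards [ae_restrict_mem measurableSet_Ioc] with s hs
    exact hβ0 s (Ioc_subset_Icc_self hs)
  have key : ∀ t ∈ Icc 0 T, ‖w t‖ ^ 2 + 2 * ∫ s in (0 : ℝ)..t, q s ≤ ‖w 0‖ ^ 2 + 2 * M * b := by
    intro t ht
    have h1 := norm_sq_sub_eq_integral hw hw' ht
    have h2 : ∫ s in (0 : ℝ)..t, 2 * inner ℝ (w s) (w' s) ≤ ∫ s in (0 : ℝ)..t,
        (2 * M * β s - 2 * q s) := by
      refine intervalIntegral.integral_mono_on ht.1
        (hii (continuousOn_const.mul (hwc.inner hw')) t ht)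
        (((hii hβ t ht).const_mul _).sub ((hii hq t ht).const_mul _)) fun s hs => ?_
      have hs' : s ∈ Icc 0 T := ⟨hs.1, hs.2.trans ht.2⟩
      have := h s hs'
      have := mul_le_mul_of_nonneg_left (hM' s hs') (hβ0 s hs')
      linarith
    have e1 : ∫ s in (0 : ℝ)..t, (2 * M * β s - 2 * q s) =
        2 * M * (∫ s in (0 : ℝ)..t, β s) - 2 * ∫ s in (0 : ℝ)..t, q s := by
      rw [intervalIntegral.integral_sub ((hii hβ t ht).const_mul _) ((hii hq t ht).const_mul _),
        intervalIntegral.integral_const_mul, intervalIntegral.integral_const_mul]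
    rw [e1] at h2
    have := mul_le_mul_of_nonneg_left (hβt t ht) (by positivity : 0 ≤ 2 * M)
    linarith
  have h0M : ‖w 0‖ ≤ M := hM' 0 ⟨le_rfl, hT⟩
  have hMB : M ≤ ‖w 0‖ + 2 * b := by
    have h1 := key tm htm
    have h2 : 0 ≤ ∫ s in (0 : ℝ)..tm, q s :=
      intervalIntegral.integral_nonneg htm.1 fun s hs => hq0 s ⟨hs.1, hs.2.trans htm.2⟩
    have h3 : M * M ≤ M * (‖w 0‖ + 2 * b) := by
      nlinarith [norm_nonneg (w 0)]
    rcases eq_or_lt_of_le ((norm_nonneg _).trans h0M) with h4 | h4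
    · rw [← h4]; positivity
    · exact le_of_mul_le_mul_left h3 h4
  refine ⟨fun t ht => (hM' t ht).trans hMB, ?_⟩
  have h1 := key T ⟨hT, le_rfl⟩
  nlinarith [norm_nonneg (w 0), sq_nonneg ‖w T‖, mul_le_mul_of_nonneg_right hMB hb0]

end Energy

/-! ### Flows of monotone operators -/

section MonotoneFlow
variable {V : Type*} [NormedAddCommGroup V] [InnerProductSpace ℝ V]

/-- The radial retraction onto the ball of radius `R`. -/
noncomputable def radialTrunc (R : ℝ) (x : V) : V := (R / max R ‖x‖) • x

theorem continuous_radialTrunc {R : ℝ} (hR : 0 < R) : Continuous (radialTrunc R : V → V) := by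
  unfold radialTrunc
  exact (continuous_const.div (continuous_const.max continuous_norm)
    fun x => (lt_max_of_lt_left hR).ne').smul continuous_id

theorem norm_radialTrunc_le {R : ℝ} (hR : 0 < R) (x : V) : ‖radialTrunc R x‖ ≤ R := by
  have h : 0 < max R ‖x‖ := lt_max_of_lt_left hR
  rw [radialTrunc, norm_smul, Real.norm_of_nonneg (by positivity), div_mul_eq_mul_div,
      div_le_iff₀ h]
  gcongr
  exact le_max_right _ _

theorem radialTrunc_of_norm_le {R : ℝ} (hR : 0 < R) {x : V}
    (hx : ‖x‖ ≤ R) : radialTrunc R x = x := by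
  rw [radialTrunc, max_eq_left hx, div_self hR.ne', one_smul]

/-- The truncated operator is no longer monotone, but it keeps the lower bound used in the energy
estimate, because the truncation of `x` is a positive multiple of `x`. -/
theorem neg_le_inner_radialTrunc {A : V → V} (hmono : ∀ u v, 0 ≤ inner ℝ (A u - A v) (u - v))
    {R : ℝ} (hR : 0 < R)
    (x : V) : -(‖A 0‖ * ‖x‖) ≤ inner ℝ (A (radialTrunc R x)) x := by
  have h : 0 < R / max R ‖x‖ := div_pos hR (lt_max_of_lt_left hR)
  have h1 := hmono (radialTrunc R x) 0
  rw [sub_zero] at h1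
  nth_rewrite 2 [radialTrunc] at h1
  rw [real_inner_smul_right] at h1
  have h2 := nonneg_of_mul_nonneg_right h1 h
  rw [inner_sub_left] at h2
  have h3 := abs_real_inner_le_norm (A 0) x
  linarith [neg_abs_le (inner ℝ (A 0) x)]

/-- The initial value problem `u' + A(u) = f` for a continuous monotone operator has a solution on
`[0,T]`: Peano's theorem applies to the operator truncated outside a large ball, and the energy
estimate, which survives the truncation, keeps the solution inside that ball. -/
theorem exists_monotone_flow [FiniteDimensional ℝ V] {A : V → V} (hA : Continuous A)
    (hmono : ∀ u v, 0 ≤ inner ℝ (A u - A v) (u - v)) {T : ℝ} (hT : 0 < T) {f : ℝ → V}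
    (hf : ContinuousOn f (Icc 0 T)) (u₀ : V) :
    ∃ u : ℝ → V, u 0 = u₀ ∧ ∀ t ∈ Icc 0 T, HasDerivWithinAt u (f t - A (u t)) (Icc 0 T) t := by
  have : CompleteSpace V := FiniteDimensional.complete ℝ V
  have : ProperSpace V := FiniteDimensional.proper ℝ V
  set fe : ℝ → V := IccExtend hT.le ((Icc 0 T).domRestrict f) with hfe
  have hfec : Continuous fe := hf.domRestrict.Icc_extend'
  have hfet : ∀ t ∈ Icc 0 T, fe t = f t := fun t ht => IccExtend_of_mem _ _ ht
  obtain ⟨F, hF⟩ := isCompact_Icc.exists_bound_of_continuousOn hf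
  have hFe : ∀ t, ‖fe t‖ ≤ F := fun t => hF _ (projIcc 0 T hT.le t).2
  have hF0 : 0 ≤ F := (norm_nonneg _).trans (hFe 0)
  set R : ℝ := ‖u₀‖ + 2 * (T * (F + ‖A 0‖)) + 1 with hR
  have hR0 : 0 < R := by positivity
  obtain ⟨C, hC⟩ := (isCompact_closedBall (0 : V) R).exists_bound_of_continuousOn hA.continuousOn
  have hCx : ∀ x, ‖A (radialTrunc R x)‖ ≤ C := fun x =>
    hC _ (by simpa using norm_radialTrunc_le hR0 x)
  have hgc : Continuous (Function.uncurry fun t x => fe t - A (radialTrunc R x)) :=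
    (hfec.comp continuous_fst).sub (hA.comp ((continuous_radialTrunc hR0).comp continuous_snd))
  obtain ⟨u, huc, hu⟩ := exists_integral_solution hgc (M := F + C)
    (fun t x => (norm_sub_le _ _).trans (add_le_add (hFe t) (hCx x))) u₀ hT
  have hint : Continuous fun s => fe s - A (radialTrunc R (u s)) :=
    hgc.comp (continuous_id.prodMk huc)
  have hd : ∀ t ∈ Icc 0 T, HasDerivWithinAt u (fe t - A (radialTrunc R (u t))) (Icc 0 T) t := by
    intro t ht
    have h1 : HasDerivAt (fun t => u₀ + ∫ s in (0 : ℝ)..t, (fe s - A (radialTrunc R (u s))))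
        (fe t - A (radialTrunc R (u t))) t :=
      (hint.integral_hasStrictDerivAt 0 t).hasDerivAt.const_add u₀
    exact h1.hasDerivWithinAt.congr hu (hu t ht)
  have hu0 : u 0 = u₀ := by simpa using hu 0 ⟨le_rfl, hT.le⟩
  have hbound := (energy_estimate hT.le hd hint.continuousOn (q := fun _ => 0)
    (β := fun _ => F + ‖A 0‖)
    continuousOn_const continuousOn_const (fun _ _ => le_rfl) (fun _ _ => by positivity)
        (fun t _ => by
      rw [add_zero, inner_sub_right, real_inner_comm]
      have h1 := neg_le_inner_radialTrunc hmono hR0 (u t)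
      rw [real_inner_comm] at h1
      have h2 := real_inner_le_norm (fe t) (u t)
      have h3 := mul_le_mul_of_nonneg_right (hFe t) (norm_nonneg (u t))
      linarith)).1
  refine ⟨u, hu0, fun t ht => ?_⟩
  have h1 := hbound t ht
  rw [hu0, intervalIntegral.integral_const, sub_zero, smul_eq_mul] at h1
  have h2 := hd t ht
  rwa [radialTrunc_of_norm_le hR0 (by linarith), hfet t ht] at h2

theorem monotone_flow_unique {A : V → V} (hA : Continuous A)
    (hmono : ∀ u v, 0 ≤ inner ℝ (A u - A v) (u - v)) {T : ℝ} (hT : 0 ≤ T) {f : ℝ → V}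
    (hf : ContinuousOn f (Icc 0 T)) {u v : ℝ → V}
    (hu : ∀ t ∈ Icc 0 T, HasDerivWithinAt u (f t - A (u t)) (Icc 0 T) t)
    (hv : ∀ t ∈ Icc 0 T, HasDerivWithinAt v (f t - A (v t)) (Icc 0 T) t) (h0 : u 0 = v 0) :
    EqOn u v (Icc 0 T) := by
  have huc : ContinuousOn u (Icc 0 T) := fun s hs => (hu s hs).continuousWithinAt
  have hvc : ContinuousOn v (Icc 0 T) := fun s hs => (hv s hs).continuousWithinAt
  have h := (energy_estimate hT (fun t ht => (hu t ht).sub (hv t ht))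
    ((hf.sub (hA.comp_continuousOn huc)).sub (hf.sub (hA.comp_continuousOn hvc))) (q := fun _ => 0)
    (β := fun _ => 0)
    continuousOn_const continuousOn_const (fun _ _ => le_rfl) (fun _ _ => le_rfl) (fun t _ => by
      have := hmono (u t) (v t)
      rw [real_inner_comm] at this
      have e : f t - A (u t) - (f t - A (v t)) = -(A (u t) - A (v t)) := by abel
      simp only [Pi.sub_apply]
      rw [e, inner_neg_right]
      linarith)).1
  intro t ht
  have := h t ht
  simp only [Pi.sub_apply, h0, sub_self, norm_zero, intervalIntegral.integral_zero, mul_zero,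
    add_zero] at this
  exact sub_eq_zero.1 (norm_le_zero_iff.1 this)

end MonotoneFlow

/-! ### Weak time derivatives -/

section WeakTimeDerivative
open Real (smoothTransition)

theorem support_deriv_smoothTransition : Function.support (deriv smoothTransition) ⊆ Icc 0 1 := by
  intro x hx
  by_contra h
  rw [mem_Icc, not_and_or, not_le, not_le] at h
  refine hx ?_
  rcases h with h | h
  · have : smoothTransition =ᶠ[𝓝 x] fun _ => 0 := by
      filter_upwards [gt_mem_nhds h] with y hy
      exact Real.smoothTransition.zero_of_nonpos hy.le
    rw [this.deriv_eq, deriv_const]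
  · have : smoothTransition =ᶠ[𝓝 x] fun _ => 1 := by
      filter_upwards [lt_mem_nhds h] with y hy
      exact Real.smoothTransition.one_of_one_le hy.le
    rw [this.deriv_eq, deriv_const]

theorem contDiff_smoothTransition {n : ℕ∞} : ContDiff ℝ n smoothTransition :=
  Real.smoothTransition.contDiff

theorem hasDerivAt_smoothTransition (x : ℝ) : HasDerivAt smoothTransition
    (deriv smoothTransition x) x :=
  ((contDiff_smoothTransition (n := 1)).differentiable (by simp) x).hasDerivAt

theorem continuous_deriv_smoothTransition : Continuous (deriv smoothTransition) :=
  (contDiff_smoothTransition (n := 1)).continuous_deriv (by simp)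

theorem hasCompactSupport_deriv_smoothTransition : HasCompactSupport (deriv smoothTransition) :=
  HasCompactSupport.of_support_subset_isCompact isCompact_Icc support_deriv_smoothTransition

theorem integral_deriv_smoothTransition : ∫ x, deriv smoothTransition x = 1 := by
  have h := integral_of_hasDerivAt_of_tendsto (f := smoothTransition) hasDerivAt_smoothTransition
    (continuous_deriv_smoothTransition.integrable_of_hasCompactSupport
      hasCompactSupport_deriv_smoothTransition)
    (m := 0) (n := 1) ?_ ?_
  · simpa using h
  · refine tendsto_const_nhds.congr' ?_
    filter_upwards [eventually_le_atBot 0] with x hx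
    exact (Real.smoothTransition.zero_of_nonpos hx).symm
  · refine tendsto_const_nhds.congr' ?_
    filter_upwards [eventually_ge_atTop 1] with x hx
    exact (Real.smoothTransition.one_of_one_le hx).symm

variable {X : Type} [NormedAddCommGroup X] [NormedSpace ℝ X] [CompleteSpace X]

theorem tendsto_integral_deriv_smoothTransition {g : ℝ → X} (hg : Continuous g) {C : ℝ}
    (hC : ∀ x, ‖g x‖ ≤ C)
    (s : ℝ) {ε : ℕ → ℝ} (hε : ∀ n, 0 < ε n) (hε0 : Tendsto ε atTop (𝓝 0)) :
    Tendsto (fun n => ∫ x, ((ε n)⁻¹ * deriv smoothTransition ((x - s) / ε n)) • g x) atTop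
        (𝓝 (g s)) := by
  have hint := continuous_deriv_smoothTransition.integrable_of_hasCompactSupport (μ := volume)
    hasCompactSupport_deriv_smoothTransition
  have e : ∀ n, ∫ x, ((ε n)⁻¹ * deriv smoothTransition ((x - s) / ε n)) • g x =
      ∫ y, deriv smoothTransition y • g (ε n * y + s) := by
    intro n
    have h1 := integral_sub_right_eq_self (μ := volume)
      (fun x => ((ε n)⁻¹ * deriv smoothTransition (x / ε n)) • g (x + s)) s
    simp only [sub_add_cancel] at h1
    rw [h1]
    have h2 := Measure.integral_comp_div
      (fun y => ((ε n)⁻¹ * deriv smoothTransition y) • g (ε n * y + s)) (ε n)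
    have h3 : ∀ x, ε n * (x / ε n) = x := fun x => mul_div_cancel₀ x (hε n).ne'
    simp only [h3] at h2
    rw [h2, ← integral_smul]
    congr 1 with y
    rw [smul_smul, ← mul_assoc, abs_of_pos (hε n), mul_inv_cancel₀ (hε n).ne', one_mul]
  simp only [e]
  have hlim : Tendsto (fun n => ∫ y, deriv smoothTransition y • g (ε n * y + s)) atTop
      (𝓝 (∫ y, deriv smoothTransition y • g s)) := by
    refine tendsto_integral_of_dominated_convergence
      (fun y => ‖deriv smoothTransition y‖ * C) ?_ ?_ ?_ ?_
    · exact fun n => (continuous_deriv_smoothTransition.smul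
        (hg.comp (by fun_prop))).aestronglyMeasurable
    · exact hint.norm.mul_const C
    · exact fun n => ae_of_all _ fun y => by rw [norm_smul]; gcongr; exact hC _
    · refine ae_of_all _ fun y => Tendsto.const_smul ?_ _
      have : Tendsto (fun n => ε n * y + s) atTop (𝓝 (0 * y + s)) := (hε0.mul_const y).add_const s
      rw [zero_mul, zero_add] at this
      exact (hg.tendsto s).comp this
  rwa [integral_smul_const, integral_deriv_smoothTransition, one_smul] at hlim

theorem tendsto_smoothTransition_div {ε : ℕ → ℝ} (hε : ∀ n, 0 < ε n)
    (hε0 : Tendsto ε atTop (𝓝 0)) (y : ℝ) :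
    Tendsto (fun n => smoothTransition (y / ε n)) atTop (𝓝 (if 0 < y then 1 else 0)) := by
  split_ifs with h
  · refine tendsto_const_nhds.congr' ?_
    filter_upwards [hε0.eventually (gt_mem_nhds h)] with n hn
    exact (Real.smoothTransition.one_of_one_le ((one_le_div (hε n)).2 hn.le)).symm
  · refine tendsto_const_nhds.congr fun n => ?_
    exact (Real.smoothTransition.zero_of_nonpos
      (div_nonpos_of_nonpos_of_nonneg (not_lt.1 h) (hε n).le)).symm

/-- For the continuous representative of a function in `W^{1,2}(I; X)`,
`‖f(t) - f(s)‖ ≤ ∫ₛᵗ ‖f'‖`: test with a smooth approximation of the indicator of `(s, t]`. -/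
theorem MemW12Time.norm_sub_le {T : ℝ} {f f' : ℝ → X} (hf : MemW12Time T f f')
    (hfc : ContinuousOn f (Icc 0 T))
    {s t : ℝ} (hs : 0 < s) (hst : s ≤ t) (ht : t < T) :
    ‖f t - f s‖ ≤ ∫ r in s..t, ‖f' r‖ := by
  have hT : 0 < T := by linarith
  set fe : ℝ → X := IccExtend hT.le ((Icc 0 T).domRestrict f) with hfe
  have hfec : Continuous fe := hfc.domRestrict.Icc_extend'
  have hfet : ∀ r ∈ Icc 0 T, fe r = f r := fun r hr => IccExtend_of_mem _ _ hr
  obtain ⟨C, hC⟩ := isCompact_Icc.exists_bound_of_continuousOn hfc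
  have hCe : ∀ r, ‖fe r‖ ≤ C := fun r => hC _ (projIcc 0 T hT.le r).2
  have hf'1 : IntegrableOn f' (Ioo 0 T) := by
    have : IsFiniteMeasure (volTime T) := ⟨by simp [volTime]⟩
    exact hf.2.1.integrable (by norm_num)
  set ε : ℕ → ℝ := fun n => (T - t) / 2 / ((n : ℝ) + 1) with hε
  have hε0 : ∀ n, 0 < ε n := fun n => by
    have : 0 < T - t := by linarith
    simp only [hε]; positivity
  have hεle : ∀ n, t + ε n < T := by
    intro n
    have : ε n ≤ (T - t) / 2 :=
      div_le_self (by linarith) (by linarith [(Nat.cast_nonneg n : (0 : ℝ) ≤ n)])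
    linarith
  have hεlim : Tendsto ε atTop (𝓝 0) := by
    have := tendsto_one_div_add_atTop_nhds_zero_nat (𝕜 := ℝ).const_mul ((T - t) / 2)
    simpa [hε, div_eq_mul_inv] using this
  set η : ℕ → ℝ → ℝ := fun n x => smoothTransition ((x - s) / ε n) - smoothTransition
    ((x - t) / ε n) with hη
  have hηsm : ∀ n, ContDiff ℝ ∞ (η n) := fun n =>
    (contDiff_smoothTransition.comp (by fun_prop)).sub
    (contDiff_smoothTransition.comp (by fun_prop))
  have hsup : ∀ n, Function.support (η n) ⊆ Icc s (t + ε n) := by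
    intro n x hx
    by_contra h
    refine hx ?_
    rw [mem_Icc, not_and_or, not_le, not_le] at h
    rcases h with h | h
    · simp only [hη]
      rw [Real.smoothTransition.zero_of_nonpos
          (div_nonpos_of_nonpos_of_nonneg (by linarith) (hε0 n).le),
        Real.smoothTransition.zero_of_nonpos
          (div_nonpos_of_nonpos_of_nonneg (by linarith) (hε0 n).le), sub_zero]
    · simp only [hη]
      rw [Real.smoothTransition.one_of_one_le ((one_le_div (hε0 n)).2 (by linarith)),
        Real.smoothTransition.one_of_one_le ((one_le_div (hε0 n)).2 (by linarith)), sub_self]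
  have htsup : ∀ n, tsupport (η n) ⊆ Icc s (t + ε n) := fun n =>
    closure_minimal (hsup n) isClosed_Icc
  have hIcc : ∀ n, Icc s (t + ε n) ⊆ Ioo 0 T := fun n x hx =>
    ⟨hs.trans_le hx.1, hx.2.trans_lt (hεle n)⟩
  have hder : ∀ n x, HasDerivAt (η n) ((ε n)⁻¹ * deriv smoothTransition ((x - s) / ε n) -
      (ε n)⁻¹ * deriv smoothTransition ((x - t) / ε n)) x := by
    intro n x
    have h1 : ∀ r, HasDerivAt (fun x => smoothTransition ((x - r) / ε n))
        ((ε n)⁻¹ * deriv smoothTransition ((x - r) / ε n)) x := by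
      intro r
      have h2 : HasDerivAt (fun x => (x - r) / ε n) ((ε n)⁻¹) x := by
        simpa [one_div] using ((hasDerivAt_id x).sub_const r).div_const (ε n)
      rw [mul_comm]
      exact (hasDerivAt_smoothTransition _).comp x h2
    exact (h1 s).sub (h1 t)
  have hweak := fun n => hf.2.2 (η n) (hηsm n)
    (HasCompactSupport.of_support_subset_isCompact isCompact_Icc (hsup n))
    ((htsup n).trans (hIcc n))
  have hA : Tendsto (fun n => ∫ r in Ioo 0 T, deriv (η n) r • f r) atTop (𝓝 (fe s - fe t)) := by
    refine ((tendsto_integral_deriv_smoothTransition hfec hCe s hε0 hεlim).sub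
      (tendsto_integral_deriv_smoothTransition hfec hCe t hε0 hεlim)).congr fun n => ?_
    have hi : ∀ r, Integrable fun x =>
        ((ε n)⁻¹ * deriv smoothTransition ((x - r) / ε n)) • fe x := by
      intro r
      refine Continuous.integrable_of_hasCompactSupport ?_ ?_
      · exact ((continuous_const.mul
          (continuous_deriv_smoothTransition.comp (by fun_prop))).smul hfec)
      · refine HasCompactSupport.of_support_subset_isCompact (isCompact_Icc (a := r) (b := r + ε n))
          fun x hx => ?_
        have h1 : deriv smoothTransition ((x - r) / ε n) ≠ 0 := fun h => hx (by simp [h])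
        have h2 := support_deriv_smoothTransition h1
        have h3 := (div_le_iff₀ (hε0 n)).1 h2.2
        have h4 := (le_div_iff₀ (hε0 n)).1 h2.1
        exact ⟨by linarith, by linarith⟩
    rw [← integral_sub (hi s) (hi t)]
    have h0 : ∀ x, x ∉ Ioo 0 T → deriv (η n) x • fe x = 0 := by
      intro x hx
      have : x ∉ tsupport (η n) := fun h => hx (hIcc n (htsup n h))
      rw [show deriv (η n) x = 0 from by
        have h := notMem_tsupport_iff_eventuallyEq.1 this
        rw [h.deriv_eq]; simp, zero_smul]
    calc _ = ∫ x, deriv (η n) x • fe x := by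
          congr 1 with x
          rw [(hder n x).deriv, sub_smul]
      _ = ∫ x in Ioo 0 T, deriv (η n) x • fe x :=
          (setIntegral_eq_integral_of_forall_compl_eq_zero h0).symm
      _ = _ := setIntegral_congr_fun measurableSet_Ioo fun x hx => by
          simp only [hfet x (Ioo_subset_Icc_self hx)]
  have hB : Tendsto (fun n => ∫ r in Ioo 0 T, η n r • f' r) atTop
      (𝓝 (∫ r in Ioo 0 T, (Ioc s t).indicator f' r)) := by
    refine tendsto_integral_of_dominated_convergence (fun r => ‖f' r‖) ?_ hf'1.norm ?_ ?_
    · exact fun n => (hηsm n).continuous.aestronglyMeasurable.smul hf'1.1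
    · refine fun n => ae_of_all _ fun r => ?_
      rw [norm_smul]
      refine mul_le_of_le_one_left (norm_nonneg _) ?_
      rw [Real.norm_eq_abs, abs_le]
      have a1 := Real.smoothTransition.nonneg ((r - s) / ε n)
      have a2 := Real.smoothTransition.le_one ((r - s) / ε n)
      have a3 := Real.smoothTransition.nonneg ((r - t) / ε n)
      have a4 := Real.smoothTransition.le_one ((r - t) / ε n)
      simp only [hη]
      constructor <;> linarith
    · refine ae_of_all _ fun r => ?_
      have h1 := ((tendsto_smoothTransition_div hε0 hεlim (r - s)).sub
        (tendsto_smoothTransition_div hε0 hεlim (r - t))).smul_const (f' r)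
      convert! h1 using 2
      by_cases h2 : r ∈ Ioc s t
      · rw [indicator_of_mem h2, if_pos (by linarith [h2.1]), if_neg (by linarith [h2.2]),
          sub_zero, one_smul]
      · rw [indicator_of_notMem h2]
        rw [mem_Ioc, not_and_or, not_lt, not_le] at h2
        rcases h2 with h2 | h2
        · rw [if_neg (by linarith), if_neg (by linarith), sub_zero, zero_smul]
        · rw [if_pos (by linarith), if_pos (by linarith), sub_self, zero_smul]
  have hlim := tendsto_nhds_unique hA (hB.neg.congr fun n => (hweak n).symm)
  have hI : ∫ r in Ioo 0 T, (Ioc s t).indicator f' r = ∫ r in s..t, f' r := by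
    have hsub : Ioc s t ⊆ Ioo 0 T := fun x hx => ⟨hs.trans hx.1, hx.2.trans_lt ht⟩
    rw [setIntegral_indicator measurableSet_Ioc, inter_eq_self_of_subset_right hsub,
      intervalIntegral.integral_of_le hst]
  rw [hI, hfet s ⟨hs.le, by linarith⟩, hfet t ⟨by linarith, ht.le⟩] at hlim
  have : f t - f s = ∫ r in s..t, f' r := by
    rw [← neg_sub, hlim, neg_neg]
  rw [this]
  exact intervalIntegral.norm_integral_le_integral_norm hst

end WeakTimeDerivative

/-! ### Difference quotients in time -/

section DifferenceQuotients

/-- A bounded sequence in a Hilbert space converges weakly along an ultrafilter. -/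
theorem exists_weak_limit {H : Type*} [NormedAddCommGroup H] [InnerProductSpace ℝ H]
    [CompleteSpace H]
    {g : ℕ → H} {C : ℝ} (hC : ∀ n, ‖g n‖ ≤ C) :
    ∃ z : H, ‖z‖ ≤ C ∧ ∀ y, Tendsto (fun n => inner ℝ (g n) y) (hyperfilter ℕ : Filter ℕ)
        (𝓝 (inner ℝ z y)) := by
  set ℓ : ℕ → WeakDual ℝ H := fun n =>
    StrongDual.toWeakDual (InnerProductSpace.toDual ℝ H (g n)) with hℓ
  have hK := WeakDual.isCompact_closedBall (𝕜 := ℝ) (E := H) 0 C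
  obtain ⟨z', hz', hlim⟩ := hK.ultrafilter_le_nhds ((hyperfilter ℕ).map ℓ) (by
    rw [Ultrafilter.coe_map, le_principal_iff, mem_map]
    refine univ_mem' fun n => ?_
    simpa [hℓ] using hC n)
  set z := (InnerProductSpace.toDual ℝ H).symm (WeakDual.toStrongDual z') with hz
  refine ⟨z, ?_, fun y => ?_⟩
  · rw [hz, LinearIsometryEquiv.norm_map]
    simpa using hz'
  · have h1 : Tendsto (fun n => ℓ n y) (hyperfilter ℕ : Filter ℕ) (𝓝 (z' y)) :=
      ((WeakDual.eval_continuous y).tendsto z').comp hlim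
    have h2 : inner ℝ z y = z' y := by
      rw [hz, InnerProductSpace.toDual_symm_apply]; rfl
    rw [h2]
    exact h1

/-- The difference quotients of a test function converge, weakly against bounded functions. -/
theorem tendsto_integral_diffQuot {η φ : ℝ → ℝ} (hη : ContDiff ℝ ∞ η) (hc : HasCompactSupport η)
    (hφ : Continuous φ) {C : ℝ} (hC : ∀ x, |φ x| ≤ C) {h : ℕ → ℝ} (hh : ∀ n, 0 < h n)
    (hh0 : Tendsto h atTop (𝓝 0)) :
    Tendsto (fun n => ∫ s, η s * ((h n)⁻¹ * (φ (s + h n) - φ s))) atTop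
        (𝓝 (-∫ s, deriv η s * φ s)) := by
  have hηc := hη.continuous
  obtain ⟨M, hM⟩ := (hη.continuous_deriv (by simp)).bounded_above_of_compact_support hc.deriv
  have hM0 : 0 ≤ M := (norm_nonneg _).trans (hM 0)
  obtain ⟨R, hR⟩ := hc.isBounded.subset_closedBall 0
  have hmul : ∀ {ψ : ℝ → ℝ}, Continuous ψ → Integrable fun s => η s * ψ s := fun hψ =>
    (hηc.mul hψ).integrable_of_hasCompactSupport hc.mul_right
  have e : ∀ n, ∫ s, η s * ((h n)⁻¹ * (φ (s + h n) - φ s)) = ∫ s,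
      (h n)⁻¹ * (η (s - h n) - η s) * φ s := by
    intro n
    have h1 := integral_sub_right_eq_self (μ := volume) (fun s => η s * φ (s + h n)) (h n)
    simp only [sub_add_cancel] at h1
    have h2 : Integrable fun s => η (s - h n) * φ s := by
      have := (hmul (hφ.comp (continuous_add_const (h n)))).comp_sub_right (h n)
      simpa using this
    have h3 : Integrable fun s => η s * φ (s + h n) := hmul (hφ.comp (continuous_add_const (h n)))
    calc ∫ s, η s * ((h n)⁻¹ * (φ (s + h n) - φ s))
        = ∫ s, ((h n)⁻¹ * (η s * φ (s + h n)) - (h n)⁻¹ * (η s * φ s)) := by congr 1 with s; ring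
      _ = (h n)⁻¹ * (∫ s, η s * φ (s + h n)) - (h n)⁻¹ * ∫ s, η s * φ s := by
          rw [integral_sub (h3.const_mul _) ((hmul hφ).const_mul _),
            integral_const_mul, integral_const_mul]
      _ = (h n)⁻¹ * (∫ s, η (s - h n) * φ s) - (h n)⁻¹ * ∫ s, η s * φ s := by rw [h1]
      _ = ∫ s, ((h n)⁻¹ * (η (s - h n) * φ s) - (h n)⁻¹ * (η s * φ s)) := by
          rw [integral_sub (h2.const_mul _) ((hmul hφ).const_mul _), integral_const_mul,
              integral_const_mul]
      _ = _ := by congr 1 with s; ring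
  simp only [e]
  rw [← integral_neg]
  obtain ⟨B, hB⟩ : ∃ B, ∀ n, h n ≤ B := by
    obtain ⟨B, hB⟩ := hh0.bddAbove_range
    exact ⟨B, fun n => hB (mem_range_self n)⟩
  have hB0 : 0 ≤ B := (hh 0).le.trans (hB 0)
  refine tendsto_integral_of_dominated_convergence
    ((Metric.closedBall (0 : ℝ) (R + B)).indicator fun _ => M * C) ?_ ?_ ?_ ?_
  · exact fun n => (by fun_prop : Continuous fun s =>
        (h n)⁻¹ * (η (s - h n) - η s) * φ s).aestronglyMeasurable
  · exact (integrable_indicator_iff measurableSet_closedBall).2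
      (integrableOn_const Metric.isBounded_closedBall.measure_lt_top.ne)
  · refine fun n => ae_of_all _ fun s => ?_
    by_cases hs : s ∈ Metric.closedBall (0 : ℝ) (R + B)
    · rw [indicator_of_mem hs, norm_mul]
      refine mul_le_mul ?_ (hC s) (norm_nonneg _) hM0
      have h1 := Convex.norm_image_sub_le_of_norm_deriv_le (f := η) (s := univ) (C := M)
        (fun x _ => hη.differentiable (by simp) x) (fun x _ => hM x) convex_univ (mem_univ s)
          (mem_univ (s - h n))
      rw [norm_mul, norm_inv, Real.norm_of_nonneg (hh n).le, inv_mul_le_iff₀ (hh n)]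
      refine h1.trans_eq ?_
      rw [sub_sub_cancel_left, norm_neg, Real.norm_of_nonneg (hh n).le, mul_comm]
    · rw [indicator_of_notMem hs]
      have hz : ∀ x, x ∉ Metric.closedBall (0 : ℝ) R → η x = 0 := fun x hx =>
        image_eq_zero_of_notMem_tsupport fun h => hx (hR h)
      simp only [mem_closedBall_zero_iff, Real.norm_eq_abs, not_le] at hs hz
      have h1 : R < |s - h n| := by
        have := abs_sub_abs_le_abs_sub s (h n)
        rw [abs_of_pos (hh n)] at this
        linarith [hB n]
      rw [hz s (by linarith), hz _ h1]
      simp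
  · refine ae_of_all _ fun s => ?_
    have hd : HasDerivAt η (deriv η s) s := (hη.differentiable (by simp) s).hasDerivAt
    have h1 : Tendsto (fun n => -h n) atTop (𝓝[≠] 0) := by
      rw [tendsto_nhdsWithin_iff]
      exact ⟨by simpa using hh0.neg, Eventually.of_forall fun n => by simp [(hh n).ne']⟩
    have h2 := (hd.tendsto_slope_zero.comp h1).neg.mul_const (φ s)
    rw [neg_mul] at h2
    refine h2.congr fun n => ?_
    simp only [Function.comp_apply, smul_eq_mul, inv_neg, ← sub_eq_add_neg]
    ring

variable {X : Type} [NormedAddCommGroup X] [InnerProductSpace ℝ X] [CompleteSpace X]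

/-- A function whose difference quotients are bounded in `L²` has a weak derivative in `L²`. -/
theorem exists_memW12Time_of_diffQuot {T : ℝ} (hT : 0 < T) {Φ : ℝ → X}
    (hΦ : ContinuousOn Φ (Icc 0 T)) {C : ℝ}
    (hC0 : 0 ≤ C) (hC : ∀ h ∈ Ioo 0 T, ∫ s in (0 : ℝ)..(T - h), ‖Φ (s + h) - Φ s‖ ^ 2 ≤
      (C * h) ^ 2) :
    ∃ Φ' : ℝ → X, MemW12Time T Φ Φ' ∧ eLpNorm Φ' 2 (volTime T) ≤ ENNReal.ofReal C := by
  have : IsFiniteMeasure (volTime T) := ⟨by simp [volTime]⟩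
  set Φe : ℝ → X := IccExtend hT.le ((Icc 0 T).domRestrict Φ) with hΦe
  have hΦec : Continuous Φe := hΦ.domRestrict.Icc_extend'
  have hΦet : ∀ r ∈ Icc 0 T, Φe r = Φ r := fun r hr => IccExtend_of_mem _ _ hr
  obtain ⟨B, hB⟩ := isCompact_Icc.exists_bound_of_continuousOn hΦ
  have hBe : ∀ r, ‖Φe r‖ ≤ B := fun r => hB _ (projIcc 0 T hT.le r).2
  set h : ℕ → ℝ := fun n => T / 2 / ((n : ℝ) + 1) with hh
  have hh0 : ∀ n, 0 < h n := fun n => by simp only [hh]; positivity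
  have hhT : ∀ n, h n < T := by
    intro n
    have : h n ≤ T / 2 := div_le_self (by linarith)
      (by linarith [(Nat.cast_nonneg n : (0 : ℝ) ≤ n)])
    linarith
  have hhlim : Tendsto h atTop (𝓝 0) := by
    have := tendsto_one_div_add_atTop_nhds_zero_nat (𝕜 := ℝ).const_mul (T / 2)
    simpa [hh, div_eq_mul_inv] using this
  set G : ℕ → ℝ → X := fun n => (Ioo 0 (T - h n)).indicator fun s =>
    (h n)⁻¹ • (Φe (s + h n) - Φe s) with hG
  have hGc : ∀ n, Continuous fun s => (h n)⁻¹ • (Φe (s + h n) - Φe s) := fun n => by fun_prop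
  have hGm : ∀ n, MemLp (G n) 2 (volTime T) := by
    intro n
    refine MemLp.indicator measurableSet_Ioo (MemLp.of_bound (hGc n).aestronglyMeasurable
      ((h n)⁻¹ * (B + B)) (ae_of_all _ fun s => ?_))
    rw [norm_smul, norm_inv, Real.norm_of_nonneg (hh0 n).le]
    have := hh0 n
    gcongr
    exact (norm_sub_le _ _).trans (add_le_add (hBe _) (hBe _))
  have hGn : ∀ n, eLpNorm (G n) 2 (volTime T) ≤ ENNReal.ofReal C := by
    intro n
    rw [eLpNorm_two_eq_ofReal_sqrt (hGm n)]
    refine ENNReal.ofReal_le_ofReal ?_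
    rw [Real.sqrt_le_left hC0]
    have e1 : ∀ s, ‖G n s‖ ^ 2 = (Ioo 0 (T - h n)).indicator
        (fun s => ((h n)⁻¹) ^ 2 * ‖Φe (s + h n) - Φe s‖ ^ 2) s := by
      intro s
      by_cases hs : s ∈ Ioo 0 (T - h n)
      · simp only [hG, indicator_of_mem hs]
        rw [norm_smul, mul_pow, norm_inv, Real.norm_of_nonneg (hh0 n).le]
      · simp only [hG, indicator_of_notMem hs]; simp
    have hsub : Ioo 0 (T - h n) ⊆ Ioo 0 T := Ioo_subset_Ioo_right (by linarith [hh0 n])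
    simp only [e1]
    rw [setIntegral_indicator measurableSet_Ioo, inter_eq_self_of_subset_right hsub,
        integral_const_mul,
      ← integral_Ioc_eq_integral_Ioo, ← intervalIntegral.integral_of_le (by linarith [hhT n])]
    have e2 : ∫ s in (0 : ℝ)..(T - h n), ‖Φe (s + h n) - Φe s‖ ^ 2 =
        ∫ s in (0 : ℝ)..(T - h n), ‖Φ (s + h n) - Φ s‖ ^ 2 := by
      refine intervalIntegral.integral_congr fun s hs => ?_
      rw [uIcc_of_le (by linarith [hhT n])] at hs
      rw [hΦet _ ⟨by linarith [hs.1, hh0 n], by linarith [hs.2]⟩,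
          hΦet _ ⟨hs.1, by linarith [hs.2, hh0 n]⟩]
    rw [e2, inv_pow, inv_mul_le_iff₀ (by have := hh0 n; positivity)]
    refine (hC (h n) ⟨hh0 n, hhT n⟩).trans_eq (by ring)
  obtain ⟨z, hz, hzlim⟩ := exists_weak_limit (g := fun n => (hGm n).toLp (G n))
      (C := C) (fun n => by
    rw [Lp.norm_toLp]
    exact ENNReal.toReal_le_of_le_ofReal hC0 (hGn n))
  have hz1 : Integrable z (volTime T) := (Lp.memLp z).integrable (by norm_num)
  refine ⟨z, ⟨?_, Lp.memLp z, fun η hη hc hs => ?_⟩, ?_⟩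
  · have h1 : MemLp Φe 2 (volTime T) := MemLp.of_bound hΦec.aestronglyMeasurable B (ae_of_all _ hBe)
    refine (memLp_congr_ae ?_).1 h1
    filter_upwards [ae_restrict_mem measurableSet_Ioo] with t ht
    exact hΦet t (Ioo_subset_Icc_self ht)
  · have hηb : ∃ M, ∀ s, ‖η s‖ ≤ M := hη.continuous.bounded_above_of_compact_support hc
    obtain ⟨M, hM⟩ := hηb
    have hdi : Integrable (fun t => deriv η t • Φe t) (volTime T) :=
      (((hη.continuous_deriv (by simp)).smul hΦec).integrable_of_hasCompactSupport
        hc.deriv.smul_right).restrict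
    have hηz : Integrable (fun t => η t • z t) (volTime T) :=
      hz1.bdd_smul M hη.continuous.aestronglyMeasurable (ae_of_all _ hM)
    have hcongr : ∫ t in Ioo 0 T, deriv η t • Φ t = ∫ t in Ioo 0 T, deriv η t • Φe t :=
      setIntegral_congr_fun measurableSet_Ioo fun t ht => by
        simp only [hΦet t (Ioo_subset_Icc_self ht)]
    rw [hcongr]
    refine ext_inner_right ℝ fun x => ?_
    rw [inner_neg_left, real_inner_comm, real_inner_comm x, ← integral_inner hdi,
        ← integral_inner hηz]
    have hym : MemLp (fun t => η t • x) 2 (volTime T) :=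
      MemLp.of_bound (hη.continuous.smul continuous_const).aestronglyMeasurable (M * ‖x‖)
        (ae_of_all _ fun t => by rw [norm_smul]; gcongr; exact hM t)
    have hlim1 := hzlim (hym.toLp _)
    have hlim2 := (tendsto_integral_diffQuot hη hc (φ := fun s => inner ℝ x (Φe s)) (by fun_prop)
      (C := ‖x‖ * B) (fun s => (abs_real_inner_le_norm _ _).trans (by gcongr; exact hBe s)) hh0
        hhlim).mono_left
      (Nat.hyperfilter_le_atTop)
    -- the support of `η` lies in `(0, T - h)` for small `h`
    have hev : ∀ᶠ n in atTop, Function.support η ⊆ Ioo 0 (T - h n) := by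
      rcases (tsupport η).eq_empty_or_nonempty with he | hne
      · refine Eventually.of_forall fun n => ?_
        rw [tsupport_eq_empty_iff.1 he]; simp
      · obtain ⟨m, hm, hmax⟩ := hc.exists_isMaxOn hne continuousOn_id
        have hmT := (hs hm).2
        filter_upwards [hhlim.eventually (gt_mem_nhds (show 0 < T - m by linarith))] with n hn
        intro x hx
        have hx' := subset_tsupport η hx
        have : x ≤ m := hmax hx'
        exact ⟨(hs hx').1, by linarith⟩
    have hcong2 : (fun n => inner ℝ ((hGm n).toLp (G n)) (hym.toLp _))
      =ᶠ[(hyperfilter ℕ : Filter ℕ)]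
        fun n => ∫ s, η s * ((h n)⁻¹ * (inner ℝ x (Φe (s + h n)) - inner ℝ x (Φe s))) := by
      filter_upwards [Nat.hyperfilter_le_atTop hev] with n hn
      rw [L2.inner_def]
      have e1 : ∫ t in Ioo 0 T, inner ℝ ((hGm n).toLp (G n) t) (hym.toLp _ t) =
          ∫ t in Ioo 0 T, η t * ((h n)⁻¹ * (inner ℝ x (Φe (t + h n)) - inner ℝ x (Φe t))) := by
        refine integral_congr_ae ?_
        filter_upwards [(hGm n).coeFn_toLp, hym.coeFn_toLp] with t h1 h2
        rw [h1, h2, real_inner_smul_right]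
        by_cases ht : t ∈ Ioo 0 (T - h n)
        · simp only [hG, indicator_of_mem ht]
          rw [real_inner_smul_left, inner_sub_left, real_inner_comm x, real_inner_comm x]
        · rw [Function.notMem_support.1 fun h' => ht (hn h'), zero_mul, zero_mul]
      rw [e1]
      refine setIntegral_eq_integral_of_forall_compl_eq_zero fun t ht => ?_
      have : t ∉ Ioo 0 (T - h n) := fun h' => ht (Ioo_subset_Ioo_right (by linarith [hh0 n]) h')
      rw [Function.notMem_support.1 fun h' => this (hn h'), zero_mul]
    have hfin := tendsto_nhds_unique (hlim1.congr' hcong2) hlim2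
    rw [L2.inner_def] at hfin
    have e3 : ∫ t in Ioo 0 T, inner ℝ (z t) (hym.toLp _ t) = ∫ t in Ioo 0 T,
        inner ℝ x (η t • z t) := by
      refine integral_congr_ae ?_
      filter_upwards [hym.coeFn_toLp] with t h2
      rw [h2, real_inner_smul_right, real_inner_smul_right, real_inner_comm]
    have e4 : ∫ t, deriv η t * inner ℝ x (Φe t) = ∫ t in Ioo 0 T, inner ℝ x (deriv η t • Φe t) := by
      rw [← setIntegral_eq_integral_of_forall_compl_eq_zero (s := Ioo 0 T)]
      · simp only [real_inner_smul_right]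
      · intro t ht
        have : t ∉ tsupport η := fun h' => ht (hs h')
        have h1 := notMem_tsupport_iff_eventuallyEq.1 this
        rw [h1.deriv_eq]; simp
    rw [e3, e4] at hfin
    rw [hfin, neg_neg]
  · rw [← ENNReal.ofReal_toReal (Lp.eLpNorm_ne_top z), ← Lp.norm_def]
    exact ENNReal.ofReal_le_ofReal hz

end DifferenceQuotients

/-! ### Increments of `W^{1,2}` functions -/

section TimeBounds
variable {X : Type} [NormedAddCommGroup X] {T : ℝ}

theorem integral_norm_le_sqrt_mul {g : ℝ → X} (hT : 0 ≤ T) (hg : MemLp g 2 (volTime T))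
    {M : ℝ} (hM : 0 ≤ M)
    (h : eLpNorm g 2 (volTime T) ≤ ENNReal.ofReal M) : ∫ s in (0 : ℝ)..T, ‖g s‖ ≤ √T * M := by
  have : IsFiniteMeasure (volTime T) := ⟨by simp [volTime]⟩
  have h1 := sq_integral_norm_le hg
  rw [eLpNorm_two_eq_ofReal_sqrt hg, ENNReal.ofReal_le_ofReal_iff hM, Real.sqrt_le_left hM] at h
  rw [intervalIntegral.integral_of_le hT, integral_Ioc_eq_integral_Ioo]
  refine abs_le_of_sq_le_sq' ?_ (by positivity) |>.2
  rw [mul_pow, Real.sq_sqrt hT]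
  refine h1.trans ?_
  have e : (volTime T).real univ = T := by simp [volTime, Measure.real, hT]
  rw [e]
  gcongr

variable [NormedSpace ℝ X] [CompleteSpace X] {f f' : ℝ → X}

/-- The primitive `G(t) = ∫₀ᵗ ‖f'‖` is a modulus of continuity of `f`. -/
theorem MemW12Time.exists_modulus (hT : 0 < T) (hf : MemW12Time T f f')
    (hfc : ContinuousOn f (Icc 0 T)) :
    ∃ G : ℝ → ℝ, Continuous G ∧ Monotone G ∧ G 0 = 0 ∧ G T = ∫ s in (0 : ℝ)..T, ‖f' s‖ ∧
      ∀ s ∈ Icc 0 T, ∀ t ∈ Icc 0 T, ‖f t - f s‖ ≤ |G t - G s| := by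
  have : IsFiniteMeasure (volTime T) := ⟨by simp [volTime]⟩
  have hf'1 : IntegrableOn (fun s => ‖f' s‖) (Ioo 0 T) := (hf.2.1.integrable (by norm_num)).norm
  set g : ℝ → ℝ := (Ioo 0 T).indicator fun s => ‖f' s‖ with hg
  have hgi : Integrable g := (integrable_indicator_iff measurableSet_Ioo).2 hf'1
  have hii : ∀ a b, IntervalIntegrable g volume a b := fun a b => hgi.intervalIntegrable
  have hg0 : ∀ s, 0 ≤ g s := fun s => indicator_nonneg (fun _ _ => norm_nonneg _) s
  have hGc : Continuous fun t => ∫ s in (0 : ℝ)..t, g s :=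
    intervalIntegral.continuous_primitive hii 0
  have hsub : ∀ s t, (∫ r in (0 : ℝ)..t, g r) - ∫ r in (0 : ℝ)..s, g r = ∫ r in s..t,
    g r := fun s t =>
    intervalIntegral.integral_interval_sub_left (hii 0 t) (hii 0 s)
  refine ⟨fun t => ∫ s in (0 : ℝ)..t, g s, hGc, fun s t hst => ?_, by simp, ?_, ?_⟩
  · rw [← sub_nonneg, hsub]
    exact intervalIntegral.integral_nonneg hst fun r _ => hg0 r
  · show ∫ s in (0 : ℝ)..T, g s = _
    rw [intervalIntegral.integral_of_le hT.le, intervalIntegral.integral_of_le hT.le,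
      integral_Ioc_eq_integral_Ioo, integral_Ioc_eq_integral_Ioo]
    exact setIntegral_congr_fun measurableSet_Ioo fun r hr => indicator_of_mem hr _
  · have hord : ∀ s ∈ Ioo 0 T, ∀ t ∈ Ioo 0 T, s ≤ t →
        ‖f t - f s‖ ≤ |(∫ r in (0 : ℝ)..t, g r) - ∫ r in (0 : ℝ)..s, g r| := by
      intro s hs t ht hst
      rw [hsub]
      refine (hf.norm_sub_le hfc hs.1 hst ht.2).trans (le_of_eq_of_le ?_ (le_abs_self _))
      refine intervalIntegral.integral_congr fun r hr => ?_
      rw [uIcc_of_le hst] at hr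
      have hr' : r ∈ Ioo 0 T := ⟨hs.1.trans_le hr.1, hr.2.trans_lt ht.2⟩
      exact (indicator_of_mem hr' fun s => ‖f' s‖).symm
    have hcl : closure (Ioo 0 T ×ˢ Ioo 0 T) = Icc 0 T ×ˢ Icc 0 T := by
      rw [closure_prod_eq, closure_Ioo hT.ne]
    have hle := le_on_closure (s := Ioo 0 T ×ˢ Ioo 0 T) (f := fun z : ℝ × ℝ => ‖f z.2 - f z.1‖)
      (g := fun z => |(∫ r in (0 : ℝ)..z.2, g r) - ∫ r in (0 : ℝ)..z.1, g r|) (fun z hz => by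
        rcases le_total z.1 z.2 with h | h
        · exact hord _ hz.1 _ hz.2 h
        · rw [norm_sub_rev, abs_sub_comm]
          exact hord _ hz.2 _ hz.1 h)
      (by
        rw [hcl]
        exact ((hfc.comp continuousOn_snd fun z hz => hz.2).sub
          (hfc.comp continuousOn_fst fun z hz => hz.1)).norm)
      ((hGc.comp continuous_snd).sub (hGc.comp continuous_fst)).abs.continuousOn
    rw [hcl] at hle
    exact fun s hs t ht => hle (x := (s, t)) ⟨hs, ht⟩

/-- The increments of a `W^{1,2}` function in time are of order `h` in `L¹`. -/
theorem MemW12Time.integral_norm_increment_le (hT : 0 < T) (hf : MemW12Time T f f')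
    (hfc : ContinuousOn f (Icc 0 T)) {h : ℝ} (hh : h ∈ Ioo 0 T) :
    ∫ s in (0 : ℝ)..(T - h), ‖f (s + h) - f s‖ ≤ h * ∫ s in (0 : ℝ)..T, ‖f' s‖ := by
  obtain ⟨G, hGc, hGm, hG0, hGT, hG⟩ := hf.exists_modulus hT hfc
  have hTh : 0 ≤ T - h := by linarith [hh.2]
  have hm1 : ∀ s ∈ Icc 0 (T - h), s ∈ Icc 0 T ∧ s + h ∈ Icc 0 T := fun s hs =>
    ⟨⟨hs.1, by linarith [hs.2, hh.1]⟩, by linarith [hs.1, hh.1], by linarith [hs.2]⟩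
  have hii : ∀ a b, IntervalIntegrable G volume a b := fun a b => hGc.intervalIntegrable a b
  have hshift : IntervalIntegrable (fun s => G (s + h)) volume 0 (T - h) :=
    (hGc.comp (continuous_add_const h)).intervalIntegrable _ _
  calc ∫ s in (0 : ℝ)..(T - h), ‖f (s + h) - f s‖ ≤ ∫ s in (0 : ℝ)..(T - h), (G (s + h) - G s) := by
        refine intervalIntegral.integral_mono_on hTh ?_ (hshift.sub (hii _ _)) fun s hs => ?_
        · refine ContinuousOn.intervalIntegrable ?_
          rw [uIcc_of_le hTh]
          exact ((hfc.comp (continuous_add_const h).continuousOn fun s hs => (hm1 s hs).2).sub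
            (hfc.mono fun s hs => (hm1 s hs).1)).norm
        · have := hG s (hm1 s hs).1 (s + h) (hm1 s hs).2
          rwa [abs_of_nonneg (sub_nonneg.2 (hGm (by linarith [hh.1])))] at this
    _ = (∫ s in h..T, G s) - ∫ s in (0 : ℝ)..(T - h), G s := by
        rw [intervalIntegral.integral_sub hshift (hii _ _),
            intervalIntegral.integral_comp_add_right]
        simp
    _ = (∫ s in (T - h)..T, G s) - ∫ s in (0 : ℝ)..h, G s := by
        have a1 := intervalIntegral.integral_add_adjacent_intervals (hii 0 h) (hii h T)
        have a2 := intervalIntegral.integral_add_adjacent_intervals (hii 0 (T - h)) (hii (T - h) T)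
        linarith
    _ ≤ (∫ _ in (T - h)..T, G T) - 0 := by
        refine sub_le_sub ?_ (intervalIntegral.integral_nonneg hh.1.le fun s hs => ?_)
        · exact intervalIntegral.integral_mono_on (by linarith [hh.1]) (hii _ _)
            (by simp) fun s hs => hGm hs.2
        · rw [← hG0]; exact hGm hs.1
    _ = _ := by rw [intervalIntegral.integral_const, hGT, smul_eq_mul]; ring

theorem MemW12Time.norm_le (hT : 0 < T) (hf : MemW12Time T f f')
    (hfc : ContinuousOn f (Icc 0 T)) {t : ℝ}
    (ht : t ∈ Icc 0 T) : ‖f t‖ ≤ T⁻¹ * (∫ s in (0 : ℝ)..T, ‖f s‖) + ∫ s in (0 : ℝ)..T, ‖f' s‖ := by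
  obtain ⟨G, hGc, hGm, hG0, hGT, hG⟩ := hf.exists_modulus hT hfc
  rw [← hGT]
  have hfi : IntervalIntegrable (fun s => ‖f s‖) volume 0 T :=
    ContinuousOn.intervalIntegrable (by rw [uIcc_of_le hT.le]; exact hfc.norm)
  have h1 : ∫ _ in (0 : ℝ)..T, ‖f t‖ ≤ ∫ s in (0 : ℝ)..T, (‖f s‖ + G T) := by
    refine intervalIntegral.integral_mono_on hT.le (by simp) (hfi.add (by simp)) fun s hs => ?_
    have h2 : |G t - G s| ≤ G T := by
      rw [abs_le]
      have := hGm ht.1; have := hGm ht.2; have := hGm hs.1; have := hGm hs.2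
      constructor <;> linarith
    have h3 := hG s hs t ht
    have h4 := norm_le_norm_add_norm_sub' (f t) (f s)
    linarith
  rw [intervalIntegral.integral_const, intervalIntegral.integral_add hfi (by simp),
    intervalIntegral.integral_const, sub_zero, smul_eq_mul, smul_eq_mul] at h1
  rw [inv_mul_eq_div, ← sub_le_iff_le_add, le_div_iff₀ hT]
  linarith

end TimeBounds

/-! ### A priori estimates for monotone and gradient flows -/

section GradientFlow
variable {V : Type*} [NormedAddCommGroup V] [InnerProductSpace ℝ V]

/-- A function with a continuous field of subgradients is differentiable. -/
theorem hasFDerivAt_of_subgradient {A : V → V} (hA : Continuous A) {J : V → ℝ}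
    (hJ : ∀ u v, inner ℝ (A u) (v - u) ≤ J v - J u) (u : V) : HasFDerivAt J
    (innerSL ℝ (A u)) u := by
  rw [hasFDerivAt_iff_isLittleO]
  have h1 : (fun v => J v - J u - innerSL ℝ (A u) (v - u)) =O[𝓝 u] fun v =>
      ‖A v - A u‖ * ‖v - u‖ := by
    refine Asymptotics.IsBigO.of_bound 1 (Eventually.of_forall fun v => ?_)
    have h2 := hJ u v
    have h3 := hJ v u
    rw [← neg_sub v u, inner_neg_right] at h3
    have h4 := real_inner_le_norm (A v - A u) (v - u)
    rw [inner_sub_left] at h4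
    rw [innerSL_apply_apply, one_mul, Real.norm_of_nonneg (by linarith),
        Real.norm_of_nonneg (by positivity)]
    linarith
  refine h1.trans_isLittleO ?_
  have h5 : (fun v => ‖A v - A u‖) =o[𝓝 u] fun _ => (1 : ℝ) := by
    rw [Asymptotics.isLittleO_one_iff]
    have := (hA.tendsto u).sub_const (A u)
    simpa using this.norm
  have := h5.mul_isBigO (Asymptotics.isBigO_refl (fun v => ‖v - u‖) (𝓝 u))
  simpa using this.norm_right

theorem continuous_of_norm_sq_sub_le {X : Type*} [NormedAddCommGroup X] {A : V → V}
    (hA : Continuous A)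
    {Φ : V → X} {c : ℝ} (hc : 0 < c) (hΦ : ∀ u v, c * ‖Φ u - Φ v‖ ^ 2 ≤
      inner ℝ (A u - A v) (u - v)) :
    Continuous Φ := by
  refine continuous_iff_continuousAt.2 fun u => ?_
  rw [ContinuousAt, tendsto_iff_norm_sub_tendsto_zero]
  have h1 : Tendsto (fun v => √(c⁻¹ * inner ℝ (A v - A u) (v - u))) (𝓝 u) (𝓝 0) := by
    have : Continuous fun v => √(c⁻¹ * inner ℝ (A v - A u) (v - u)) := by fun_prop
    simpa using this.tendsto u
  refine squeeze_zero (fun _ => norm_nonneg _) (fun v => Real.le_sqrt_of_sq_le ?_) h1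
  rw [le_inv_mul_iff₀ hc]
  exact hΦ v u

variable {T : ℝ} {A : V → V} {f u : ℝ → V}

theorem intervalIntegrable_of_continuousOn_Icc {Z : Type*} [NormedAddCommGroup Z] {g : ℝ → Z}
    (hg : ContinuousOn g (Icc 0 T)) {a b : ℝ} (ha : a ∈ Icc 0 T) (hb : b ∈ Icc 0 T) :
    IntervalIntegrable g volume a b :=
  (hg.mono (uIcc_subset_Icc ha hb)).intervalIntegrable

/-- The energy balance `J(u(t)) + ½ ∫₀ᵗ ‖u'‖² ≤ J(u(0)) + ½ ∫₀ᵗ ‖f‖²` of the flow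
`u' + A u = f` with `A` the gradient of `J`. -/
theorem gradient_flow_energy (hA : Continuous A) {J : V → ℝ}
    (hJ : ∀ u v, inner ℝ (A u) (v - u) ≤ J v - J u) (hf : ContinuousOn f (Icc 0 T))
    (hu : ∀ t ∈ Icc 0 T, HasDerivWithinAt u (f t - A (u t)) (Icc 0 T) t) {t : ℝ}
    (ht : t ∈ Icc 0 T) :
    J (u t) + 1 / 2 * (∫ s in (0 : ℝ)..t, ‖f s - A (u s)‖ ^ 2) ≤
      J (u 0) + 1 / 2 * ∫ s in (0 : ℝ)..t, ‖f s‖ ^ 2 := by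
  have h0 : (0 : ℝ) ∈ Icc 0 T := ⟨le_rfl, ht.1.trans ht.2⟩
  have huc : ContinuousOn u (Icc 0 T) := fun s hs => (hu s hs).continuousWithinAt
  have hAu : ContinuousOn (fun s => A (u s)) (Icc 0 T) := hA.comp_continuousOn huc
  have hJc : Continuous J := continuous_iff_continuousAt.2 fun v =>
    (hasFDerivAt_of_subgradient hA hJ v).continuousAt
  have hsub : Icc 0 t ⊆ Icc 0 T := Icc_subset_Icc_right ht.2
  have hd : ContinuousOn (fun s => inner ℝ (A (u s)) (f s - A (u s))) (Icc 0 T) :=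
    hAu.inner (hf.sub hAu)
  have h1 : ∫ s in (0 : ℝ)..t, inner ℝ (A (u s)) (f s - A (u s)) = J (u t) - J (u 0) := by
    refine intervalIntegral.integral_eq_sub_of_hasDerivAt_of_le ht.1
      (hJc.comp_continuousOn (huc.mono hsub)) (fun s hs => ?_)
        (intervalIntegrable_of_continuousOn_Icc hd h0 ht)
    exact (hasFDerivAt_of_subgradient hA hJ (u s)).comp_hasDerivAt s
      (hasDerivAt_of_within_Icc (hu s (hsub (Ioo_subset_Icc_self hs))) ⟨hs.1, hs.2.trans_le ht.2⟩)
  have hi1 : IntervalIntegrable (fun s => ‖f s‖ ^ 2) volume 0 t :=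
    intervalIntegrable_of_continuousOn_Icc (hf.norm.pow 2) h0 ht
  have hi2 : IntervalIntegrable (fun s => ‖f s - A (u s)‖ ^ 2) volume 0 t :=
    intervalIntegrable_of_continuousOn_Icc ((hf.sub hAu).norm.pow 2) h0 ht
  have h2 : ∫ s in (0 : ℝ)..t, inner ℝ (A (u s)) (f s - A (u s)) ≤
      ∫ s in (0 : ℝ)..t, (1 / 2 * ‖f s‖ ^ 2 - 1 / 2 * ‖f s - A (u s)‖ ^ 2) := by
    refine intervalIntegral.integral_mono_on ht.1 (intervalIntegrable_of_continuousOn_Icc hd h0 ht)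
      ((hi1.const_mul _).sub (hi2.const_mul _)) fun s hs => ?_
    have h3 := norm_add_sq_real (A (u s)) (f s - A (u s))
    rw [add_sub_cancel] at h3
    nlinarith [sq_nonneg ‖A (u s)‖]
  have e : ∫ s in (0 : ℝ)..t, (1 / 2 * ‖f s‖ ^ 2 - 1 / 2 * ‖f s - A (u s)‖ ^ 2) =
      1 / 2 * (∫ s in (0 : ℝ)..t, ‖f s‖ ^ 2) - 1 / 2 * ∫ s in (0 : ℝ)..t, ‖f s - A (u s)‖ ^ 2 := by
    have a1 := hi1.const_mul (1 / 2)
    have a2 := hi2.const_mul (1 / 2)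
    rw [intervalIntegral.integral_sub a1 a2, intervalIntegral.integral_const_mul,
      intervalIntegral.integral_const_mul]
  rw [h1, e] at h2
  linarith

variable {X : Type*} [NormedAddCommGroup X]

/-- The energy estimate for the increments `u(· + h) - u`. -/
theorem monotone_flow_increment (hA : Continuous A) {Φ : V → X} {c : ℝ} (hc : 0 < c)
    (hΦ : ∀ u v, c * ‖Φ u - Φ v‖ ^ 2 ≤ inner ℝ (A u - A v) (u - v)) (hf : ContinuousOn f (Icc 0 T))
    (hu : ∀ t ∈ Icc 0 T, HasDerivWithinAt u (f t - A (u t)) (Icc 0 T) t) {D : ℝ}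
    (hD : ∀ h ∈ Ioo 0 T, ∫ s in (0 : ℝ)..(T - h), ‖f (s + h) - f s‖ ≤ h * D) {h : ℝ}
    (hh : h ∈ Ioo 0 T) :
    (∀ t ∈ Icc 0 (T - h), ‖u (t + h) - u t‖ ≤ ‖u h - u 0‖ + 2 * (h * D)) ∧
      2 * c * (∫ s in (0 : ℝ)..(T - h), ‖Φ (u (s + h)) - Φ (u s)‖ ^ 2) ≤
        (‖u h - u 0‖ + 2 * (h * D)) ^ 2 := by
  have huc : ContinuousOn u (Icc 0 T) := fun s hs => (hu s hs).continuousWithinAt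
  have hΦc := continuous_of_norm_sq_sub_le hA hc hΦ
  have m1 : MapsTo (fun s => s + h) (Icc 0 (T - h)) (Icc 0 T) := fun s hs =>
    ⟨by linarith [hs.1, hh.1], by linarith [hs.2]⟩
  have m0 : Icc 0 (T - h) ⊆ Icc 0 T := fun s hs => ⟨hs.1, by linarith [hs.2, hh.1]⟩
  have hsh : ContinuousOn (fun s => s + h) (Icc 0 (T - h)) := (continuous_add_const h).continuousOn
  have hAu : ContinuousOn (fun s => A (u s)) (Icc 0 T) := hA.comp_continuousOn huc
  have hu' : ContinuousOn (fun s => f s - A (u s)) (Icc 0 T) := hf.sub hAu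
  have hder : ∀ t ∈ Icc 0 (T - h), HasDerivWithinAt (fun s => u (s + h) - u s)
      ((f (t + h) - A (u (t + h))) - (f t - A (u t))) (Icc 0 (T - h)) t := by
    intro t ht
    refine HasDerivWithinAt.sub ?_ ((hu t (m0 ht)).mono m0)
    have h1 := (hu (t + h) (m1 ht)).scomp t (h := fun s => s + h)
      (((hasDerivAt_id t).add_const h).hasDerivWithinAt) m1
    simpa [Function.comp_def] using h1
  have hE := energy_estimate (T := T - h) (by linarith [hh.2]) hder
    (q := fun s => c * ‖Φ (u (s + h)) - Φ (u s)‖ ^ 2) (β := fun s => ‖f (s + h) - f s‖)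
    ((hu'.comp hsh m1).sub (hu'.mono m0))
    (continuousOn_const.mul (((hΦc.comp_continuousOn (huc.comp hsh m1)).sub
      (hΦc.comp_continuousOn (huc.mono m0))).norm.pow 2))
    ((hf.comp hsh m1).sub (hf.mono m0)).norm
    (fun t _ => by positivity) (fun t _ => norm_nonneg _) (fun t _ => by
      have h1 := hΦ (u (t + h)) (u t)
      have h2 := real_inner_le_norm (f (t + h) - f t) (u (t + h) - u t)
      have h3 : inner ℝ (u (t + h) - u t) ((f (t + h) - A (u (t + h))) - (f t - A (u t))) =
          inner ℝ (f (t + h) - f t) (u (t + h) - u t) - inner ℝ (A (u (t + h)) - A (u t))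
              (u (t + h) - u t) := by
        rw [real_inner_comm, ← inner_sub_left]
        congr 1
        abel
      rw [h3]
      linarith)
  simp only [zero_add, intervalIntegral.integral_const_mul] at hE
  have hD' := hD h hh
  have h0 : 0 ≤ ∫ s in (0 : ℝ)..(T - h), ‖f (s + h) - f s‖ :=
    intervalIntegral.integral_nonneg (by linarith [hh.2]) fun _ _ => norm_nonneg _
  refine ⟨fun t ht => (hE.1 t ht).trans (by linarith), ?_⟩
  rw [mul_assoc]
  refine hE.2.trans ?_
  gcongr

/-- The time derivative of a monotone flow is controlled by its initial value and by the variation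
of the right-hand side. -/
theorem norm_deriv_monotone_flow_le (hA : Continuous A) {Φ : V → X} {c : ℝ} (hc : 0 < c)
    (hΦ : ∀ u v, c * ‖Φ u - Φ v‖ ^ 2 ≤ inner ℝ (A u - A v) (u - v)) (hT : 0 < T)
    (hf : ContinuousOn f (Icc 0 T))
    (hu : ∀ t ∈ Icc 0 T, HasDerivWithinAt u (f t - A (u t)) (Icc 0 T) t) {D : ℝ}
    (hD : ∀ h ∈ Ioo 0 T, ∫ s in (0 : ℝ)..(T - h), ‖f (s + h) - f s‖ ≤ h * D) {t : ℝ}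
    (ht : t ∈ Icc 0 T) :
    ‖f t - A (u t)‖ ≤ ‖f 0 - A (u 0)‖ + 2 * D := by
  have huc : ContinuousOn u (Icc 0 T) := fun s hs => (hu s hs).continuousWithinAt
  have hu' : ContinuousOn (fun s => f s - A (u s)) (Icc 0 T) := hf.sub (hA.comp_continuousOn huc)
  have key : ∀ t ∈ Ico 0 T, ‖f t - A (u t)‖ ≤ ‖f 0 - A (u 0)‖ + 2 * D := by
    intro t ht
    have hq : ∀ s ∈ Ico 0 T, Tendsto (fun h => ‖h⁻¹ • (u (s + h) - u s)‖) (𝓝[>] 0)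
        (𝓝 ‖f s - A (u s)‖) := by
      intro s hs
      have h1 : HasDerivWithinAt u (f s - A (u s)) (Ioi s) s :=
        ((hu s (Ico_subset_Icc_self hs)).mono_of_mem_nhdsWithin
          (Icc_mem_nhdsGE_of_mem hs)).Ioi_of_Ici
      rw [hasDerivWithinAt_iff_tendsto_slope' (by simp)] at h1
      have h2 : Tendsto (fun h : ℝ => s + h) (𝓝[>] 0) (𝓝[>] s) := by
        rw [tendsto_nhdsWithin_iff]
        refine ⟨?_, ?_⟩
        · have : Tendsto (fun h : ℝ => s + h) (𝓝 0) (𝓝 (s + 0)) :=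
            (continuous_const_add s).tendsto 0
          rw [add_zero] at this
          exact this.mono_left nhdsWithin_le_nhds
        · filter_upwards [self_mem_nhdsWithin] with h hh
          simpa using hh
      refine (h1.comp h2).norm.congr fun h => ?_
      simp [slope_def_module]
    have h3 := hq 0 ⟨le_rfl, hT⟩
    refine le_of_tendsto_of_tendsto (hq t ht) (h3.add_const (2 * D)) ?_
    filter_upwards [Ioo_mem_nhdsGT (show (0 : ℝ) < T - t by linarith [ht.2])] with h hh
    have hhT : h ∈ Ioo 0 T := ⟨hh.1, by linarith [hh.2, ht.1]⟩
    have h4 := (monotone_flow_increment hA hc hΦ hf hu hD hhT).1 t ⟨ht.1, by linarith [hh.2]⟩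
    rw [zero_add, norm_smul, norm_smul, norm_inv, Real.norm_of_nonneg hh.1.le,
        inv_mul_le_iff₀ hh.1, mul_add,
      mul_inv_cancel_left₀ hh.1.ne']
    linarith
  have hcl := le_on_closure (s := Ico 0 T) key (by rw [closure_Ico hT.ne]; exact hu'.norm)
    continuousOn_const
  rw [closure_Ico hT.ne] at hcl
  exact hcl ht

/-- The increments of `Φ ∘ u` are of order `h` in `L²`. -/
theorem integral_norm_sq_increment_le (hA : Continuous A) {Φ : V → X} {c : ℝ} (hc : 0 < c)
    (hΦ : ∀ u v, c * ‖Φ u - Φ v‖ ^ 2 ≤ inner ℝ (A u - A v) (u - v)) (hT : 0 < T)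
    (hf : ContinuousOn f (Icc 0 T))
    (hu : ∀ t ∈ Icc 0 T, HasDerivWithinAt u (f t - A (u t)) (Icc 0 T) t) {D : ℝ}
    (hD : ∀ h ∈ Ioo 0 T, ∫ s in (0 : ℝ)..(T - h), ‖f (s + h) - f s‖ ≤ h * D) {h : ℝ}
    (hh : h ∈ Ioo 0 T) :
    ∫ s in (0 : ℝ)..(T - h), ‖Φ (u (s + h)) - Φ (u s)‖ ^ 2 ≤
      ((√(2 * c))⁻¹ * (‖f 0 - A (u 0)‖ + 4 * D) * h) ^ 2 := by
  have h1 := (monotone_flow_increment hA hc hΦ hf hu hD hh).2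
  have h2 : ‖u h - u 0‖ ≤ (‖f 0 - A (u 0)‖ + 2 * D) * ‖h - 0‖ :=
    Convex.norm_image_sub_le_of_norm_hasDerivWithin_le (f := u) hu
      (fun s hs => norm_deriv_monotone_flow_le hA hc hΦ hT hf hu hD hs) (convex_Icc 0 T)
      ⟨le_rfl, hT.le⟩ (Ioo_subset_Icc_self hh)
  rw [sub_zero, Real.norm_of_nonneg hh.1.le] at h2
  have hD0 : 0 ≤ h * D := (intervalIntegral.integral_nonneg (by linarith [hh.2])
    fun _ _ => norm_nonneg _).trans (hD h hh)
  have h3 : (‖u h - u 0‖ + 2 * (h * D)) ^ 2 ≤ ((‖f 0 - A (u 0)‖ + 4 * D) * h) ^ 2 := by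
    gcongr
    linarith
  rw [mul_assoc, mul_pow, inv_pow, Real.sq_sqrt (by positivity), le_inv_mul_iff₀ (by positivity)]
  exact h1.trans h3

end GradientFlow

/-! ### The discrete space is finite-dimensional -/

section FiniteDimension
variable {d : ℕ} {Ω : TopologicalSpace.Opens (RVec d)}

/-- The discrete space is finite-dimensional: a field in it is determined by the polynomials that
represent its components on the cells. -/
theorem finiteDimensional_Vh (𝒯 : Triangulation Ω) {p : ℝ} (hp : 1 < p) (k r : ℕ) :
    FiniteDimensional ℝ (Vh 𝒯 hp k r) := by
  let E := 𝒯.cells → Fin d → MvPolynomial.restrictTotalDegree (Fin d) ℝ k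
  -- the graph of the relation "`P` represents `v`"
  let R : Submodule ℝ (Vh 𝒯 hp k r × E) :=
    { carrier := {z | ∀ s : 𝒯.cells, ∀ i, ∀ᵐ x ∂(volOn Ω), x ∈ closedCell s.1 →
        z.1.1 x i = MvPolynomial.eval (fun j => x j) (z.2 s i).1}
      zero_mem' := by
        intro s i
        filter_upwards [Lp.coeFn_zero (RVec d) 2 (volOn Ω)] with x hx _
        have : ((0 : Vh 𝒯 hp k r × E).1.1 : RVec d → RVec d) x = 0 := hx
        rw [this]
        exact (map_zero _).symm
      add_mem' := by
        intro a b ha hb s i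
        filter_upwards [ha s i, hb s i, Lp.coeFn_add a.1.1 b.1.1] with x h1 h2 h3 hx
        have : ((a + b).1.1 : RVec d → RVec d) x = a.1.1 x + b.1.1 x := h3
        rw [this, PiLp.add_apply, h1 hx, h2 hx]
        exact (map_add _ (a.2 s i).1 (b.2 s i).1).symm
      smul_mem' := by
        intro c a ha s i
        filter_upwards [ha s i, Lp.coeFn_smul c a.1.1] with x h1 h3 hx
        have : ((c • a).1.1 : RVec d → RVec d) x = c • a.1.1 x := h3
        rw [this, PiLp.smul_apply, h1 hx]
        exact (MvPolynomial.smul_eval _ (a.2 s i).1 c).symm }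
  have hinj : Function.Injective ((LinearMap.snd ℝ (Vh 𝒯 hp k r) E).comp R.subtype) := by
    refine (injective_iff_map_eq_zero _).2 ?_
    rintro ⟨⟨v, P⟩, hz⟩ h0
    have hP : P = 0 := h0
    subst hP
    have hv : (v.1 : RVec d → RVec d) =ᵐ[volOn Ω] 0 := by
      have h1 : ∀ᵐ x ∂(volOn Ω), ∀ s : 𝒯.cells, ∀ i, x ∈ closedCell s.1 →
          v.1 x i = MvPolynomial.eval (fun j => x j) (((0 : E) s i).1) :=
        ae_all_iff.2 fun s => ae_all_iff.2 fun i => hz s i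
      filter_upwards [h1, ae_restrict_mem Ω.isOpen.measurableSet] with x hx hxΩ
      have h2 : x ∈ ⋃ s ∈ 𝒯.cells, convexHull ℝ (s : Set (RVec d)) := by
        rw [𝒯.iUnion_eq]; exact subset_closure hxΩ
      simp only [mem_iUnion, exists_prop] at h2
      obtain ⟨s, hs, hxs⟩ := h2
      ext i
      rw [hx ⟨s, hs⟩ i hxs]
      exact map_zero _
    have hv0 : v = 0 := Subtype.ext ((Lp.eq_zero_iff_ae_eq_zero).2 hv)
    subst hv0
    rfl
  have : FiniteDimensional ℝ R := FiniteDimensional.of_injective _ hinj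
  refine Module.Finite.of_surjective ((LinearMap.fst ℝ (Vh 𝒯 hp k r) E).comp R.subtype) fun v => ?_
  have hv := v.2.1.2
  choose P hPd hPe using fun (s : 𝒯.cells) (i : Fin d) => hv i s.1 s.2
  exact ⟨⟨(v, fun s i => ⟨P s i, (MvPolynomial.mem_restrictTotalDegree _ _ _).2 (hPd s i)⟩),
    fun s i => hPe s i⟩, rfl⟩

end FiniteDimension

/-! ### The stress pairing -/

section StressPairing
variable {d : ℕ} {Ω : TopologicalSpace.Opens (RVec d)} {δ p : ℝ}

theorem symGrad_ae_eq {u : RVec d → RVec d} {G : RVec d → RTen d} (h : HasWeakGrad Ω u G) :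
    symGrad Ω u =ᵐ[volOn Ω] fun x => symPart (G x) := by
  filter_upwards [weakGrad_ae_eq h] with x hx
  rw [symGrad, hx]

theorem symPart_symGrad (u : RVec d → RVec d) (x : RVec d) : symPart (symGrad Ω u x) =
    symGrad Ω u x :=
  symPart_symPart _

theorem MemW0.symGrad_add {u v : RVec d → RVec d} (hu : MemW0 Ω p u) (hv : MemW0 Ω p v)
    {w : RVec d → RVec d}
    (hw : w =ᵐ[volOn Ω] u + v) : symGrad Ω w =ᵐ[volOn Ω] symGrad Ω u + symGrad Ω v := by
  filter_upwards [symGrad_ae_eq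
    ((hu.hasWeakGrad.add hv.hasWeakGrad).congr hw.symm (ae_eq_refl _))] with x hx
  rw [hx, Pi.add_apply, symPart_add]; rfl

theorem MemW0.symGrad_smul {u : RVec d → RVec d} (hu : MemW0 Ω p u) (c : ℝ) {w : RVec d → RVec d}
    (hw : w =ᵐ[volOn Ω] c • u) : symGrad Ω w =ᵐ[volOn Ω] c • symGrad Ω u := by
  filter_upwards [symGrad_ae_eq ((hu.hasWeakGrad.smul c).congr hw.symm (ae_eq_refl _))] with x hx
  rw [hx, Pi.smul_apply, symPart_smul]; rfl

theorem one_add_rpow_le {p s : ℝ} (hp : 0 ≤ p) (hs : 0 ≤ s) : (1 + s) ^ p ≤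
    2 ^ p * (1 + s ^ p) := by
  have h1 : (1 + s) ^ p ≤ (2 * max 1 s) ^ p :=
    Real.rpow_le_rpow (by positivity) (by linarith [le_max_left 1 s, le_max_right 1 s]) hp
  rw [Real.mul_rpow (by norm_num) (by positivity)] at h1
  refine h1.trans ?_
  gcongr
  rcases max_choice 1 s with h | h <;> rw [h]
  · rw [Real.one_rpow]; linarith [Real.rpow_nonneg hs p]
  · linarith

theorem integrable_norm_rpow_of_memLp {α F : Type*} [MeasurableSpace α] {μ : Measure α}
    [NormedAddCommGroup F]
    (hp : 1 < p) {G : α → F} (hG : MemLp G (ENNReal.ofReal p) μ) : Integrable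
    (fun x => ‖G x‖ ^ p) μ := by
  have := hG.integrable_norm_rpow (by simpa using by linarith) (by simp)
  rwa [ENNReal.toReal_ofReal (by linarith)] at this

theorem stressPairing_smul {u v : RVec d → RVec d} (hv : MemW0 Ω p v) (c : ℝ) {z : RVec d → RVec d}
    (hz : z =ᵐ[volOn Ω] c • v) : stressPairing Ω δ p u z = c * stressPairing Ω δ p u v := by
  unfold stressPairing
  rw [← integral_const_mul]
  refine integral_congr_ae ?_
  filter_upwards [hv.symGrad_smul c hz] with x hx
  rw [hx, Pi.smul_apply, real_inner_smul_right]

theorem stressPairing_self (hδ : 0 ≤ δ) (u : RVec d → RVec d) :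
    stressPairing Ω δ p u u = ∫ x in (Ω : Set (RVec d)), ‖tensorF δ p (symGrad Ω u x)‖ ^ 2 := by
  unfold stressPairing
  congr 1 with x
  rw [← inner_stressS_self hδ, symPart_symGrad]

variable [IsFiniteMeasure (volOn Ω)]

theorem integrable_one_add_rpow (hp : 1 < p) {G : RVec d → RTen d}
    (hG : MemLp G (ENNReal.ofReal p) (volOn Ω)) :
    Integrable (fun x => (1 + ‖G x‖) ^ p) (volOn Ω) := by
  have h1 : MemLp (fun x => 1 + ‖G x‖) (ENNReal.ofReal p) (volOn Ω) :=
    (memLp_const (1 : ℝ)).add hG.norm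
  refine (integrable_norm_rpow_of_memLp hp h1).congr (ae_of_all _ fun x => ?_)
  simp only []
  rw [Real.norm_of_nonneg (by positivity)]

theorem memLp_stressS (hδ : δ ∈ Icc (0 : ℝ) 1) (hp : 1 < p) {G : RVec d → RTen d}
    (hG : MemLp G (ENNReal.ofReal p) (volOn Ω)) :
    MemLp (fun x => stressS δ p (G x)) (ENNReal.ofReal (p / (p - 1))) (volOn Ω) := by
  have hp1 : 0 < p - 1 := by linarith
  have h1 : MemLp (fun x => 1 + ‖symPart (G x)‖) (ENNReal.ofReal p) (volOn Ω) :=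
    (memLp_const (1 : ℝ)).add (memLp_symPart hG).norm
  have h2 := h1.norm_rpow_div (ENNReal.ofReal (p - 1))
  rw [ENNReal.toReal_ofReal hp1.le, ← ENNReal.ofReal_div_of_pos hp1] at h2
  refine h2.of_le ((continuous_stressS hδ.1 hp).comp_aestronglyMeasurable hG.1)
    (ae_of_all _ fun x => ?_)
  rw [Real.norm_of_nonneg (by positivity : 0 ≤ 1 + ‖symPart (G x)‖),
      Real.norm_of_nonneg (by positivity)]
  exact norm_stressS_le hδ.1 hδ.2 hp _

theorem memLp_tensorF (hδ : δ ∈ Icc (0 : ℝ) 1) (hp : 1 < p) {G : RVec d → RTen d}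
    (hG : MemLp G (ENNReal.ofReal p) (volOn Ω)) : MemLp (fun x => tensorF δ p (G x)) 2
    (volOn Ω) := by
  have hm := (continuous_tensorF (d := d) hδ.1 hp).comp_aestronglyMeasurable hG.1
  rw [memLp_two_iff_integrable_sq_norm hm]
  refine (integrable_one_add_rpow hp (memLp_symPart hG)).mono' (hm.norm.pow 2)
    (ae_of_all _ fun x => ?_)
  rw [Real.norm_of_nonneg (by positivity)]
  exact norm_sq_tensorF_le hδ.1 hδ.2 hp _

theorem integrable_phiPot (hδ : δ ∈ Icc (0 : ℝ) 1) (hp : 1 < p) {G : RVec d → RTen d}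
    (hG : MemLp G (ENNReal.ofReal p) (volOn Ω)) : Integrable (fun x => phiPot δ p ‖symPart (G x)‖)
    (volOn Ω) := by
  refine ((memLp_tensorF hδ hp hG).integrable_norm_pow (by norm_num)).mono'
    (((continuous_phiPot hδ.1 hp).comp continuous_symPart.norm).comp_aestronglyMeasurable hG.1)
    (ae_of_all _ fun x => ?_)
  have h1 := le_phiPot hδ.1 hp (norm_nonneg (symPart (G x)))
  have h2 := phiPot_le hδ.1 hp (norm_nonneg (symPart (G x)))
  rw [← norm_sq_tensorF hδ.1] at h1 h2
  rw [Real.norm_of_nonneg]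
  · exact h2
  · exact le_trans (mul_nonneg (potConst_pos p).le (sq_nonneg _)) h1

theorem integrable_inner_stressS (hδ : δ ∈ Icc (0 : ℝ) 1) (hp : 1 < p) {G H : RVec d → RTen d}
    (hG : MemLp G (ENNReal.ofReal p) (volOn Ω)) (hH : MemLp H (ENNReal.ofReal p) (volOn Ω)) :
    Integrable (fun x => inner ℝ (stressS δ p (G x)) (H x)) (volOn Ω) := by
  have : ENNReal.HolderConjugate (ENNReal.ofReal (p / (p - 1))) (ENNReal.ofReal p) :=
    (Real.HolderConjugate.conjExponent hp).symm.ennrealOfReal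
  refine ((memLp_stressS hδ hp hG).norm.integrable_mul hH.norm).mono'
    ((memLp_stressS hδ hp hG).1.inner hH.1) (ae_of_all _ fun x => ?_)
  exact norm_inner_le_norm _ _

theorem stressPairing_add (hδ : δ ∈ Icc (0 : ℝ) 1) (hp : 1 < p) {u v w : RVec d → RVec d}
    (hu : MemW0 Ω p u) (hv : MemW0 Ω p v) (hw : MemW0 Ω p w) {z : RVec d → RVec d}
    (hz : z =ᵐ[volOn Ω] v + w) : stressPairing Ω δ p u z = stressPairing Ω δ p u v +
        stressPairing Ω δ p u w := by
  unfold stressPairing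
  rw [← integral_add (integrable_inner_stressS hδ hp hu.memLp_symGrad hv.memLp_symGrad)
    (integrable_inner_stressS hδ hp hu.memLp_symGrad hw.memLp_symGrad)]
  refine integral_congr_ae ?_
  filter_upwards [hv.symGrad_add hw hz] with x hx
  rw [hx, Pi.add_apply, inner_add_right]

end StressPairing

/-! ### The stress operator on `V_h` -/

section StressOperator
variable {d : ℕ} {Ω : TopologicalSpace.Opens (RVec d)} {δ p : ℝ}

theorem MemW0.symGrad_sub {u v : RVec d → RVec d} (hu : MemW0 Ω p u) (hv : MemW0 Ω p v)
    {w : RVec d → RVec d}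
    (hw : w =ᵐ[volOn Ω] u - v) : symGrad Ω w =ᵐ[volOn Ω] symGrad Ω u - symGrad Ω v := by
  have h1 := hu.symGrad_add (hv.smul (-1)) (w := w) (by simpa [sub_eq_add_neg] using hw)
  have h2 := hv.symGrad_smul (-1) (ae_eq_refl _)
  filter_upwards [h1, h2] with x h1 h2
  rw [h1, Pi.add_apply, h2, Pi.smul_apply, Pi.sub_apply, neg_one_smul, sub_eq_add_neg]

theorem norm_sq_toLp {α F : Type*} [MeasurableSpace α] {μ : Measure α}
    [NormedAddCommGroup F] {g : α → F}
    (hg : MemLp g 2 μ) : ‖hg.toLp g‖ ^ 2 = ∫ x, ‖g x‖ ^ 2 ∂μ := by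
  rw [Lp.norm_toLp, eLpNorm_two_eq_ofReal_sqrt hg, ENNReal.toReal_ofReal (Real.sqrt_nonneg _),
    Real.sq_sqrt (integral_nonneg fun _ => sq_nonneg _)]

section
variable {𝒯 : Triangulation Ω} {hp : 1 < p} {k r : ℕ}

theorem memW0_Vh (v : Vh 𝒯 hp k r) : MemW0 Ω p v.1 := v.2.1.1

theorem coeFn_add_Vh (v w : Vh 𝒯 hp k r) : ((v + w).1 : RVec d → RVec d) =ᵐ[volOn Ω] v.1 + w.1 :=
  Lp.coeFn_add v.1 w.1

theorem coeFn_sub_Vh (v w : Vh 𝒯 hp k r) : ((v - w).1 : RVec d → RVec d) =ᵐ[volOn Ω] v.1 - w.1 :=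
  Lp.coeFn_sub v.1 w.1

theorem coeFn_smul_Vh (c : ℝ) (v : Vh 𝒯 hp k r) :
    ((c • v).1 : RVec d → RVec d) =ᵐ[volOn Ω] c • (v.1 : RVec d → RVec d) :=
  Lp.coeFn_smul c v.1

end

variable [IsFiniteMeasure (volOn Ω)]

theorem monoConst_mul_integral_le (hδ : δ ∈ Icc (0 : ℝ) 1) (hp : 1 < p) {u v z : RVec d → RVec d}
    (hu : MemW0 Ω p u) (hv : MemW0 Ω p v) (hz : z =ᵐ[volOn Ω] u - v) :
    monoConst p * (∫ x in (Ω : Set (RVec d)),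
        ‖tensorF δ p (symGrad Ω u x) - tensorF δ p (symGrad Ω v x)‖ ^ 2) ≤
      stressPairing Ω δ p u z - stressPairing Ω δ p v z := by
  have hzw : MemW0 Ω p z := (hu.add (hv.smul (-1))).congr (by simpa [sub_eq_add_neg] using hz.symm)
  have h1 := integrable_inner_stressS hδ hp hu.memLp_symGrad hzw.memLp_symGrad
  have h2 := integrable_inner_stressS hδ hp hv.memLp_symGrad hzw.memLp_symGrad
  unfold stressPairing
  rw [← integral_const_mul, ← integral_sub h1 h2]
  refine integral_mono_ae ((((memLp_tensorF hδ hp hu.memLp_symGrad).sub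
    (memLp_tensorF hδ hp hv.memLp_symGrad)).integrable_norm_pow (by norm_num)).const_mul _)
      (h1.sub h2) ?_
  filter_upwards [hu.symGrad_sub hv hz] with x hx
  have h3 := monoConst_mul_norm_sq_le hδ.1 hp (symGrad Ω u x) (symGrad Ω v x)
  rw [symPart_symGrad, symPart_symGrad] at h3
  rw [hx, ← inner_sub_left]
  exact h3

theorem stressPairing_le_phiPot_sub (hδ : δ ∈ Icc (0 : ℝ) 1) (hp : 1 < p) {u v z : RVec d → RVec d}
    (hu : MemW0 Ω p u) (hv : MemW0 Ω p v) (hz : z =ᵐ[volOn Ω] v - u) :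
    stressPairing Ω δ p u z ≤ (∫ x in (Ω : Set (RVec d)), phiPot δ p ‖symPart (symGrad Ω v x)‖) -
      ∫ x in (Ω : Set (RVec d)), phiPot δ p ‖symPart (symGrad Ω u x)‖ := by
  have hzw : MemW0 Ω p z := (hv.add (hu.smul (-1))).congr (by simpa [sub_eq_add_neg] using hz.symm)
  have h1 := integrable_phiPot hδ hp hv.memLp_symGrad
  have h2 := integrable_phiPot hδ hp hu.memLp_symGrad
  unfold stressPairing
  rw [← integral_sub h1 h2]
  refine integral_mono_ae (integrable_inner_stressS hδ hp hu.memLp_symGrad hzw.memLp_symGrad)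
    (h1.sub h2) ?_
  filter_upwards [hv.symGrad_sub hu hz] with x hx
  have h3 := inner_stressS_le_phiPot_sub hδ.1 hp (symGrad Ω u x) (symGrad Ω v x)
  rw [symPart_symGrad, symPart_symGrad] at h3
  rw [hx, symPart_symGrad, symPart_symGrad]
  exact h3

variable {𝒯 : Triangulation Ω} {hp : 1 < p} {k r : ℕ}

/-- Riesz representation in `V_h` of the functional `ξ ↦ (S(Du), Dξ)`. -/
theorem exists_stress_representative (hδ : δ ∈ Icc (0 : ℝ) 1) {u : RVec d → RVec d}
    (hu : MemW0 Ω p u) :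
    ∃ z : Vh 𝒯 hp k r, ∀ ξ : Vh 𝒯 hp k r, inner ℝ z ξ = stressPairing Ω δ p u ξ.1 := by
  have : FiniteDimensional ℝ (Vh 𝒯 hp k r) := finiteDimensional_Vh 𝒯 hp k r
  have : CompleteSpace (Vh 𝒯 hp k r) := FiniteDimensional.complete ℝ _
  let L : Vh 𝒯 hp k r →ₗ[ℝ] ℝ :=
    { toFun := fun ξ => stressPairing Ω δ p u ξ.1
      map_add' := fun ξ ζ => stressPairing_add hδ hp hu (memW0_Vh ξ) (memW0_Vh ζ) (coeFn_add_Vh ξ ζ)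
      map_smul' := fun c ξ => stressPairing_smul (memW0_Vh ξ) c (coeFn_smul_Vh c ξ) }
  refine ⟨(InnerProductSpace.toDual ℝ (Vh 𝒯 hp k r)).symm
    (LinearMap.toContinuousLinearMap L), fun ξ => ?_⟩
  rw [InnerProductSpace.toDual_symm_apply]
  rfl

/-- The pairing `(S(Du), Dξ)` depends continuously on `u ∈ V_h`. -/
theorem continuous_stressPairing (hδ : δ ∈ Icc (0 : ℝ) 1) {ξ : RVec d → RVec d} (hξ : MemW0 Ω p ξ) :
    Continuous fun u : Vh 𝒯 hp k r => stressPairing Ω δ p u.1 ξ := by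
  have : FiniteDimensional ℝ (Vh 𝒯 hp k r) := finiteDimensional_Vh 𝒯 hp k r
  set b := Module.finBasis ℝ (Vh 𝒯 hp k r) with hb
  set n := Module.finrank ℝ (Vh 𝒯 hp k r) with hn
  set g : Fin n → RVec d → RTen d := fun i => symGrad Ω (b i).1 with hg
  have hgL : ∀ i, MemLp (g i) (ENNReal.ofReal p) (volOn Ω) := fun i =>
    (memW0_Vh (b i)).memLp_symGrad
  -- in coordinates the symmetric gradient is a finite sum of fixed functions
  have hsum : ∀ (s : Finset (Fin n)) (c : Fin n → ℝ),
      symGrad Ω (∑ i ∈ s, c i • b i : Vh 𝒯 hp k r).1 =ᵐ[volOn Ω] fun x => ∑ i ∈ s, c i • g i x := by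
    intro s c
    induction s using Finset.induction_on with
    | empty =>
      have h1 := (memW0_Vh (0 : Vh 𝒯 hp k r)).symGrad_smul 0 (w := (0 : Vh 𝒯 hp k r).1) (by
        have := coeFn_smul_Vh 0 (0 : Vh 𝒯 hp k r)
        rwa [smul_zero] at this)
      filter_upwards [h1] with x hx
      simp only [Finset.sum_empty]
      rw [hx]; simp
    | insert a s ha ih =>
      have h1 := (memW0_Vh (c a • b a)).symGrad_add (memW0_Vh (∑ i ∈ s, c i • b i))
        (coeFn_add_Vh _ _)
      have h2 := (memW0_Vh (b a)).symGrad_smul (c a) (coeFn_smul_Vh (c a) (b a))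
      rw [Finset.sum_insert ha]
      filter_upwards [h1, h2, ih] with x h1 h2 h3
      rw [h1, Pi.add_apply, h2, h3, Finset.sum_insert ha]
      rfl
  have hcont : Continuous fun c : Fin n → ℝ =>
      ∫ x in (Ω : Set (RVec d)), inner ℝ (stressS δ p (∑ i, c i • g i x)) (symGrad Ω ξ x) := by
    refine continuous_iff_continuousAt.2 fun c₀ => ?_
    set B : RVec d → ℝ := fun x => 1 + ∑ i, (|c₀ i| + 1) * ‖g i x‖ with hB
    have hB1 : ∀ x, 1 ≤ B x := fun x => by
      have : 0 ≤ ∑ i, (|c₀ i| + 1) * ‖g i x‖ := Finset.sum_nonneg fun i _ => by positivity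
      simp only [hB]; linarith
    have hBL : MemLp B (ENNReal.ofReal p) (volOn Ω) :=
      (memLp_const (1 : ℝ)).add (memLp_finsetSum _ fun i _ => (hgL i).norm.const_mul _)
    have hp1 : 0 < p - 1 := by linarith
    have hBp : MemLp (fun x => B x ^ (p - 1)) (ENNReal.ofReal (p / (p - 1))) (volOn Ω) := by
      have h2 := hBL.norm_rpow_div (ENNReal.ofReal (p - 1))
      rw [ENNReal.toReal_ofReal hp1.le, ← ENNReal.ofReal_div_of_pos hp1] at h2
      refine (memLp_congr_ae (ae_of_all _ fun x => ?_)).1 h2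
      simp only [Real.norm_of_nonneg (zero_le_one.trans (hB1 x))]
    have : ENNReal.HolderConjugate (ENNReal.ofReal (p / (p - 1))) (ENNReal.ofReal p) :=
      (Real.HolderConjugate.conjExponent hp).symm.ennrealOfReal
    refine continuousAt_of_dominated (bound := fun x => B x ^ (p - 1) * ‖symGrad Ω ξ x‖) ?_ ?_ ?_ ?_
    · refine Eventually.of_forall fun c => ?_
      have hm : MemLp (fun x => ∑ i, c i • g i x) (ENNReal.ofReal p) (volOn Ω) :=
        memLp_finsetSum _ fun i _ => (hgL i).const_smul (c i)
      exact ((continuous_stressS hδ.1 hp).comp_aestronglyMeasurable hm.1).inner hξ.memLp_symGrad.1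
    · filter_upwards [Metric.ball_mem_nhds c₀ one_pos] with c hc
      refine ae_of_all _ fun x => ?_
      refine (norm_inner_le_norm _ _).trans ?_
      gcongr
      refine (norm_stressS_le hδ.1 hδ.2 hp _).trans ?_
      refine Real.rpow_le_rpow (by positivity) ?_ hp1.le
      simp only [hB]
      gcongr
      refine (norm_symPart_le _).trans ((norm_sum_le _ _).trans (Finset.sum_le_sum fun i _ => ?_))
      rw [norm_smul]
      gcongr
      have h1 : |c i - c₀ i| < 1 := (dist_le_pi_dist c c₀ i).trans_lt hc
      have h2 := abs_sub_abs_le_abs_sub (c i) (c₀ i)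
      rw [Real.norm_eq_abs]
      linarith
    · exact hBp.integrable_mul hξ.memLp_symGrad.norm
    · refine ae_of_all _ fun x => Continuous.continuousAt ?_
      exact ((continuous_stressS hδ.1 hp).comp (continuous_finsetSum _ fun i _ =>
        (continuous_apply i).smul continuous_const)).inner continuous_const
  have hrepr : Continuous fun u : Vh 𝒯 hp k r => fun i => b.repr u i :=
    (b.equivFun.toLinearMap).continuous_of_finiteDimensional
  refine (hcont.comp hrepr).congr fun u => ?_
  unfold stressPairing
  refine integral_congr_ae ?_
  have h1 := hsum Finset.univ fun i => b.repr u i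
  rw [b.sum_repr] at h1
  filter_upwards [h1] with x hx
  rw [hx]

/-- The discrete stress operator `A`, the map `Φ(u) = F(Du)` and the potential `J(u) = ∫ φ(|Du|)`
on `V_h`, with the relations among them. -/
theorem exists_stress_operator (hδ : δ ∈ Icc (0 : ℝ) 1) :
    ∃ (A : Vh 𝒯 hp k r → Vh 𝒯 hp k r) (Φ : Vh 𝒯 hp k r → Lp (RTen d) 2 (volOn Ω))
      (J : Vh 𝒯 hp k r → ℝ),
      Continuous A ∧ (∀ u ξ, inner ℝ (A u) ξ = stressPairing Ω δ p u.1 ξ.1) ∧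
      (∀ u, Φ u =ᵐ[volOn Ω] fun x => tensorF δ p (symGrad Ω u.1 x)) ∧
      (∀ u v, monoConst p * ‖Φ u - Φ v‖ ^ 2 ≤ inner ℝ (A u - A v) (u - v)) ∧
      (∀ u, inner ℝ (A u) u = ‖Φ u‖ ^ 2) ∧
      (∀ u v, inner ℝ (A u) (v - u) ≤ J v - J u) ∧
      (∀ u, potConst p * ‖Φ u‖ ^ 2 ≤ J u ∧ J u ≤ ‖Φ u‖ ^ 2) := by
  have : FiniteDimensional ℝ (Vh 𝒯 hp k r) := finiteDimensional_Vh 𝒯 hp k r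
  have : CompleteSpace (Vh 𝒯 hp k r) := FiniteDimensional.complete ℝ _
  choose A hA using fun u : Vh 𝒯 hp k r =>
    exists_stress_representative (𝒯 := 𝒯) (hp := hp) (k := k) (r := r) hδ (memW0_Vh u)
  have hF := fun u : Vh 𝒯 hp k r => memLp_tensorF hδ hp (memW0_Vh u).memLp_symGrad
  refine ⟨A, fun u => (hF u).toLp _,
    fun u => ∫ x in (Ω : Set (RVec d)), phiPot δ p ‖symPart (symGrad Ω u.1 x)‖, ?_, hA,
    fun u => (hF u).coeFn_toLp, fun u v => ?_, fun u => ?_, fun u v => ?_, fun u => ?_⟩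
  · have h1 : Continuous fun u => InnerProductSpace.toDual ℝ (Vh 𝒯 hp k r) (A u) := by
      refine continuous_clm_apply.2 fun ξ => ?_
      simp only [InnerProductSpace.toDual_apply_apply, hA]
      exact continuous_stressPairing hδ (memW0_Vh ξ)
    exact ((InnerProductSpace.toDual ℝ (Vh 𝒯 hp k r)).symm.continuous.comp h1).congr fun u =>
      LinearIsometryEquiv.symm_apply_apply _ _
  · rw [← MemLp.toLp_sub, norm_sq_toLp, inner_sub_left, hA, hA]
    exact monoConst_mul_integral_le hδ hp (memW0_Vh u) (memW0_Vh v) (coeFn_sub_Vh u v)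
  · rw [norm_sq_toLp, hA]
    exact stressPairing_self hδ.1 _
  · rw [hA]
    exact stressPairing_le_phiPot_sub hδ hp (memW0_Vh u) (memW0_Vh v) (coeFn_sub_Vh v u)
  · have h1 := (hF u).integrable_norm_pow (p := 2) (by norm_num)
    have h2 := integrable_phiPot hδ hp (memW0_Vh u).memLp_symGrad
    rw [norm_sq_toLp, ← integral_const_mul]
    refine ⟨integral_mono (h1.const_mul _) h2 fun x => ?_, integral_mono h2 h1 fun x => ?_⟩
    · simp only [norm_sq_tensorF hδ.1]
      exact le_phiPot hδ.1 hp (norm_nonneg _)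
    · simp only [norm_sq_tensorF hδ.1]
      exact phiPot_le hδ.1 hp (norm_nonneg _)

end StressOperator

/-! ### Surjectivity of coercive gradients and integration by parts -/

section Surjectivity

/-- A continuous gradient field with a coercive convex potential is surjective: minimize
`J - (b, ·)`. -/
theorem exists_eq_of_coercive_potential {V : Type*} [NormedAddCommGroup V] [InnerProductSpace ℝ V]
    [FiniteDimensional ℝ V] {A : V → V} (hA : Continuous A) {J : V → ℝ}
    (hJ : ∀ u v, inner ℝ (A u) (v - u) ≤ J v - J u) {p c C : ℝ} (hp : 1 < p) (hc : 0 < c)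
    (hco : ∀ u, c * ‖u‖ ^ p - C ≤ J u) (b : V) : ∃ u, A u = b := by
  have : ProperSpace V := FiniteDimensional.proper ℝ V
  have hd := hasFDerivAt_of_subgradient hA hJ
  have hJc : Continuous J := continuous_iff_continuousAt.2 fun v => (hd v).continuousAt
  have hlim : Tendsto (fun u => J u - inner ℝ b u) (cocompact V) atTop := by
    have h1 : Tendsto (fun s : ℝ => s * (c * s ^ (p - 1) - ‖b‖) - C) atTop atTop := by
      refine tendsto_atTop_add_const_right _ _ (tendsto_id.atTop_mul_atTop₀ ?_)
      exact tendsto_atTop_add_const_right _ _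
        ((tendsto_rpow_atTop (by linarith)).const_mul_atTop hc)
    refine tendsto_atTop_mono (fun u => ?_) (h1.comp (tendsto_norm_cocompact_atTop (E := V)))
    have h2 := hco u
    have h3 := real_inner_le_norm b u
    have h4 : ‖u‖ ^ p = ‖u‖ * ‖u‖ ^ (p - 1) := by
      rcases eq_or_lt_of_le (norm_nonneg u) with h | h
      · rw [← h, Real.zero_rpow (by linarith), zero_mul]
      · rw [Real.rpow_sub_one h.ne', mul_div_cancel₀ _ h.ne']
    simp only [Function.comp_apply]
    rw [h4] at h2
    linarith
  obtain ⟨u, hu⟩ := (hJc.sub (continuous_const.inner continuous_id)).exists_forall_le hlim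
  refine ⟨u, ?_⟩
  have h1 : HasFDerivAt (fun v => J v - inner ℝ b v) (innerSL ℝ (A u) - innerSL ℝ b) u :=
    (hd u).sub (innerSL ℝ b).hasFDerivAt
  have h2 := IsLocalMin.hasFDerivAt_eq_zero (Eventually.of_forall hu) h1
  have h3 := congrArg (fun L => L (A u - b)) h2
  simp only [← map_sub, innerSL_apply_apply, _root_.zero_apply] at h3
  exact sub_eq_zero.1 (inner_self_eq_zero.1 h3)

end Surjectivity

section IntegrationByParts
variable {d : ℕ} {Ω : TopologicalSpace.Opens (RVec d)} {δ p : ℝ}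

theorem integral_norm_mul_norm_two_le {α F G : Type*} [MeasurableSpace α] {μ : Measure α}
    [NormedAddCommGroup F] [NormedAddCommGroup G] {f : α → F} {g : α → G} (hf : MemLp f 2 μ)
    (hg : MemLp g 2 μ) :
    ∫ x, ‖f x‖ * ‖g x‖ ∂μ ≤ (eLpNorm f 2 μ).toReal * (eLpNorm g 2 μ).toReal := by
  have h := integral_norm_mul_norm_le (p := 2) (q := 2) Real.HolderConjugate.two_two (f := f)
    (g := g) (μ := μ)
  simp only [ENNReal.ofReal_ofNat] at h
  exact h hf hg

/-- Integration by parts: the pairing of a tensor field with the gradient of a test field is bounded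
by the `L²` norms of the weak gradient of the former and of the latter. -/
theorem abs_integral_inner_classGrad_le {S : RVec d → RTen d}
    {N : RVec d → EuclideanSpace ℝ ((Fin d × Fin d) × Fin d)} (hN : HasWeakGrad Ω S N)
    (hN2 : MemLp N 2 (volOn Ω)) {w : RVec d → RVec d} (hw : ContDiff ℝ ∞ w)
    (hc : HasCompactSupport w)
    (hs : tsupport w ⊆ Ω) :
    |∫ x in (Ω : Set (RVec d)), inner ℝ (S x) (classGrad w x)| ≤
      (d : ℝ) ^ 2 * ((eLpNorm N 2 (volOn Ω)).toReal * (eLpNorm w 2 (volOn Ω)).toReal) := by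
  have hw2 : MemLp w 2 (volOn Ω) := (hw.continuous.memLp_of_hasCompactSupport hc).restrict _
  have hcomp : ∀ i, ContDiff ℝ ∞ fun x => w x i := fun i =>
    (EuclideanSpace.proj (𝕜 := ℝ) i : RVec d →L[ℝ] ℝ).contDiff.comp hw
  have hci : ∀ i, HasCompactSupport fun x => w x i := fun i =>
    hc.comp_left (g := fun y : RVec d => y i) rfl
  have hsi : ∀ i, tsupport (fun x => w x i) ⊆ Ω := fun i =>
    (closure_mono (Function.support_subset_iff'.2 fun x hx => by
      rw [Function.notMem_support.1 hx]; rfl)).trans hs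
  have hder : ∀ x i j, classGrad w x (i, j) =
      fderiv ℝ (fun x => w x i) x (EuclideanSpace.single j 1) := by
    intro x i j
    have h1 : HasFDerivAt (fun x => w x i)
        ((EuclideanSpace.proj (𝕜 := ℝ) i : RVec d →L[ℝ] ℝ).comp (fderiv ℝ w x)) x :=
      (EuclideanSpace.proj (𝕜 := ℝ) i : RVec d →L[ℝ] ℝ).hasFDerivAt.comp x
        (hw.differentiable (by simp) x).hasFDerivAt
    rw [h1.fderiv]
    rfl
  have hint : ∀ k : Fin d × Fin d, Integrable (fun x => S x k * classGrad w x k) (volOn Ω) := by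
    rintro ⟨i, j⟩
    simp only [hder]
    exact integrableOn_mul_partial _ (locallyIntegrableOn_coord hN.1 (i, j)) (hcomp i)
      (hci i) (hsi i)
  have e1 : ∫ x in (Ω : Set (RVec d)), inner ℝ (S x) (classGrad w x) =
      ∑ k : Fin d × Fin d, ∫ x in (Ω : Set (RVec d)), S x k * classGrad w x k := by
    rw [← integral_finsetSum _ fun k _ => hint k]
    congr 1 with x
    simp only [PiLp.inner_apply, RCLike.inner_apply, conj_trivial]
    exact Finset.sum_congr rfl fun k _ => mul_comm _ _
  have hbound : ∀ k : Fin d × Fin d, |∫ x in (Ω : Set (RVec d)), S x k * classGrad w x k| ≤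
      (eLpNorm N 2 (volOn Ω)).toReal * (eLpNorm w 2 (volOn Ω)).toReal := by
    rintro ⟨i, j⟩
    simp only [hder]
    rw [hN.2.2 _ (hcomp i) (hci i) (hsi i) (i, j) j, abs_neg]
    refine (abs_integral_le_integral_abs).trans
      (le_trans ?_ (integral_norm_mul_norm_two_le hN2 hw2))
    refine integral_mono_of_nonneg (ae_of_all _ fun x => abs_nonneg _)
      (hN2.norm.integrable_mul hw2.norm)
      (ae_of_all _ fun x => ?_)
    simp only [abs_mul]
    exact mul_le_mul (PiLp.norm_apply_le (N x) _) (PiLp.norm_apply_le (w x) _) (abs_nonneg _)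
      (norm_nonneg _)
  rw [e1]
  refine (Finset.abs_sum_le_sum_abs _ _).trans ((Finset.sum_le_sum fun k _ => hbound k).trans_eq ?_)
  simp [sq]

/-- If `∇S(Du) ∈ L²(Ω)`, the functional `ξ ↦ (S(Du), Dξ)` is bounded in `L²(Ω)`. -/
theorem abs_stressPairing_le [IsFiniteMeasure (volOn Ω)] (hδ : δ ∈ Icc (0 : ℝ) 1)
    (hp : 1 < p) {K : NNReal}
    (hK : ∀ w : RVec d → RVec d, ContDiff ℝ ∞ w → HasCompactSupport w → tsupport w ⊆ Ω →
      eLpNorm w 2 (volOn Ω) ≤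
        K * eLpNorm (fun x => symPart (classGrad w x)) (ENNReal.ofReal p) (volOn Ω))
    {u ξ : RVec d → RVec d} (hu : MemW0 Ω p u) (hξ : MemW0 Ω p ξ) (hξ2 : MemLp ξ 2 (volOn Ω))
    {N : RVec d → EuclideanSpace ℝ ((Fin d × Fin d) × Fin d)}
    (hN : HasWeakGrad Ω (fun x => stressS δ p (symGrad Ω u x)) N) (hN2 : MemLp N 2 (volOn Ω)) :
    |stressPairing Ω δ p u ξ| ≤
      (d : ℝ) ^ 2 * ((eLpNorm N 2 (volOn Ω)).toReal * (eLpNorm ξ 2 (volOn Ω)).toReal) := by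
  obtain ⟨w, hw, tw, tG⟩ := hξ.exists_approx
  have t2 := tendsto_eLpNorm_two_of_korn hp hK hξ.memLp.1 hξ.memLp_weakGrad.1 hw tw tG
  have hw2 : ∀ n, MemLp (w n) 2 (volOn Ω) := fun n =>
    ((hw n).1.continuous.memLp_of_hasCompactSupport (hw n).2.1).restrict _
  have hS := memLp_stressS hδ hp hu.memLp_symGrad
  have hconj := Real.HolderConjugate.conjExponent hp
  have hwG : ∀ n, MemLp (classGrad (w n)) (ENNReal.ofReal p) (volOn Ω) := fun n => by
    refine ((continuous_classGrad (hw n).1).memLp_of_hasCompactSupport ?_).restrict _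
    exact HasCompactSupport.of_support_subset_isCompact (hw n).2.1 (support_classGrad_subset _)
  have inst' : ENNReal.HolderConjugate (ENNReal.ofReal p) (ENNReal.ofReal (p / (p - 1))) :=
    hconj.ennrealOfReal
  have hinn : ∀ {H : RVec d → RTen d}, MemLp H (ENNReal.ofReal p) (volOn Ω) →
      Integrable (fun x => inner ℝ (stressS δ p (symGrad Ω u x)) (H x)) (volOn Ω) := fun hH =>
    integrable_inner_stressS hδ hp hu.memLp_symGrad hH
  have e0 : stressPairing Ω δ p u ξ =
      ∫ x in (Ω : Set (RVec d)), inner ℝ (stressS δ p (symGrad Ω u x)) (weakGrad Ω ξ x) := by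
    unfold stressPairing
    congr 1 with x
    rw [stressS_eq, real_inner_smul_left, real_inner_smul_left,
        inner_symPart_left _ (weakGrad Ω ξ x)]
    rfl
  have hlim : Tendsto (fun n => ∫ x in (Ω : Set (RVec d)),
      inner ℝ (stressS δ p (symGrad Ω u x)) (classGrad (w n) x)) atTop
          (𝓝 (stressPairing Ω δ p u ξ)) := by
    rw [e0, tendsto_iff_norm_sub_tendsto_zero]
    have h1 : Tendsto (fun n =>
      (eLpNorm (weakGrad Ω ξ - classGrad (w n)) (ENNReal.ofReal p) (volOn Ω)).toReal *
        (eLpNorm (fun x => stressS δ p (symGrad Ω u x)) (ENNReal.ofReal (p / (p - 1)))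
          (volOn Ω)).toReal)
        atTop (𝓝 0) := by
      have := ((ENNReal.tendsto_toReal ENNReal.zero_ne_top).comp tG).mul_const
        (eLpNorm (fun x => stressS δ p (symGrad Ω u x)) (ENNReal.ofReal (p / (p - 1)))
          (volOn Ω)).toReal
      simpa using this
    refine squeeze_zero (fun _ => norm_nonneg _) (fun n => ?_) h1
    have hdiff := hξ.memLp_weakGrad.sub (hwG n)
    rw [norm_sub_rev, ← integral_sub (hinn hξ.memLp_weakGrad) (hinn (hwG n))]
    refine (norm_integral_le_integral_norm _).trans
      (le_trans ?_ (integral_norm_mul_norm_le hconj hdiff hS))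
    refine integral_mono_of_nonneg (ae_of_all _ fun x => norm_nonneg _)
      (hdiff.norm.integrable_mul hS.norm)
      (ae_of_all _ fun x => ?_)
    simp only []
    rw [← inner_sub_right, mul_comm]
    exact norm_inner_le_norm _ _
  have hlim2 : Tendsto (fun n => (eLpNorm (w n) 2 (volOn Ω)).toReal) atTop
      (𝓝 (eLpNorm ξ 2 (volOn Ω)).toReal) := by
    rw [tendsto_iff_norm_sub_tendsto_zero]
    have h1 := (ENNReal.tendsto_toReal ENNReal.zero_ne_top).comp t2
    refine squeeze_zero (fun _ => norm_nonneg _) (fun n => ?_) h1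
    have h3 := abs_norm_sub_norm_le ((hw2 n).toLp _) (hξ2.toLp _)
    rw [norm_sub_rev, ← MemLp.toLp_sub, Lp.norm_toLp, Lp.norm_toLp, Lp.norm_toLp] at h3
    exact h3
  exact le_of_tendsto_of_tendsto' hlim.abs ((hlim2.const_mul _).const_mul _) fun n =>
    abs_integral_inner_classGrad_le hN hN2 (hw n).1 (hw n).2.1 (hw n).2.2

end IntegrationByParts

/-! ### The discrete initial value -/

section NonlinearProjection
variable {d : ℕ} {Ω : TopologicalSpace.Opens (RVec d)} {δ p : ℝ}

theorem toReal_eLpNorm_rpow (hp : 1 < p) {F : Type*} [NormedAddCommGroup F] {G : RVec d → F}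
    (hG : MemLp G (ENNReal.ofReal p) (volOn Ω)) :
    (eLpNorm G (ENNReal.ofReal p) (volOn Ω)).toReal ^ p = ∫ x in (Ω : Set (RVec d)), ‖G x‖ ^ p := by
  have hp0 : 0 < p := by linarith
  have h0 : 0 ≤ ∫ x in (Ω : Set (RVec d)), ‖G x‖ ^ p :=
    integral_nonneg fun x => Real.rpow_nonneg (norm_nonneg _) _
  rw [hG.eLpNorm_eq_integral_rpow_norm (by simpa using hp0) (by simp), ENNReal.toReal_ofReal hp0.le,
    ENNReal.toReal_ofReal (by positivity), ← Real.rpow_mul h0, inv_mul_cancel₀ hp0.ne',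
      Real.rpow_one]

variable [IsFiniteMeasure (volOn Ω)]

theorem integral_norm_symGrad_rpow_le (hδ : δ ∈ Icc (0 : ℝ) 1) (hp : 1 < p) {u : RVec d → RVec d}
    (hu : MemW0 Ω p u) :
    ∫ x in (Ω : Set (RVec d)), ‖symGrad Ω u x‖ ^ p ≤
      2 * (∫ x in (Ω : Set (RVec d)), ‖tensorF δ p (symGrad Ω u x)‖ ^ 2) + (volOn Ω).real univ := by
  have h1 := ((memLp_tensorF hδ hp hu.memLp_symGrad).integrable_norm_pow (p := 2)
    (by norm_num)).const_mul 2
  have h2 : ∫ x in (Ω : Set (RVec d)), ‖symGrad Ω u x‖ ^ p ≤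
      ∫ x in (Ω : Set (RVec d)), (2 * ‖tensorF δ p (symGrad Ω u x)‖ ^ 2 + 1) := by
    refine integral_mono (integrable_norm_rpow_of_memLp hp hu.memLp_symGrad)
      (h1.add (integrable_const 1))
      fun x => ?_
    have := rpow_le_two_mul_add_one hδ.1 hδ.2 hp (norm_nonneg (symPart (symGrad Ω u x)))
    simp only []
    rwa [← norm_sq_tensorF hδ.1, symPart_symGrad] at this
  rw [integral_add h1 (integrable_const 1), integral_const_mul, integral_const] at h2
  simpa using h2

/-- Young's inequality for the stress pairing. -/
theorem stressPairing_le_young (hδ : δ ∈ Icc (0 : ℝ) 1) (hp : 1 < p) {u ξ : RVec d → RVec d}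
    (hu : MemW0 Ω p u) (hξ : MemW0 Ω p ξ) :
    stressPairing Ω δ p u ξ ≤ 1 / 4 * (∫ x in (Ω : Set (RVec d)), ‖symGrad Ω ξ x‖ ^ p) +
      4 ^ (1 / (p - 1)) * (2 ^ p * ((volOn Ω).real univ + ∫ x in (Ω : Set (RVec d)),
          ‖symGrad Ω u x‖ ^ p)) := by
  have h1 := (integrable_norm_rpow_of_memLp hp hξ.memLp_symGrad).const_mul (1 / 4)
  have h2 := integrable_norm_rpow_of_memLp hp hu.memLp_symGrad
  have h3 : Integrable (fun x =>
    (4 : ℝ) ^ (1 / (p - 1)) * (2 ^ p * (1 + ‖symGrad Ω u x‖ ^ p))) (volOn Ω) :=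
    ((((integrable_const 1).add h2)).const_mul _).const_mul _
  have h4 : stressPairing Ω δ p u ξ ≤ ∫ x in (Ω : Set (RVec d)), (1 / 4 * ‖symGrad Ω ξ x‖ ^ p +
      (4 : ℝ) ^ (1 / (p - 1)) * (2 ^ p * (1 + ‖symGrad Ω u x‖ ^ p))) := by
    refine integral_mono (integrable_inner_stressS hδ hp hu.memLp_symGrad
      hξ.memLp_symGrad) (h1.add h3)
      fun x => ?_
    have a1 := norm_stressS_le hδ.1 hδ.2 hp (symGrad Ω u x)
    rw [symPart_symGrad] at a1
    have a2 : (0 : ℝ) < 4 ^ (1 / (p - 1)) := by positivity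
    calc inner ℝ (stressS δ p (symGrad Ω u x)) (symGrad Ω ξ x)
        ≤ ‖stressS δ p (symGrad Ω u x)‖ * ‖symGrad Ω ξ x‖ := real_inner_le_norm _ _
      _ ≤ (1 + ‖symGrad Ω u x‖) ^ (p - 1) * ‖symGrad Ω ξ x‖ := by gcongr
      _ ≤ 1 / 4 * ‖symGrad Ω ξ x‖ ^ p + 4 ^ (1 / (p - 1)) * (1 + ‖symGrad Ω u x‖) ^ p :=
          rpow_mul_le_young hp (by positivity) (norm_nonneg _)
      _ ≤ _ := by
          gcongr
          exact one_add_rpow_le (by linarith) (norm_nonneg _)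
  refine h4.trans_eq ?_
  rw [integral_add h1 h3, integral_const_mul, integral_const_mul, integral_const_mul,
    integral_add (integrable_const 1) h2, integral_const]
  simp

variable {𝒯 : Triangulation Ω} {hp : 1 < p} {k r : ℕ} {K : NNReal}

/-- Korn-Sobolev in terms of the dissipation `∫ |F(Dv)|²`. -/
theorem norm_rpow_le_dissipation (hδ : δ ∈ Icc (0 : ℝ) 1)
    (hK : ∀ w : RVec d → RVec d, ContDiff ℝ ∞ w → HasCompactSupport w → tsupport w ⊆ Ω →
      eLpNorm w 2 (volOn Ω) ≤
        K * eLpNorm (fun x => symPart (classGrad w x)) (ENNReal.ofReal p) (volOn Ω))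
          (v : Vh 𝒯 hp k r) :
    ‖v‖ ^ p ≤ (K : ℝ) ^ p *
      (2 * (∫ x in (Ω : Set (RVec d)), ‖tensorF δ p (symGrad Ω v.1 x)‖ ^ 2) +
          (volOn Ω).real univ) := by
  have hv := memW0_Vh v
  have h1 : ‖v‖ ≤ K * (eLpNorm (symGrad Ω v.1) (ENNReal.ofReal p) (volOn Ω)).toReal := by
    have h2 := ENNReal.toReal_mono (ENNReal.mul_ne_top ENNReal.coe_ne_top hv.memLp_symGrad.2.ne)
      (hv.eLpNorm_two_le hp hK)
    rwa [ENNReal.toReal_mul, ENNReal.coe_toReal, ← Lp.norm_def] at h2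
  have h3 := Real.rpow_le_rpow (norm_nonneg v) h1 (by linarith : 0 ≤ p)
  rw [Real.mul_rpow (by positivity) (by positivity), toReal_eLpNorm_rpow hp hv.memLp_symGrad] at h3
  refine h3.trans ?_
  gcongr
  exact integral_norm_symGrad_rpow_le hδ hp hv

/-- Existence by minimization of the coercive potential of `A`; two solutions have the same
symmetric gradient by strict monotonicity, and the Korn-Sobolev inequality identifies them. -/
theorem existsUnique_nonlinearProjection (hδ : δ ∈ Icc (0 : ℝ) 1)
    (hK : ∀ w : RVec d → RVec d, ContDiff ℝ ∞ w → HasCompactSupport w → tsupport w ⊆ Ω →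
      eLpNorm w 2 (volOn Ω) ≤
        K * eLpNorm (fun x => symPart (classGrad w x)) (ENNReal.ofReal p) (volOn Ω))
    {u₀ : RVec d → RVec d} (hu₀ : MemW0 Ω p u₀) :
    ∃! w : Vh 𝒯 hp k r, IsNonlinearProjection 𝒯 hp k r δ u₀ w := by
  have : FiniteDimensional ℝ (Vh 𝒯 hp k r) := finiteDimensional_Vh 𝒯 hp k r
  obtain ⟨A, Φ, J, hAc, hA, hΦ, hmono, hself, hconv, hJ⟩ :=
    exists_stress_operator (𝒯 := 𝒯) (hp := hp) (k := k) (r := r) hδ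
  obtain ⟨b, hb⟩ := exists_stress_representative (𝒯 := 𝒯) (hp := hp) (k := k) (r := r) hδ hu₀
  have hiff : ∀ w, IsNonlinearProjection 𝒯 hp k r δ u₀ w ↔ A w = b := fun w => by
    constructor
    · intro h
      refine ext_inner_right ℝ fun ξ => ?_
      rw [hA, hb, h ξ]
    · intro h ξ
      rw [← hA, h, hb]
  have hpot := potConst_pos p
  have hK1 : (0 : ℝ) < ((K : ℝ) + 1) ^ p := by positivity
  obtain ⟨w, hw⟩ := exists_eq_of_coercive_potential hAc hconv
    (c := potConst p / (2 * ((K : ℝ) + 1) ^ p))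
    (C := potConst p * (volOn Ω).real univ / 2) hp (by positivity) (fun u => by
      have h1 := norm_rpow_le_dissipation hδ hK u
      rw [← stressPairing_self hδ.1, ← hA, hself] at h1
      have h2 : ‖u‖ ^ p ≤ ((K : ℝ) + 1) ^ p * (2 * ‖Φ u‖ ^ 2 + (volOn Ω).real univ) := by
        refine h1.trans ?_
        gcongr
        linarith
      have h3 : potConst p / (2 * ((K : ℝ) + 1) ^ p) * ‖u‖ ^ p ≤
          potConst p / (2 * ((K : ℝ) + 1) ^ p) *
            (((K : ℝ) + 1) ^ p * (2 * ‖Φ u‖ ^ 2 + (volOn Ω).real univ)) := by gcongr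
      have e : potConst p / (2 * ((K : ℝ) + 1) ^ p) *
            (((K : ℝ) + 1) ^ p * (2 * ‖Φ u‖ ^ 2 + (volOn Ω).real univ)) =
          potConst p * ‖Φ u‖ ^ 2 + potConst p * (volOn Ω).real univ / 2 := by
        field_simp
      linarith [(hJ u).1]) b
  refine ⟨w, (hiff w).2 hw, fun v hv => ?_⟩
  -- equal stresses force equal symmetric gradients, hence equal fields by Korn's inequality
  have hAv : A v = A w := ((hiff v).1 hv).trans hw.symm
  have h1 := hmono v w
  rw [hAv, sub_self, inner_zero_left] at h1
  have h2 : ‖Φ v - Φ w‖ ^ 2 ≤ 0 := nonpos_of_mul_nonpos_right h1 (monoConst_pos hp)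
  have h3 : Φ v = Φ w := by
    rw [← sub_eq_zero, ← norm_eq_zero]
    exact pow_eq_zero_iff two_ne_zero |>.1 (le_antisymm h2 (sq_nonneg _))
  have h4 : symGrad Ω (v - w).1 =ᵐ[volOn Ω] 0 := by
    have h5 := (memW0_Vh v).symGrad_sub (memW0_Vh w) (coeFn_sub_Vh v w)
    filter_upwards [h5, hΦ v, hΦ w] with x a1 a2 a3
    have a4 := symPart_eq_of_tensorF_eq hδ.1 hp (a2.symm.trans ((congrArg (fun g => g x)
      (congrArg (fun g : Lp (RTen d) 2 (volOn Ω) => (g : RVec d → RTen d)) h3)).trans a3))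
    rw [symPart_symGrad, symPart_symGrad] at a4
    rw [a1, Pi.sub_apply, a4, sub_self]
    rfl
  have h6 := (memW0_Vh (v - w)).eLpNorm_two_le hp hK
  rw [eLpNorm_congr_ae h4, eLpNorm_zero, mul_zero] at h6
  have h7 : ‖(v - w).1‖ = 0 := by rw [Lp.norm_def, le_antisymm h6 zero_le]; rfl
  exact sub_eq_zero.1 (Subtype.ext (norm_eq_zero.1 h7))

/-- The dissipation of the discrete initial value is controlled by `‖∇u₀‖_{L^p}`. -/
theorem dissipation_nonlinearProjection_le (hδ : δ ∈ Icc (0 : ℝ) 1) {u₀ : RVec d → RVec d}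
    (hu₀ : MemW0 Ω p u₀) {M : ℝ} (hM : 0 ≤ M)
    (hu₀M : eLpNorm (weakGrad Ω u₀) (ENNReal.ofReal p) (volOn Ω) ≤ ENNReal.ofReal M)
    {w : Vh 𝒯 hp k r}
    (hw : IsNonlinearProjection 𝒯 hp k r δ u₀ w) :
    ∫ x in (Ω : Set (RVec d)), ‖tensorF δ p (symGrad Ω w.1 x)‖ ^ 2 ≤
      (volOn Ω).real univ / 2 +
          2 * (4 ^ (1 / (p - 1)) * (2 ^ p * ((volOn Ω).real univ + M ^ p))) := by
  have h1 := stressPairing_le_young hδ hp hu₀ (memW0_Vh w)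
  rw [← hw w, stressPairing_self hδ.1] at h1
  have h2 := integral_norm_symGrad_rpow_le hδ hp (memW0_Vh w)
  have h3 : ∫ x in (Ω : Set (RVec d)), ‖symGrad Ω u₀ x‖ ^ p ≤ M ^ p := by
    rw [← toReal_eLpNorm_rpow hp hu₀.memLp_symGrad]
    refine Real.rpow_le_rpow ENNReal.toReal_nonneg
      (ENNReal.toReal_le_of_le_ofReal hM ?_) (by linarith)
    exact (eLpNorm_mono fun x => norm_symPart_le _).trans hu₀M
  have h4 : (4 : ℝ) ^ (1 / (p - 1)) * (2 ^ p * ((volOn Ω).real univ +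
      ∫ x in (Ω : Set (RVec d)), ‖symGrad Ω u₀ x‖ ^ p)) ≤
      (4 : ℝ) ^ (1 / (p - 1)) * (2 ^ p * ((volOn Ω).real univ + M ^ p)) := by gcongr
  linarith

end NonlinearProjection

/-! ### Bounds for the flow -/

section TimeNorms
variable {X : Type} [NormedAddCommGroup X] {T B : ℝ} {g : ℝ → X}

theorem memLp_two_of_continuousOn (hg : ContinuousOn g (Icc 0 T)) : MemLp g 2 (volTime T) := by
  have : IsFiniteMeasure (volTime T) := ⟨by simp [volTime]⟩
  obtain ⟨C, hC⟩ := isCompact_Icc.exists_bound_of_continuousOn hg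
  refine MemLp.of_bound ((hg.mono Ioo_subset_Icc_self).aestronglyMeasurable measurableSet_Ioo) C ?_
  filter_upwards [ae_restrict_mem measurableSet_Ioo] with t ht
  exact hC t (Ioo_subset_Icc_self ht)

theorem eLpNorm_two_volTime_le_iff (hT : 0 ≤ T) (hg : MemLp g 2 (volTime T)) (hB : 0 ≤ B) :
    eLpNorm g 2 (volTime T) ≤ ENNReal.ofReal B ↔ ∫ t in (0 : ℝ)..T, ‖g t‖ ^ 2 ≤ B ^ 2 := by
  rw [eLpNorm_two_eq_ofReal_sqrt hg, ENNReal.ofReal_le_ofReal_iff hB, Real.sqrt_le_left hB,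
    intervalIntegral.integral_of_le hT, integral_Ioc_eq_integral_Ioo]

theorem eLpNorm_top_volTime_le (h : ∀ t ∈ Icc 0 T, ‖g t‖ ≤ B) :
    eLpNorm g ⊤ (volTime T) ≤ ENNReal.ofReal B := by
  rw [eLpNorm_exponent_top]
  refine eLpNormEssSup_le_of_ae_bound ?_
  filter_upwards [ae_restrict_mem measurableSet_Ioo] with t ht
  exact h t (Ioo_subset_Icc_self ht)

end TimeNorms

section FlowBounds
variable {V : Type*} [NormedAddCommGroup V] [InnerProductSpace ℝ V] {X : Type*}
  [NormedAddCommGroup X]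
  {T : ℝ} {A : V → V} {Φ : V → X} {J : V → ℝ} {f u : ℝ → V}

/-- Testing the flow with `u`. -/
theorem flow_energy_bound (hT : 0 ≤ T) (hA : Continuous A) (hΦ : Continuous Φ)
    (hself : ∀ v, inner ℝ (A v) v = ‖Φ v‖ ^ 2) (hf : ContinuousOn f (Icc 0 T))
    (hu : ∀ t ∈ Icc 0 T, HasDerivWithinAt u (f t - A (u t)) (Icc 0 T) t) {B D : ℝ} (h0 : ‖u 0‖ ≤ B)
    (hD : ∫ t in (0 : ℝ)..T, ‖f t‖ ≤ D) :
    (∀ t ∈ Icc 0 T, ‖u t‖ ≤ B + 2 * D) ∧ ∫ t in (0 : ℝ)..T, ‖Φ (u t)‖ ^ 2 ≤ (B + 2 * D) ^ 2 := by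
  have huc : ContinuousOn u (Icc 0 T) := fun s hs => (hu s hs).continuousWithinAt
  have hE := energy_estimate hT hu (hf.sub (hA.comp_continuousOn huc)) (q := fun t => ‖Φ (u t)‖ ^ 2)
    (β := fun t => ‖f t‖) ((hΦ.comp_continuousOn huc).norm.pow 2) hf.norm (fun _ _ => sq_nonneg _)
    (fun _ _ => norm_nonneg _) (fun t _ => by
      have h1 := real_inner_le_norm (f t) (u t)
      have h2 := hself (u t)
      rw [inner_sub_right, real_inner_comm, real_inner_comm (A (u t))]
      linarith)
  have hfi : 0 ≤ ∫ t in (0 : ℝ)..T, ‖f t‖ :=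
    intervalIntegral.integral_nonneg hT fun _ _ => norm_nonneg _
  refine ⟨fun t ht => (hE.1 t ht).trans (by linarith), ?_⟩
  have h3 : (‖u 0‖ + 2 * ∫ t in (0 : ℝ)..T, ‖f t‖) ^ 2 ≤ (B + 2 * D) ^ 2 := by gcongr
  have h4 : 0 ≤ ∫ t in (0 : ℝ)..T, ‖Φ (u t)‖ ^ 2 :=
    intervalIntegral.integral_nonneg hT fun _ _ => sq_nonneg _
  linarith [hE.2]

/-- Testing the flow with `u'`. -/
theorem flow_potential_bound (hT : 0 ≤ T) (hA : Continuous A) {c : ℝ} (hc : 0 < c)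
    (hconv : ∀ u v, inner ℝ (A u) (v - u) ≤ J v - J u)
    (hJ : ∀ v, c * ‖Φ v‖ ^ 2 ≤ J v ∧ J v ≤ ‖Φ v‖ ^ 2) (hf : ContinuousOn f (Icc 0 T))
    (hu : ∀ t ∈ Icc 0 T, HasDerivWithinAt u (f t - A (u t)) (Icc 0 T) t) {B D : ℝ}
    (h0 : ‖Φ (u 0)‖ ^ 2 ≤ B)
    (hD : ∫ t in (0 : ℝ)..T, ‖f t‖ ^ 2 ≤ D) :
    (∀ t ∈ Icc 0 T, ‖Φ (u t)‖ ^ 2 ≤ (B + D) / c) ∧ ∫ t in (0 : ℝ)..T, ‖f t - A (u t)‖ ^ 2 ≤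
        2 * B + D := by
  have hJ0 := (hJ (u 0)).2
  have hJn : ∀ v, 0 ≤ J v := fun v => le_trans (by positivity) (hJ v).1
  have hD0 : 0 ≤ ∫ t in (0 : ℝ)..T, ‖f t‖ ^ 2 :=
    intervalIntegral.integral_nonneg hT fun _ _ => sq_nonneg _
  refine ⟨fun t ht => ?_, ?_⟩
  · have h1 := gradient_flow_energy hA hconv hf hu ht
    have h2 : 0 ≤ ∫ s in (0 : ℝ)..t, ‖f s - A (u s)‖ ^ 2 :=
      intervalIntegral.integral_nonneg ht.1 fun _ _ => sq_nonneg _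
    have h3 : ∫ s in (0 : ℝ)..t, ‖f s‖ ^ 2 ≤ ∫ s in (0 : ℝ)..T, ‖f s‖ ^ 2 := by
      refine intervalIntegral.integral_mono_interval le_rfl ht.1 ht.2
        (ae_of_all _ fun _ => sq_nonneg _) ?_
      exact intervalIntegrable_of_continuousOn_Icc (hf.norm.pow 2) ⟨le_rfl, hT⟩ ⟨hT, le_rfl⟩
    rw [le_div_iff₀ hc, mul_comm]
    linarith [(hJ (u t)).1]
  · have h1 := gradient_flow_energy hA hconv hf hu (t := T) ⟨hT, le_rfl⟩
    linarith [hJn (u T)]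

end FlowBounds

/-! ### The semi-discrete problem -/

section Semidiscrete
variable {d : ℕ} {Ω : TopologicalSpace.Opens (RVec d)} {δ p : ℝ}
  {𝒯 : Triangulation Ω} {hp : 1 < p} {k r : ℕ}

/-- The semi-discrete problem is the flow of the stress operator `A`, with right-hand side the
projection of `f` onto `V_h`. -/
theorem isSemidiscreteSolution_iff {T : ℝ} (hT : 0 < T) {A : Vh 𝒯 hp k r → Vh 𝒯 hp k r}
    (hAc : Continuous A)
    (hA : ∀ u ξ, inner ℝ (A u) ξ = stressPairing Ω δ p u.1 ξ.1) {f : ℝ → Lp (RVec d) 2 (volOn Ω)}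
    {g : ℝ → Vh 𝒯 hp k r} (hg : ∀ t ξ, inner ℝ (g t) ξ = inner ℝ (f t) ξ.1)
    (hgc : ContinuousOn g (Icc 0 T))
    {u₀ : Vh 𝒯 hp k r} {u : ℝ → Vh 𝒯 hp k r} :
    IsSemidiscreteSolution 𝒯 hp k r δ T f u₀ u ↔
      u 0 = u₀ ∧ ∀ t ∈ Icc 0 T, HasDerivWithinAt u (g t - A (u t)) (Icc 0 T) t := by
  have hud := uniqueDiffOn_Icc hT
  constructor
  · rintro ⟨h1, h2, h3⟩
    refine ⟨h2, fun t ht => ?_⟩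
    have h4 := (h1.differentiableOn one_ne_zero t ht).hasDerivWithinAt
    have h5 : derivWithin u (Icc 0 T) t = g t - A (u t) := by
      refine ext_inner_right ℝ fun ξ => ?_
      rw [inner_sub_left, hA, hg, ← h3 t ht ξ, add_sub_cancel_right]
      rfl
    rwa [h5] at h4
  · rintro ⟨h1, h2⟩
    have h3 : ∀ t ∈ Icc 0 T, derivWithin u (Icc 0 T) t = g t - A (u t) := fun t ht =>
      (h2 t ht).derivWithin (hud t ht)
    have huc : ContinuousOn u (Icc 0 T) := fun s hs => (h2 s hs).continuousWithinAt
    refine ⟨(contDiffOn_one_iff_derivWithin hud).2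
      ⟨fun t ht => (h2 t ht).differentiableWithinAt, ?_⟩, h1,
      fun t ht ξ => ?_⟩
    · exact (hgc.sub (hAc.comp_continuousOn huc)).congr h3
    · have h4 : inner ℝ (timeDeriv T u t) ξ = inner ℝ (g t) ξ - inner ℝ (A (u t)) ξ := by
        rw [timeDeriv, h3 t ht, inner_sub_left]
      rw [hA, hg] at h4
      have h5 : inner ℝ (timeDeriv T u t) ξ = inner ℝ (timeDeriv T u t).1 ξ.1 := rfl
      rw [← h5, h4, sub_add_cancel]

end Semidiscrete

theorem mainTheorem4 (d : ℕ) (hd : 2 ≤ d) (Ω : TopologicalSpace.Opens (RVec d))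
    (hΩc : IsConnected (Ω : Set (RVec d))) (hΩb : Bornology.IsBounded (Ω : Set (RVec d)))
    (hΩL : HasLipschitzBoundary (Ω : Set (RVec d)))
    (p : ℝ) (hp : 1 < p) (hpd : 2 * (d : ℝ) / ((d : ℝ) + 2) ≤ p) (T : ℝ) (hT : 0 < T) :
    ∃ (c₁ : ℝ → ℝ) (c₂ : ℝ → ℝ → ℝ),
      ∀ (δ : ℝ), δ ∈ Icc (0 : ℝ) 1 →
      ∀ (𝒯 : Triangulation Ω) (σ₀ : ℝ), 𝒯.NonDegenerate σ₀ →
      ∀ (k r : ℕ) (cI : ℝ), InterpolationAssumption 𝒯 p k r cI →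
      ∀ (M₁ M₃ : ℝ), 0 < M₁ → 0 < M₃ →
      ∀ (f f' : ℝ → Lp (RVec d) 2 (volOn Ω)), MemW12Time T f f' → ContinuousOn f (Icc 0 T) →
      ∀ u₀ ∈ W01 Ω p, weakDiv Ω u₀ =ᵐ[volOn Ω] 0 →
        (eLpNorm f 2 (volTime T) + eLpNorm f' 2 (volTime T)) +
          (eLpNorm u₀ (ENNReal.ofReal p) (volOn Ω) +
            eLpNorm (weakGrad Ω u₀) (ENNReal.ofReal p) (volOn Ω)) ≤ ENNReal.ofReal M₁ →
      ∀ (N : RVec d → EuclideanSpace ℝ ((Fin d × Fin d) × Fin d)),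
        HasWeakGrad Ω (fun x => stressS δ p (symGrad Ω u₀ x)) N →
        eLpNorm N 2 (volOn Ω) ≤ ENNReal.ofReal M₃ →
      (∃! u₀h : Vh 𝒯 hp k r, IsNonlinearProjection 𝒯 hp k r δ u₀ u₀h) ∧
      ∀ u₀h : Vh 𝒯 hp k r, IsNonlinearProjection 𝒯 hp k r δ u₀ u₀h →
        ∃ u : ℝ → Vh 𝒯 hp k r, IsSemidiscreteSolution 𝒯 hp k r δ T f u₀h u ∧
          (∀ v : ℝ → Vh 𝒯 hp k r,
            IsSemidiscreteSolution 𝒯 hp k r δ T f u₀h v → EqOn v u (Icc 0 T)) ∧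
          ∃ Φ Φ' : ℝ → Lp (RTen d) 2 (volOn Ω),
            (∀ t ∈ Icc 0 T, Φ t =ᵐ[volOn Ω] fun x => tensorF δ p (symGrad Ω (u t).1 x)) ∧
            MemW12Time T Φ Φ' ∧
            eLpNorm (fun t => (u t).1) ⊤ (volTime T) + eLpNorm Φ 2 (volTime T) ≤
              ENNReal.ofReal (c₁ M₁) ∧
            eLpNorm (fun t => (timeDeriv T u t).1) 2 (volTime T) + eLpNorm Φ ⊤ (volTime T) ≤
              ENNReal.ofReal (c₁ M₁) ∧
            eLpNorm (fun t => (timeDeriv T u t).1) ⊤ (volTime T) + eLpNorm Φ' 2 (volTime T) ≤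
              ENNReal.ofReal (c₂ M₁ M₃) := by
  have : IsFiniteMeasure (volOn Ω) := ⟨by simpa using hΩb.measure_lt_top⟩
  obtain ⟨K, hK⟩ := exists_eLpNorm_le_symGrad hd hΩb hp hpd
  have hp0 : 0 < p := by linarith
  have hmc := monoConst_pos hp
  have hpc := potConst_pos p
  -- bounds for the dissipation and the norm of the discrete initial value
  set m : ℝ := (volOn Ω).real univ with hm
  have hm0 : 0 ≤ m := measureReal_nonneg
  obtain ⟨B, hB⟩ : ∃ B : ℝ → ℝ, ∀ M,
      B M = m / 2 + 2 * (4 ^ (1 / (p - 1)) * (2 ^ p * (m + M ^ p))) := ⟨_, fun _ => rfl⟩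
  obtain ⟨R, hR⟩ : ∃ R : ℝ → ℝ, ∀ M, R M = ((K : ℝ) ^ p * (2 * B M + m)) ^ p⁻¹ := ⟨_, fun _ => rfl⟩
  -- bound for the initial time derivative
  obtain ⟨Q, hQ⟩ : ∃ Q : ℝ → ℝ → ℝ, ∀ M M₃,
      Q M M₃ = (T⁻¹ * (√T * M) + √T * M) + (d : ℝ) ^ 2 * M₃ := ⟨_, fun _ _ => rfl⟩
  refine ⟨fun M => (2 * (R M + 2 * (√T * M))) +
    (√(2 * B M + M ^ 2) + √((B M + M ^ 2) / potConst p)),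
    fun M M₃ => (Q M M₃ + 2 * (√T * M)) + (√(2 * monoConst p))⁻¹ * (Q M M₃ + 4 * (√T * M)),
    fun δ hδ 𝒯 σ₀ _ k r cI _ M₁ M₃ hM₁ hM₃ f f' hf hfc u₀ hu₀ _ hdata N hN hN3 => ?_⟩
  have hu₀' : MemW0 Ω p u₀ := hu₀
  have hfM : eLpNorm f 2 (volTime T) ≤ ENNReal.ofReal M₁ :=
    le_self_add.trans (le_self_add.trans hdata)
  have hf'M : eLpNorm f' 2 (volTime T) ≤ ENNReal.ofReal M₁ :=
    le_add_self.trans (le_self_add.trans hdata)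
  have hGM : eLpNorm (weakGrad Ω u₀) (ENNReal.ofReal p) (volOn Ω) ≤ ENNReal.ofReal M₁ :=
    le_add_self.trans (le_add_self.trans hdata)
  have hB0 : 0 ≤ B M₁ := by rw [hB]; positivity
  have hR0 : 0 ≤ R M₁ := by rw [hR]; positivity
  have hQ0 : 0 ≤ Q M₁ M₃ := by rw [hQ]; positivity
  refine ⟨existsUnique_nonlinearProjection hδ hK hu₀', fun w hw => ?_⟩
  have : FiniteDimensional ℝ (Vh 𝒯 hp k r) := finiteDimensional_Vh 𝒯 hp k r
  have : CompleteSpace (Vh 𝒯 hp k r) := FiniteDimensional.complete ℝ _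
  obtain ⟨A, Ψ, J, hAc, hA, hΨ, hmono, hself, hconv, hJ⟩ :=
    exists_stress_operator (𝒯 := 𝒯) (hp := hp) (k := k) (r := r) hδ
  have hΨc : Continuous Ψ := continuous_of_norm_sq_sub_le hAc hmc hmono
  have hmono0 : ∀ u v, 0 ≤ inner ℝ (A u - A v) (u - v) := fun u v =>
    le_trans (by positivity) (hmono u v)
  set g : ℝ → Vh 𝒯 hp k r := fun t => (Vh 𝒯 hp k r).orthogonalProjectionOnto (f t) with hgdef
  have hg : ∀ t ξ, inner ℝ (g t) ξ = inner ℝ (f t) ξ.1 := fun t ξ =>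
    Submodule.inner_orthogonalProjectionOnto_eq_of_mem_right ξ (f t)
  have hgc : ContinuousOn g (Icc 0 T) := (ContinuousLinearMap.continuous _).comp_continuousOn hfc
  have hgn : ∀ t, ‖g t‖ ≤ ‖f t‖ := fun t => Submodule.norm_orthogonalProjectionOnto_apply_le _ _
  have hgd : ∀ s t, ‖g t - g s‖ ≤ ‖f t - f s‖ := fun s t => by
    simp only [hgdef]
    rw [← map_sub]
    exact Submodule.norm_orthogonalProjectionOnto_apply_le _ _
  have hint : ∀ {h : ℝ → ℝ}, ContinuousOn h (Icc 0 T) → IntervalIntegrable h volume 0 T := fun hh =>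
    intervalIntegrable_of_continuousOn_Icc hh ⟨le_rfl, hT.le⟩ ⟨hT.le, le_rfl⟩
  -- bounds on the right-hand side
  have hf1 : ∫ t in (0 : ℝ)..T, ‖f t‖ ≤ √T * M₁ := integral_norm_le_sqrt_mul hT.le hf.1 hM₁.le hfM
  have hf'1 : ∫ t in (0 : ℝ)..T, ‖f' t‖ ≤ √T * M₁ :=
    integral_norm_le_sqrt_mul hT.le hf.2.1 hM₁.le hf'M
  have hg1 : ∫ t in (0 : ℝ)..T, ‖g t‖ ≤ √T * M₁ :=
    (intervalIntegral.integral_mono_on hT.le (hint hgc.norm) (hint hfc.norm) fun t _ =>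
      hgn t).trans hf1
  have hg2 : ∫ t in (0 : ℝ)..T, ‖g t‖ ^ 2 ≤ M₁ ^ 2 :=
    (intervalIntegral.integral_mono_on hT.le (hint (hgc.norm.pow 2))
      (hint (hfc.norm.pow 2)) fun t _ =>
      pow_le_pow_left₀ (norm_nonneg _) (hgn t) 2).trans
      ((eLpNorm_two_volTime_le_iff hT.le hf.1 hM₁.le).1 hfM)
  have hgh : ∀ h ∈ Ioo 0 T, ∫ s in (0 : ℝ)..(T - h), ‖g (s + h) - g s‖ ≤ h * (√T * M₁) := by
    intro h hh
    have hTh : 0 ≤ T - h := by linarith [hh.2]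
    have hm1 : MapsTo (fun s => s + h) (Icc 0 (T - h)) (Icc 0 T) := fun s hs =>
      ⟨by linarith [hs.1, hh.1], by linarith [hs.2]⟩
    have hm2 : Icc 0 (T - h) ⊆ Icc 0 T := Icc_subset_Icc_right (by linarith [hh.1])
    have hi : ∀ {Z : Type} [NormedAddCommGroup Z] {e : ℝ → Z}, ContinuousOn e (Icc 0 T) →
        IntervalIntegrable (fun s => ‖e (s + h) - e s‖) volume 0 (T - h) := fun he =>
      intervalIntegrable_of_continuousOn_Icc
        (((he.comp (continuous_add_const h).continuousOn hm1).sub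
        (he.mono hm2)).norm) ⟨le_rfl, hTh⟩ ⟨hTh, le_rfl⟩
    refine (intervalIntegral.integral_mono_on hTh (hi hgc) (hi hfc) fun s _ => hgd _ _).trans ?_
    refine (hf.integral_norm_increment_le hT hfc hh).trans ?_
    have := hh.1
    gcongr
  -- the initial value
  have hw1 : ‖Ψ w‖ ^ 2 ≤ B M₁ := by
    rw [← hself, hA, stressPairing_self hδ.1, hB]
    exact dissipation_nonlinearProjection_le hδ hu₀' hM₁.le hGM hw
  have hw2 : ‖w‖ ≤ R M₁ := by
    have h1 := norm_rpow_le_dissipation hδ hK w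
    rw [← stressPairing_self hδ.1, ← hA, hself] at h1
    have h2 : ‖w‖ ^ p ≤ (K : ℝ) ^ p * (2 * B M₁ + m) := h1.trans (by gcongr)
    rw [hR]
    exact (Real.le_rpow_inv_iff_of_pos (norm_nonneg _) (by positivity) hp0).2 h2
  obtain ⟨u, hu0, hu⟩ := exists_monotone_flow hAc hmono0 hT hgc w
  have hder : ∀ t ∈ Icc 0 T, timeDeriv T u t = g t - A (u t) := fun t ht =>
    (hu t ht).derivWithin (uniqueDiffOn_Icc hT t ht)
  have huc : ContinuousOn u (Icc 0 T) := fun s hs => (hu s hs).continuousWithinAt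
  have hderc : ContinuousOn (timeDeriv T u) (Icc 0 T) :=
    (hgc.sub (hAc.comp_continuousOn huc)).congr hder
  -- the time derivative at the initial time, by integration by parts in `(S(Du₀), Dξ)`
  have hinit : ‖g 0 - A (u 0)‖ ≤ Q M₁ M₃ := by
    have hN2 : MemLp N 2 (volOn Ω) :=
      ⟨hN.2.1.aestronglyMeasurable, hN3.trans_lt ENNReal.ofReal_lt_top⟩
    set ξ := g 0 - A (u 0) with hξ
    have h1 : ‖ξ‖ ^ 2 = inner ℝ (g 0) ξ - stressPairing Ω δ p u₀ ξ.1 := by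
      rw [← hw ξ, ← hA, ← inner_sub_left, ← hu0, ← hξ, real_inner_self_eq_norm_sq]
    have h2 := abs_stressPairing_le hδ hp hK hu₀' (memW0_Vh ξ) (Lp.memLp ξ.1) hN hN2
    rw [← Lp.norm_def] at h2
    have h3 : (eLpNorm N 2 (volOn Ω)).toReal ≤ M₃ := ENNReal.toReal_le_of_le_ofReal hM₃.le hN3
    have h4 : ‖g 0‖ ≤ T⁻¹ * (√T * M₁) + √T * M₁ := by
      refine (hgn 0).trans ((hf.norm_le hT hfc ⟨le_rfl, hT.le⟩).trans ?_)
      gcongr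
    have h5 := real_inner_le_norm (g 0) ξ
    have h6 : |stressPairing Ω δ p u₀ ξ.1| ≤ (d : ℝ) ^ 2 * (M₃ * ‖ξ‖) := by
      refine h2.trans ?_
      gcongr
      exact le_rfl
    have h7 : ‖ξ‖ * ‖ξ‖ ≤ Q M₁ M₃ * ‖ξ‖ := by
      have h8 : ‖g 0‖ * ‖ξ‖ ≤ (T⁻¹ * (√T * M₁) + √T * M₁) * ‖ξ‖ := by gcongr
      have h9 := neg_abs_le (stressPairing Ω δ p u₀ ξ.1)
      rw [hQ]
      nlinarith
    rcases eq_or_lt_of_le (norm_nonneg ξ) with h | h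
    · rw [← h]; exact hQ0
    · exact le_of_mul_le_mul_right h7 h
  have hE1 := flow_energy_bound hT.le hAc hΨc hself hgc hu (hu0 ▸ hw2) hg1
  have hE2 := flow_potential_bound hT.le hAc hpc hconv hJ hgc hu (hu0 ▸ hw1) hg2
  have hE3 : ∀ t ∈ Icc 0 T, ‖g t - A (u t)‖ ≤ Q M₁ M₃ + 2 * (√T * M₁) := fun t ht =>
    (norm_deriv_monotone_flow_le hAc hmc hmono hT hgc hu hgh ht).trans (by linarith)
  have hE4 : ∀ h ∈ Ioo 0 T, ∫ s in (0 : ℝ)..(T - h), ‖Ψ (u (s + h)) - Ψ (u s)‖ ^ 2 ≤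
      ((√(2 * monoConst p))⁻¹ * (Q M₁ M₃ + 4 * (√T * M₁)) * h) ^ 2 := fun h hh => by
    refine (integral_norm_sq_increment_le hAc hmc hmono hT hgc hu hgh hh).trans ?_
    have := hh.1
    gcongr
  have hΨu : ContinuousOn (fun t => Ψ (u t)) (Icc 0 T) := hΨc.comp_continuousOn huc
  obtain ⟨Φ', hΦ', hΦ'n⟩ := exists_memW12Time_of_diffQuot hT hΨu (by positivity) hE4
  refine ⟨u, (isSemidiscreteSolution_iff hT hAc hA hg hgc).2 ⟨hu0, hu⟩, fun v hv => ?_,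
    fun t => Ψ (u t), Φ', fun t _ => hΨ (u t), hΦ', ?_, ?_, ?_⟩
  · obtain ⟨hv0, hv'⟩ := (isSemidiscreteSolution_iff hT hAc hA hg hgc).1 hv
    exact monotone_flow_unique hAc hmono0 hT.le hgc hv' hu (hv0.trans hu0.symm)
  · have h1 : eLpNorm (fun t => (u t).1) ⊤ (volTime T) ≤ ENNReal.ofReal (R M₁ + 2 * (√T * M₁)) :=
      eLpNorm_top_volTime_le hE1.1
    have h2 : eLpNorm (fun t => Ψ (u t)) 2 (volTime T) ≤ ENNReal.ofReal (R M₁ + 2 * (√T * M₁)) :=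
      (eLpNorm_two_volTime_le_iff hT.le (memLp_two_of_continuousOn hΨu) (by positivity)).2 hE1.2
    refine (add_le_add h1 h2).trans ?_
    rw [← ENNReal.ofReal_add (by positivity) (by positivity)]
    refine ENNReal.ofReal_le_ofReal ?_
    have := Real.sqrt_nonneg (2 * B M₁ + M₁ ^ 2)
    have := Real.sqrt_nonneg ((B M₁ + M₁ ^ 2) / potConst p)
    linarith
  · have h1 : eLpNorm (fun t => (timeDeriv T u t).1) 2 (volTime T) ≤
        ENNReal.ofReal (√(2 * B M₁ + M₁ ^ 2)) := by
      have hc : ContinuousOn (fun t => (timeDeriv T u t).1) (Icc 0 T) :=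
        continuous_subtype_val.comp_continuousOn hderc
      rw [eLpNorm_two_volTime_le_iff hT.le (memLp_two_of_continuousOn hc) (Real.sqrt_nonneg _),
        Real.sq_sqrt (by positivity)]
      refine le_of_eq_of_le (intervalIntegral.integral_congr fun t ht => ?_) hE2.2
      rw [uIcc_of_le hT.le] at ht
      exact congrArg (fun z : Vh 𝒯 hp k r => ‖z‖ ^ 2) (hder t ht)
    have h2 : eLpNorm (fun t => Ψ (u t)) ⊤ (volTime T) ≤
        ENNReal.ofReal (√((B M₁ + M₁ ^ 2) / potConst p)) :=
      eLpNorm_top_volTime_le fun t ht => Real.le_sqrt_of_sq_le (hE2.1 t ht)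
    refine (add_le_add h1 h2).trans ?_
    rw [← ENNReal.ofReal_add (Real.sqrt_nonneg _) (Real.sqrt_nonneg _)]
    have hD0 : 0 ≤ √T * M₁ := by positivity
    exact ENNReal.ofReal_le_ofReal (by linarith)
  · have h1 : eLpNorm (fun t => (timeDeriv T u t).1) ⊤ (volTime T) ≤
        ENNReal.ofReal (Q M₁ M₃ + 2 * (√T * M₁)) := by
      refine eLpNorm_top_volTime_le fun t ht => ?_
      rw [hder t ht]
      exact hE3 t ht
    refine (add_le_add h1 hΦ'n).trans ?_
    rw [← ENNReal.ofReal_add (by positivity) (by positivity)]
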